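/- **Setting.** Let $d\ge 1$ and let $\xi:\mathbb R^d\to[0,\infty]$ be continuous and spherically symmetric, with $\xi(0)=0$ and $C=\int_{\mathbb R^d} e^{-\xi(x)}\,dx<\infty$. Suppose that the Fourier transform of $e^{-\xi}$ is nonnegative, and define $\varepsilon(k)\in[0,\infty]$ by $$C e^{-\varepsilon(k)}=\int_{\mathbb R^d} e^{-2\pi i k\cdot x}\,e^{-\xi(x)}\,dx ,\qquad \rho_c=\int_{\mathbb R^d}\frac{dk}{e^{\varepsilon(k)}-1}\in(0,\infty].$$ For $L>0$ let $\Lambda=(0,L)^d$ and $V=L^d$, and define $\xi_\Lambda$ by $e^{-\xi_\Lambda(x)}=\sum_{y\in\mathbb Z^d}e^{-\xi(x-Ly)}$. Suppose that $\xi_\Lambda(x)\to\xi(x)$ as $V\to\infty$, for every $x\in\mathbb R^d$. For $N\ge 0$, $x\in\Lambda^N$ and a permutation $\pi\in\mathcal S_N$ let $$H(x,\pi)=\sum_{i=1}^N\xi_\Lambda(x_i-x_{\pi(i)}),\qquad Z(\Lambda,N)=\frac1{N!}\int_{\Lambda^N}\sum_{\pi\in\mathcal S_N}e^{-H(x,\pi)}\,dx,$$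 $$E_{\Lambda,N}(\theta)=\frac{1}{Z(\Lambda,N)\,N!}\int_{\Lambda^N}\sum_{\pi\in\mathcal S_N}\theta(\pi)\,e^{-H(x,\pi)}\,dx$$ for $\theta:\mathcal S_N\to[0,\infty)$. For real $m,n$ let $$\varrho_{m,n}(\pi)=\frac1V\,\#\{i=1,\dots,N: m\le \ell_i(\pi)\le n\},$$ where $\ell_i(\pi)$ is the length of the cycle of $\pi$ that contains $i$. Write $E_{\Lambda,\rho V}$ for $E_{\Lambda,N}$ with $N=\lfloor\rho V\rfloor$. **Theorem.** Let $\rho\ge0$. In the case where both $d=1$ and $\rho>\rho_c$, suppose in addition that $\xi$ is a nondecreasing function of $|x|$ on $\{|x|\ge R\}$ for some $R$. Then for all $0<a<b<1$ and all $s\ge0$: for all sufficiently large $V$ one has $0<Z(\Lambda,\lfloor\rho V\rfloor)<\infty$, and (a) $\displaystyle\lim_{V\to\infty}E_{\Lambda,\rho V}(\varrho_{1,V^a})=\min(\rho,\rho_c)$; (b) $\displaystyle\lim_{V\to\infty}E_{\Lambda,\rho V}(\varrho_{V^a,V^b})=0$; (c) $\displaystyle\lim_{V\to\infty}E_{\Lambda,\rho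 V}(\varrho_{V^b,sV})=\min\bigl(s,\max(0,\rho-\rho_c)\bigr)$ (so the limit in (c) is $0$ if $\rho\le\rho_c$, it is $s$ if $0\le s\le\rho-\rho_c$, and it is $\rho-\rho_c$ if $0\le\rho-\rho_c\le s$). -/

import Mathlib

open MeasureTheory Filter Topology
open scoped ENNReal FourierTransform ComplexOrder

namespace SpatialPermutation

noncomputable section

/-- The Euclidean space `ℝ^d`. -/
abbrev Space (d : ℕ) : Type := EuclideanSpace ℝ (Fin d)

/-- The weight `e^{-ξ(x)} ∈ [0, 1]` of a jump function `ξ : ℝ^d → [0, ∞]`. -/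
def weight {d : ℕ} (ξ : Space d → ℝ≥0∞) (x : Space d) : ℝ≥0∞ :=
  EReal.exp (-(ξ x : EReal))

/-- The normalisation `C = ∫ e^{-ξ}`. -/
def normC {d : ℕ} (ξ : Space d → ℝ≥0∞) : ℝ≥0∞ := ∫⁻ x, weight ξ x

/-- The Fourier transform `k ↦ ∫ e^{-2π i k·x} e^{-ξ(x)} dx`. -/
def weightFourier {d : ℕ} (ξ : Space d → ℝ≥0∞) (k : Space d) : ℂ :=
  𝓕 (fun x : Space d => ((weight ξ x).toReal : ℂ)) k

/-- The dispersion relation `ε(k)`, defined by `C e^{-ε(k)} = ∫ e^{-2π i k·x} e^{-ξ(x)} dx`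
when the right side is nonnegative; `ε(k) = ∞` where the Fourier transform vanishes. -/
def dispersion {d : ℕ} (ξ : Space d → ℝ≥0∞) (k : Space d) : EReal :=
  -ENNReal.log (ENNReal.ofReal (weightFourier ξ k).re / normC ξ)

/-- The critical density `ρ_c = ∫ dk / (e^{ε(k)} - 1) ∈ [0, ∞]`. -/
def criticalDensity {d : ℕ} (ξ : Space d → ℝ≥0∞) : ℝ≥0∞ :=
  ∫⁻ k : Space d, (EReal.exp (dispersion ξ k) - 1)⁻¹

/-- The vector `L y` for `y ∈ ℤ^d`. -/
def latticeVec {d : ℕ} (L : ℝ) (y : Fin d → ℤ) : Space d :=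
  WithLp.toLp 2 fun j => L * (y j : ℝ)

/-- The periodised jump function `ξ_Λ`: `e^{-ξ_Λ(x)} = ∑_{y ∈ ℤ^d} e^{-ξ(x - L y)}`. -/
def periodised {d : ℕ} (ξ : Space d → ℝ≥0∞) (L : ℝ) (x : Space d) : EReal :=
  -ENNReal.log (∑' y : Fin d → ℤ, weight ξ (x - latticeVec L y))

/-- The cubic box `Λ` of side `L`. -/
def box (d : ℕ) (L : ℝ) : Set (Space d) := {x | ∀ j, x j ∈ Set.Ioo 0 L}

/-- The Hamiltonian `H(x, π) = ∑_i ξ_Λ(x_i - x_{π(i)})`. -/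
def hamiltonian {d : ℕ} (ξ : Space d → ℝ≥0∞) (L : ℝ) {N : ℕ}
    (x : Fin N → Space d) (π : Equiv.Perm (Fin N)) : EReal :=
  ∑ i, periodised ξ L (x i - x (π i))

/-- The partition function `Z(Λ, N) = (1/N!) ∫_{Λ^N} ∑_π e^{-H(x, π)} dx`. -/
def partitionFunction {d : ℕ} (ξ : Space d → ℝ≥0∞) (L : ℝ) (N : ℕ) : ℝ≥0∞ :=
  (N.factorial : ℝ≥0∞)⁻¹ * ∫⁻ x in Set.univ.pi fun _ : Fin N => box d L,
    ∑ π : Equiv.Perm (Fin N), EReal.exp (-hamiltonian ξ L x π)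

/-- The expectation `E_{Λ,N}(θ) = (1/(Z(Λ,N) N!)) ∫_{Λ^N} ∑_π θ(π) e^{-H(x, π)} dx`
of a nonnegative random variable `θ` on permutations. -/
def expectation {d : ℕ} (ξ : Space d → ℝ≥0∞) (L : ℝ) (N : ℕ)
    (θ : Equiv.Perm (Fin N) → ℝ≥0∞) : ℝ≥0∞ :=
  (∫⁻ x in Set.univ.pi fun _ : Fin N => box d L,
    ∑ π : Equiv.Perm (Fin N), θ π * EReal.exp (-hamiltonian ξ L x π)) /
      (partitionFunction ξ L N * (N.factorial : ℝ≥0∞))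

/-- The length `ℓ_i(π)` of the cycle of `π` that contains `i`: the smallest `n ≥ 1` such that
`π^n i = i`. -/
def cycleLength {N : ℕ} (π : Equiv.Perm (Fin N)) (i : Fin N) : ℕ :=
  Function.minimalPeriod π i

/-- The density `(1/V) #{i : m ≤ ℓ_i(π) ≤ n}` of points in cycles of length between the real
numbers `m` and `n`, in volume `V`. -/
def cycleDensity (V m n : ℝ) {N : ℕ} (π : Equiv.Perm (Fin N)) : ℝ≥0∞ :=
  ENNReal.ofReal
    ((Set.ncard {i : Fin N | m ≤ (cycleLength π i : ℝ) ∧ (cycleLength π i : ℝ) ≤ n} : ℝ) / V)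

/-- `E_{Λ, ρV}` of the density of points in cycles of length between `m` and `n`, for the cubic
box `Λ` of side `L` and volume `V = L^d`, with `N = ⌊ρ V⌋` points. -/
def expectedCycleDensity {d : ℕ} (ξ : Space d → ℝ≥0∞) (ρ L m n : ℝ) : ℝ≥0∞ :=
  expectation ξ L ⌊ρ * L ^ d⌋₊ (cycleDensity (L ^ d) m n)

end

end SpatialPermutation

/-!
# Cycle lengths of ideal spatial permutations

Integrating out a marked point joins the two jumps next to it, so a cycle of length `j` contributes
the trace of the `j`-th power of the periodised kernel `e^{-ξ_Λ(x - y)}`, times the weight of the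
permutations of the remaining `N - j` points (`lintegral_sum_cycleLength`). The kernel is
translation invariant on the torus `ℝ^d / L ℤ^d` and its Fourier coefficients are nonnegative; hence
Poisson summation holds without decay assumptions (`hasSum_periodicSum_zero`), and the trace of the
`j`-th power is `C^j t_j` with `t_j = ∑ λ(k)^j` over `k ∈ L⁻¹ ℤ^d`, `λ = e^{-ε}`
(`kernelTrace_box`). It follows that `Z(Λ, N) = C^N h_N`, where `h_N` is the complete homogeneous
symmetric function of the mode weights `λ(k)` (`permWeight_eq`), and that the expected density of
points in cycles of length `j` is `t_j h_{N-j} / (h_N V)`. The problem becomes one about the ideal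
Bose gas with modes `k`, whose ground state `k = 0` has `λ = 1`.

Since `t_j / V` tends to `∫ λ^j`, and `∑ ∫ λ^j = ∫ λ / (1 - λ) = ρ_c`, finite cycles can carry a
density of at most `ρ_c`.

* If `ρ ≤ ρ_c`, they carry everything. The sequence `h` is log-concave, so the ratios
  `h_{N-j-1} / h_{N-j}` are monotone in `j`. If they are near `1` up to a large `j`, the finite cycles
  exhaust the density; otherwise `h_{N-j} / h_N` decays exponentially (`exists_tail_le`).
* If `ρ > ρ_c`, write `t_j = 1 + (t_j - 1)`. The excited modes contribute nothing to cycles whose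
  length diverges, and their particle number has mean `(ρ_c + o(1)) V` and variance `o(V²)`, which is
  a matter of Riemann sums of functions bounded by `λ / (1 - λ)` (`tendsto_tsum_of_le_occupation`,
  `tendsto_excitedSum_div_sq`). By Chebyshev's inequality the ground state holds
  `(ρ - ρ_c + o(1)) V` particles, with cycle lengths uniform on that scale
  (`tendsto_sum_homog_div`). The Riemann sums converge because `1 - λ` at a grid point near the
  origin is comparable with its values nearby (`exists_gap_comparison`). In dimension `d ≥ 2` this
  follows from rotation invariance, as short vectors are sums of two vectors of a given larger
  length; on the line it uses the monotone tails of `ξ`.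

The two cases are combined in `tendsto_sum_cycles`.
-/

namespace SpatialPermutation

/-! ### Weighted permutations and the cycle recursion -/

section Cycles

open Equiv Equiv.Perm

/-- The composition `(κ ∘ K)(x, y) = ∫ κ(x, z) K(z, y) dμ(z)` of two kernels. -/
noncomputable def kernelComp {X : Type*} [MeasurableSpace X] (μ : Measure X)
    (κ K : X → X → ℝ≥0∞) (x y : X) : ℝ≥0∞ :=
  ∫⁻ z, κ x z * K z y ∂μ

/-- The kernel `κ ∘ K ∘ ⋯ ∘ K` with `j` factors `K`. -/
noncomputable def kernelIter {X : Type*} [MeasurableSpace X] (μ : Measure X)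
    (K κ : X → X → ℝ≥0∞) : ℕ → X → X → ℝ≥0∞
  | 0 => κ
  | j + 1 => kernelComp μ (kernelIter μ K κ j) K

/-- The trace `∫ κ(x, x) dμ(x)` of a kernel. -/
noncomputable def kernelTrace {X : Type*} [MeasurableSpace X] (μ : Measure X)
    (κ : X → X → ℝ≥0∞) : ℝ≥0∞ :=
  ∫⁻ x, κ x x ∂μ

/-- The total weight `∫ ∑_π ∏_i K(x_i, x_{π(i)}) dμ^N(x)` of the permutations of `N` points. -/
noncomputable def permWeight {X : Type*} [MeasurableSpace X] (μ : Measure X)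
    (K : X → X → ℝ≥0∞) (N : ℕ) : ℝ≥0∞ :=
  ∫⁻ x : Fin N → X, ∑ π : Perm (Fin N), ∏ i, K (x i) (x (π i)) ∂Measure.pi fun _ => μ

/-- The weight of a permutation `π` of the points `x`, where the jump that arrives at the marked
index `q` is weighted by `κ` and all other jumps by `K`. -/
noncomputable def markedProd {X : Type*} (K κ : X → X → ℝ≥0∞) {N : ℕ} (q : Fin N) (x : Fin N → X)
    (π : Perm (Fin N)) : ℝ≥0∞ :=
  ∏ i, if π i = q then κ (x i) (x (π i)) else K (x i) (x (π i))

/-- The integral of `∑_π f(ℓ_q(π))` times the weight of `π` marked at `q`. -/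
noncomputable def markedWeight {X : Type*} [MeasurableSpace X] (μ : Measure X)
    (K κ : X → X → ℝ≥0∞) (f : ℕ → ℝ≥0∞) (N : ℕ) (q : Fin N) : ℝ≥0∞ :=
  ∫⁻ x : Fin N → X, ∑ π : Perm (Fin N), f (cycleLength π q) * markedProd K κ q x π
    ∂Measure.pi fun _ => μ

theorem cycleLength_conj {N : ℕ} (σ π : Perm (Fin N)) (q : Fin N) :
    cycleLength (σ * π * σ⁻¹) (σ q) = cycleLength π q := by
  unfold cycleLength
  rw [Function.minimalPeriod_eq_minimalPeriod_iff]
  intro n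
  have h : ((⇑(σ * π * σ⁻¹))^[n]) (σ q) = σ (π^[n] q) := by
    have : Function.Semiconj σ π (⇑(σ * π * σ⁻¹)) := by intro x; simp
    exact (this.iterate_right n q).symm
  unfold Function.IsPeriodicPt Function.IsFixedPt
  rw [h, EmbeddingLike.apply_eq_iff_eq]

theorem markedProd_conj {X : Type*} (K κ : X → X → ℝ≥0∞) {N : ℕ} (σ π : Perm (Fin N)) (q : Fin N)
    (x : Fin N → X) :
    markedProd K κ (σ q) x (σ * π * σ⁻¹) = markedProd K κ q (x ∘ σ) π := by
  unfold markedProd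
  rw [← Equiv.prod_comp σ]
  simp

theorem markedWeight_eq {X : Type*} [MeasurableSpace X] (μ : Measure X) [SigmaFinite μ]
    (K κ : X → X → ℝ≥0∞) (f : ℕ → ℝ≥0∞) {N : ℕ} (q q' : Fin N) :
    markedWeight μ K κ f N q = markedWeight μ K κ f N q' := by
  obtain ⟨σ, rfl⟩ : ∃ σ : Perm (Fin N), σ q = q' := ⟨swap q q', swap_apply_left q q'⟩
  unfold markedWeight
  have hmp := measurePreserving_piCongrLeft (fun _ : Fin N => μ) σ.symm
  rw [← hmp.lintegral_comp_emb (MeasurableEquiv.measurableEmbedding _)]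
  refine lintegral_congr fun x => ?_
  rw [← (MulAut.conj σ).toEquiv.sum_comp (fun π => f (cycleLength π (σ q)) * _)]
  refine Finset.sum_congr rfl fun π _ => ?_
  have h1 := cycleLength_conj σ π q
  have h2 := markedProd_conj K κ σ π q x
  simp only [MulEquiv.toEquiv_eq_coe, EquivLike.coe_coe, MulAut.conj_apply]
  rw [h1, h2]
  congr 2
  funext i
  simpa using MeasurableEquiv.piCongrLeft_apply_apply (β := fun _ => X) σ.symm x (σ i)

theorem lintegral_pi_succ {X : Type*} [MeasurableSpace X] (μ : Measure X) [SigmaFinite μ] (N : ℕ)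
    (F : (Fin (N + 1) → X) → ℝ≥0∞) (hF : Measurable F) :
    ∫⁻ x, F x ∂(Measure.pi fun _ => μ) =
      ∫⁻ y : Fin N → X, ∫⁻ x, F (Fin.cons x y) ∂μ ∂(Measure.pi fun _ => μ) := by
  have hmp := (measurePreserving_piFinSuccAbove (fun _ : Fin (N + 1) => μ) 0).symm
  rw [← hmp.lintegral_comp_emb (MeasurableEquiv.measurableEmbedding _), lintegral_prod_symm]
  · refine lintegral_congr fun y => lintegral_congr fun x => ?_
    rw [MeasurableEquiv.piFinSuccAbove_symm_apply]
    exact congrArg F (Fin.insertNth_zero' x y)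
  · exact (hF.comp (MeasurableEquiv.measurable _)).aemeasurable

theorem cycleLength_decomposeFin_zero {N : ℕ} (e : Perm (Fin N)) :
    cycleLength (decomposeFin.symm (0, e)) 0 = 1 := by
  unfold cycleLength
  rw [Function.minimalPeriod_eq_one_iff_isFixedPt]
  simp [Function.IsFixedPt]

theorem cycleLength_decomposeFin_succ {N : ℕ} (q : Fin N) (e : Perm (Fin N)) :
    cycleLength (decomposeFin.symm (q.succ, e)) 0 = cycleLength e q + 1 := by
  set π := decomposeFin.symm (q.succ, e) with hπ
  have hpos : 0 < cycleLength e q :=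
    Function.minimalPeriod_pos_of_mem_periodicPts
      (Function.Injective.mem_periodicPts e.injective q)
  have hiter : ∀ m < cycleLength e q, π^[m + 1] 0 = (e^[m] q).succ := by
    intro m
    induction m with
    | zero => intro _; simp [hπ]
    | succ m ih =>
      intro hm
      rw [Function.iterate_succ_apply', ih (by omega), hπ, decomposeFin_symm_apply_succ,
        ← Function.iterate_succ_apply' (⇑e)]
      rw [swap_apply_of_ne_of_ne (Fin.succ_ne_zero _)]
      intro h
      have h' := Fin.succ_injective _ h
      exact Function.not_isPeriodicPt_of_pos_of_lt_minimalPeriod (Nat.succ_ne_zero m) hm h'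
  have hlast : π^[cycleLength e q + 1] 0 = 0 := by
    obtain ⟨m, hm⟩ : ∃ m, cycleLength e q = m + 1 := ⟨_, (Nat.succ_pred_eq_of_pos hpos).symm⟩
    rw [hm, Function.iterate_succ_apply', hiter m (by omega), hπ, decomposeFin_symm_apply_succ,
      ← Function.iterate_succ_apply' (⇑e)]
    have : e^[cycleLength e q] q = q := Function.iterate_minimalPeriod
    rw [hm] at this
    rw [this]; simp
  refine le_antisymm (Function.IsPeriodicPt.minimalPeriod_le (Nat.succ_pos _) hlast) ?_
  by_contra hlt
  push Not at hlt
  have hp : 0 < cycleLength π 0 :=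
    Function.minimalPeriod_pos_of_mem_periodicPts
      (Function.Injective.mem_periodicPts π.injective 0)
  obtain ⟨m, hm⟩ : ∃ m, cycleLength π 0 = m + 1 := ⟨_, (Nat.succ_pred_eq_of_pos hp).symm⟩
  have h0 : π^[cycleLength π 0] 0 = 0 := Function.iterate_minimalPeriod
  rw [hm, hiter m (by omega)] at h0
  exact Fin.succ_ne_zero _ h0

theorem markedProd_decomposeFin_zero {X : Type*} (K κ : X → X → ℝ≥0∞) {N : ℕ} (e : Perm (Fin N))
    (x : X) (y : Fin N → X) :
    markedProd K κ 0 (Fin.cons x y) (decomposeFin.symm (0, e)) =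
      κ x x * ∏ i, K (y i) (y (e i)) := by
  unfold markedProd
  rw [Fin.prod_univ_succ]
  simp

theorem markedProd_decomposeFin_succ {X : Type*} (K κ : X → X → ℝ≥0∞) {N : ℕ} (q : Fin N)
    (e : Perm (Fin N)) (x : X) (y : Fin N → X) :
    markedProd K κ 0 (Fin.cons x y) (decomposeFin.symm (q.succ, e)) =
      (κ (y (e.symm q)) x * K x (y q)) *
        ∏ i ∈ Finset.univ.erase (e.symm q), K (y i) (y (e i)) := by
  unfold markedProd
  rw [Fin.prod_univ_succ, ← Finset.mul_prod_erase Finset.univ _ (Finset.mem_univ (e.symm q))]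
  have h1 : ∀ i ∈ Finset.univ.erase (e.symm q),
      (if decomposeFin.symm (q.succ, e) i.succ = 0 then
        κ ((Fin.cons x y : Fin (N + 1) → X) i.succ)
          ((Fin.cons x y : Fin (N + 1) → X) (decomposeFin.symm (q.succ, e) i.succ)) else
        K ((Fin.cons x y : Fin (N + 1) → X) i.succ)
          ((Fin.cons x y : Fin (N + 1) → X) (decomposeFin.symm (q.succ, e) i.succ))) =
        K (y i) (y (e i)) := by
    intro i hi
    have hne : e i ≠ q := by
      rintro rfl; simp at hi
    have : swap 0 q.succ (e i).succ = (e i).succ :=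
      swap_apply_of_ne_of_ne (Fin.succ_ne_zero _) fun h => hne (Fin.succ_injective _ h)
    rw [decomposeFin_symm_apply_succ, this]
    simp
  rw [Finset.prod_congr rfl h1]
  simp
  ring

theorem markedProd_kernelComp {X : Type*} [MeasurableSpace X] (μ : Measure X)
    (K κ : X → X → ℝ≥0∞) {N : ℕ} (q : Fin N) (e : Perm (Fin N)) (y : Fin N → X) :
    markedProd K (kernelComp μ κ K) q y e =
      kernelComp μ κ K (y (e.symm q)) (y q) *
        ∏ i ∈ Finset.univ.erase (e.symm q), K (y i) (y (e i)) := by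
  unfold markedProd
  rw [← Finset.mul_prod_erase Finset.univ _ (Finset.mem_univ (e.symm q))]
  congr 1
  · simp
  · refine Finset.prod_congr rfl fun i hi => ?_
    rw [if_neg]
    rintro rfl; simp at hi

theorem measurable_markedProd {X : Type*} [MeasurableSpace X] {K κ : X → X → ℝ≥0∞}
    (hK : Measurable (Function.uncurry K)) (hκ : Measurable (Function.uncurry κ)) {N : ℕ}
    (q : Fin N) (π : Perm (Fin N)) : Measurable fun x => markedProd K κ q x π := by
  unfold markedProd
  refine Finset.measurable_prod _ fun i _ => ?_
  have h : Measurable fun x : Fin N → X => (x i, x (π i)) :=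
    (measurable_pi_apply i).prodMk (measurable_pi_apply (π i))
  split_ifs
  · exact hκ.comp h
  · exact hK.comp h

theorem measurable_kernelComp {X : Type*} [MeasurableSpace X] (μ : Measure X) [SigmaFinite μ]
    {κ K : X → X → ℝ≥0∞} (hκ : Measurable (Function.uncurry κ))
    (hK : Measurable (Function.uncurry K)) :
    Measurable (Function.uncurry (kernelComp μ κ K)) := by
  refine Measurable.lintegral_prod_right (f := fun (p : X × X) z => κ p.1 z * K z p.2) ?_
  refine Measurable.mul ?_ ?_
  · exact hκ.comp (measurable_fst.fst.prodMk measurable_snd)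
  · exact hK.comp (measurable_snd.prodMk measurable_fst.snd)

/-- Removing the marked point from its cycle: either it was a fixed point, or its removal leaves a
permutation of the other points, marked at the image of the removed point and with the two jumps at
that point merged into one by composition of kernels. -/
theorem markedWeight_succ {X : Type*} [MeasurableSpace X] (μ : Measure X) [SigmaFinite μ]
    {K κ : X → X → ℝ≥0∞} (hK : Measurable (Function.uncurry K))
    (hκ : Measurable (Function.uncurry κ)) (f : ℕ → ℝ≥0∞) (N : ℕ) :
    markedWeight μ K κ f (N + 1) 0 =
      f 1 * kernelTrace μ κ * permWeight μ K N +
        ∑ q, markedWeight μ K (kernelComp μ κ K) (fun j => f (j + 1)) N q := by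
  have hmeas : ∀ (N : ℕ) (κ : X → X → ℝ≥0∞) (hκ : Measurable (Function.uncurry κ)) (f : ℕ → ℝ≥0∞)
      (q : Fin N),
      Measurable fun x : Fin N → X =>
        ∑ π : Perm (Fin N), f (cycleLength π q) * markedProd K κ q x π := fun N κ hκ f q =>
    Finset.measurable_sum _ fun π _ => (measurable_markedProd hK hκ q π).const_mul _
  have hprod : ∀ (N : ℕ) (e : Perm (Fin N)),
      Measurable fun y : Fin N → X => ∏ i, K (y i) (y (e i)) := fun N e =>
    Finset.measurable_prod _ fun i _ => hK.comp (f := fun y : Fin N → X => (y i, y (e i)))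
      ((measurable_pi_apply i).prodMk (measurable_pi_apply (e i)))
  have hdiag : Measurable fun x => κ x x := hκ.comp (measurable_id.prodMk measurable_id)
  unfold markedWeight permWeight
  rw [lintegral_pi_succ μ N _ (hmeas _ κ hκ f 0), ← lintegral_const_mul _ (by
      exact Finset.measurable_sum _ fun e _ => hprod N e),
    ← lintegral_finsetSum _ (fun q _ => hmeas N _ (measurable_kernelComp μ hκ hK)
      (fun j => f (j + 1)) q),
    ← lintegral_add_left (by
      exact (Finset.measurable_sum _ fun e _ => hprod N e).const_mul _)]
  refine lintegral_congr fun y => ?_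
  have hsplit : ∀ x : X, (∑ π : Perm (Fin (N + 1)),
      f (cycleLength π 0) * markedProd K κ 0 (Fin.cons x y) π) =
      (f 1 * ∑ e : Perm (Fin N), ∏ i, K (y i) (y (e i))) * κ x x +
      ∑ q : Fin N, ∑ e : Perm (Fin N), (f (cycleLength e q + 1) *
        ∏ i ∈ Finset.univ.erase (e.symm q), K (y i) (y (e i))) *
          (κ (y (e.symm q)) x * K x (y q)) := by
    intro x
    rw [← decomposeFin.symm.sum_comp, Fintype.sum_prod_type, Fin.sum_univ_succ]
    congr 1
    · rw [mul_assoc, Finset.sum_mul, Finset.mul_sum]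
      refine Finset.sum_congr rfl fun e _ => ?_
      rw [cycleLength_decomposeFin_zero, markedProd_decomposeFin_zero]
      ring
    · refine Finset.sum_congr rfl fun q _ => Finset.sum_congr rfl fun e _ => ?_
      rw [cycleLength_decomposeFin_succ, markedProd_decomposeFin_succ]
      ring
  have hker : ∀ a b : X, Measurable fun x => κ a x * K x b := fun a b =>
    (hκ.comp (measurable_const.prodMk measurable_id)).mul
      (hK.comp (measurable_id.prodMk measurable_const))
  simp_rw [hsplit]
  rw [lintegral_add_left (hdiag.const_mul _), lintegral_const_mul _ hdiag,
    lintegral_finsetSum _ (fun q _ => Finset.measurable_sum _ fun e _ =>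
      (hker _ _).const_mul _)]
  congr 1
  · unfold kernelTrace; ring
  · refine Finset.sum_congr rfl fun q _ => ?_
    rw [lintegral_finsetSum _ (fun e _ => (hker _ _).const_mul _)]
    refine Finset.sum_congr rfl fun e _ => ?_
    rw [lintegral_const_mul _ (hker _ _), markedProd_kernelComp]
    unfold kernelComp
    ring

/-- The cycle through a marked point has length `j + 1` with weight
`tr(κ ∘ K^j)` times the weight of the permutations of the remaining points. -/
theorem sum_markedWeight {X : Type*} [MeasurableSpace X] (μ : Measure X) [SigmaFinite μ]
    {K : X → X → ℝ≥0∞} (hK : Measurable (Function.uncurry K)) (N : ℕ) :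
    ∀ (κ : X → X → ℝ≥0∞) (_ : Measurable (Function.uncurry κ)) (f : ℕ → ℝ≥0∞),
      ∑ q, markedWeight μ K κ f N q = (N.factorial : ℝ≥0∞) *
        ∑ j ∈ Finset.range N, f (j + 1) * kernelTrace μ (kernelIter μ K κ j) *
          (permWeight μ K (N - 1 - j) / ((N - 1 - j).factorial : ℝ≥0∞)) := by
  have hshift : ∀ (κ : X → X → ℝ≥0∞) (j : ℕ),
      kernelIter μ K (kernelComp μ κ K) j = kernelIter μ K κ (j + 1) := by
    intro κ j
    induction j with
    | zero => rfl
    | succ j ih => rw [kernelIter, ih]; rfl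
  induction N with
  | zero => intro κ _ f; simp
  | succ N ih =>
    intro κ hκ f
    have h0 : ∑ q, markedWeight μ K κ f (N + 1) q =
        ((N + 1 : ℕ) : ℝ≥0∞) * markedWeight μ K κ f (N + 1) 0 := by
      rw [Finset.sum_congr rfl fun q _ => markedWeight_eq μ K κ f q 0]
      simp
    rw [h0, markedWeight_succ μ hK hκ, ih _ (measurable_kernelComp μ hκ hK),
      Finset.sum_range_succ', Nat.factorial_succ]
    have hfac : (N.factorial : ℝ≥0∞) ≠ 0 := by exact_mod_cast N.factorial_ne_zero
    have hfac' : (N.factorial : ℝ≥0∞) ≠ ∞ := ENNReal.natCast_ne_top _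
    have hW : permWeight μ K N =
        (N.factorial : ℝ≥0∞) * (permWeight μ K N / (N.factorial : ℝ≥0∞)) :=
      (ENNReal.mul_div_cancel hfac hfac').symm
    have hsum : ∀ j ∈ Finset.range N, f (j + 1 + 1) *
        kernelTrace μ (kernelIter μ K (kernelComp μ κ K) j) *
          (permWeight μ K (N - 1 - j) / ((N - 1 - j).factorial : ℝ≥0∞)) =
        f (j + 1 + 1) * kernelTrace μ (kernelIter μ K κ (j + 1)) *
          (permWeight μ K (N + 1 - 1 - (j + 1)) / ((N + 1 - 1 - (j + 1)).factorial : ℝ≥0∞)) := by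
      intro j _
      rw [hshift, show N + 1 - 1 - (j + 1) = N - 1 - j by omega]
    rw [Finset.sum_congr rfl hsum]
    nth_rewrite 1 [hW]
    simp only [Nat.add_sub_cancel, Nat.sub_zero, zero_add, kernelIter]
    push_cast
    ring

/-- The sum over the points of a function of the length of their cycle, integrated against the
weights of permutations. -/
theorem lintegral_sum_cycleLength {X : Type*} [MeasurableSpace X] (μ : Measure X) [SigmaFinite μ]
    {K : X → X → ℝ≥0∞} (hK : Measurable (Function.uncurry K)) (N : ℕ) (f : ℕ → ℝ≥0∞) :
    ∫⁻ x : Fin N → X, ∑ π : Perm (Fin N), (∑ q, f (cycleLength π q)) *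
        ∏ i, K (x i) (x (π i)) ∂(Measure.pi fun _ => μ) = (N.factorial : ℝ≥0∞) *
      ∑ j ∈ Finset.range N, f (j + 1) * kernelTrace μ (kernelIter μ K K j) *
        (permWeight μ K (N - 1 - j) / ((N - 1 - j).factorial : ℝ≥0∞)) := by
  rw [← sum_markedWeight μ hK N K hK f]
  unfold markedWeight
  rw [← lintegral_finsetSum _ (fun q _ => Finset.measurable_sum _ fun π _ =>
    (measurable_markedProd hK hK q π).const_mul _)]
  refine lintegral_congr fun x => ?_
  rw [Finset.sum_comm]
  refine Finset.sum_congr rfl fun π _ => ?_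
  rw [Finset.sum_mul]
  refine Finset.sum_congr rfl fun q _ => ?_
  simp [markedProd]

end Cycles

/-! ### Complete homogeneous sequences -/

section Homog

/-- The sequence of complete homogeneous symmetric functions belonging to the power sums
`t 1, t 2, …`, through Newton's identity `n h_n = ∑_{j=1}^n t_j h_{n-j}` with `h_0 = 1`.
The value `t 0` is not used. -/
noncomputable def homog (t : ℕ → ℝ) : ℕ → ℝ
  | 0 => 1
  | n + 1 => (∑ i : Fin (n + 1), t (i + 1) * homog t (n - i)) / (n + 1)

theorem homog_zero (t : ℕ → ℝ) : homog t 0 = 1 := by rw [homog]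

theorem homog_succ (t : ℕ → ℝ) (n : ℕ) :
    (n + 1 : ℝ) * homog t (n + 1) = ∑ i ∈ Finset.range (n + 1), t (i + 1) * homog t (n - i) := by
  rw [homog, mul_div_cancel₀ _ (by positivity),
    ← Fin.sum_univ_eq_sum_range fun i => t (i + 1) * homog t (n - i)]

theorem eq_homog {t y : ℕ → ℝ} (h0 : y 0 = 1)
    (h : ∀ n : ℕ, (n + 1 : ℝ) * y (n + 1) = ∑ i ∈ Finset.range (n + 1), t (i + 1) * y (n - i)) :
    y = homog t := by
  funext n
  induction n using Nat.strong_induction_on with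
  | _ n ih =>
    cases n with
    | zero => rw [h0, homog_zero]
    | succ n =>
      have hn : (n + 1 : ℝ) ≠ 0 := by positivity
      apply mul_left_cancel₀ hn
      rw [h, homog_succ]
      refine Finset.sum_congr rfl fun i _ => ?_
      rw [ih (n - i) (by omega)]

theorem homog_nonneg {t : ℕ → ℝ} (ht : ∀ j, 0 ≤ t (j + 1)) (n : ℕ) : 0 ≤ homog t n := by
  induction n using Nat.strong_induction_on with
  | _ n ih =>
    cases n with
    | zero => rw [homog_zero]; exact zero_le_one
    | succ n =>
      rw [homog]
      refine div_nonneg (Finset.sum_nonneg fun i _ => mul_nonneg (ht _) (ih _ (by omega))) ?_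
      positivity

theorem tendsto_homog {α : Type*} {l : Filter α} {t : α → ℕ → ℝ} {t' : ℕ → ℝ}
    (h : ∀ j, Tendsto (fun a => t a (j + 1)) l (𝓝 (t' (j + 1)))) (n : ℕ) :
    Tendsto (fun a => homog (t a) n) l (𝓝 (homog t' n)) := by
  induction n using Nat.strong_induction_on with
  | _ n ih =>
    cases n with
    | zero => simp only [homog_zero]; exact tendsto_const_nhds
    | succ n =>
      simp only [homog]
      exact (tendsto_finsetSum _ fun (i : Fin (n + 1)) _ =>
        (h i).mul (ih (n - i) (by omega))).div_const _

/-- Adjoining one more variable `x`: the generating function is multiplied by `(1 - x z)⁻¹`. -/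
theorem homog_add_pow (t : ℕ → ℝ) (x : ℝ) (n : ℕ) :
    homog (fun j => t j + x ^ j) (n + 1) =
      homog t (n + 1) + x * homog (fun j => t j + x ^ j) n := by
  set b : ℕ → ℝ := fun n => Nat.rec 1 (fun m y => homog t (m + 1) + x * y) n with hb
  have hb0 : b 0 = 1 := rfl
  have hbs : ∀ m, b (m + 1) = homog t (m + 1) + x * b m := fun m => rfl
  suffices h : b = homog (fun j => t j + x ^ j) by rw [← h, hbs]
  refine eq_homog hb0 fun n => ?_
  induction n with
  | zero =>
    have h1 := homog_succ t 0
    simp only [zero_add, Finset.range_one, Finset.sum_singleton, Nat.sub_zero, homog_zero,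
      Nat.cast_zero, one_mul, mul_one] at h1
    simp [hbs, hb0, h1]
  | succ m ih =>
    have h1 := homog_succ t (m + 1)
    have h2 : ∑ i ∈ Finset.range (m + 1 + 1), (t (i + 1) + x ^ (i + 1)) * b (m + 1 - i) =
        ∑ i ∈ Finset.range (m + 1 + 1), t (i + 1) * homog t (m + 1 - i) +
        x * ∑ i ∈ Finset.range (m + 1), (t (i + 1) + x ^ (i + 1)) * b (m - i) + x * b (m + 1) := by
      have e1 : ∑ i ∈ Finset.range (m + 1 + 1), t (i + 1) * b (m + 1 - i) =
          ∑ i ∈ Finset.range (m + 1 + 1), t (i + 1) * homog t (m + 1 - i) +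
          x * ∑ i ∈ Finset.range (m + 1), t (i + 1) * b (m - i) := by
        rw [Finset.sum_range_succ, Finset.sum_range_succ _ (m + 1), Nat.sub_self, hb0, homog_zero,
          Finset.mul_sum, add_right_comm (Finset.sum _ _), add_left_inj, ← Finset.sum_add_distrib]
        refine Finset.sum_congr rfl fun i hi => ?_
        have hi' := Finset.mem_range.1 hi
        rw [show m + 1 - i = (m - i) + 1 by omega, hbs]
        ring
      have e2 : ∑ i ∈ Finset.range (m + 1 + 1), x ^ (i + 1) * b (m + 1 - i) =
          x * ∑ i ∈ Finset.range (m + 1), x ^ (i + 1) * b (m - i) + x * b (m + 1) := by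
        rw [Finset.sum_range_succ', Finset.mul_sum]
        congr 1
        · refine Finset.sum_congr rfl fun i _ => ?_
          rw [show m + 1 - (i + 1) = m - i by omega]
          ring
        · simp
      simp only [add_mul, Finset.sum_add_distrib]
      rw [e1, e2]
      ring
    rw [h2, ← h1, ← ih, hbs (m + 1)]
    push_cast
    ring

theorem homog_add_pow_eq_sum (t : ℕ → ℝ) (x : ℝ) (n : ℕ) :
    homog (fun j => t j + x ^ j) n = ∑ i ∈ Finset.range (n + 1), x ^ i * homog t (n - i) := by
  induction n with
  | zero => simp [homog_zero]
  | succ n ih =>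
    rw [homog_add_pow, ih, Finset.sum_range_succ' _ (n + 1), Finset.mul_sum, add_comm]
    congr 1
    · refine Finset.sum_congr rfl fun i _ => ?_
      rw [show n + 1 - (i + 1) = n - i by omega]
      ring
    · simp

/-- Log-concavity without internal zeros, in multiplicative form. -/
def LogConcave (a : ℕ → ℝ) : Prop := ∀ m n, m ≤ n → a m * a (n + 1) ≤ a (m + 1) * a n

theorem LogConcave.mul_le {a : ℕ → ℝ} (h : LogConcave a) (k : ℕ) :
    ∀ p l, a p * a (p + k + l) ≤ a (p + k) * a (p + l) := by
  induction k with
  | zero => intro p l; simp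
  | succ k ih =>
    intro p l
    cases l with
    | zero => exact le_of_eq (by rw [add_zero, add_zero, mul_comm])
    | succ l =>
      calc a p * a (p + (k + 1) + (l + 1)) ≤ a (p + 1) * a (p + 1 + k + l) := by
            have := h p (p + 1 + k + l) (by omega)
            rwa [show p + 1 + k + l + 1 = p + (k + 1) + (l + 1) by omega] at this
        _ ≤ a (p + 1 + k) * a (p + 1 + l) := ih _ _
        _ = _ := by rw [show p + 1 + k = p + (k + 1) by omega, show p + 1 + l = p + (l + 1) by omega]

theorem LogConcave.homog_add_pow {t : ℕ → ℝ} (h : LogConcave (homog t))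
    (ht : ∀ j, 0 ≤ t (j + 1)) {x : ℝ} (hx : 0 ≤ x) :
    LogConcave (homog fun j => t j + x ^ j) := by
  intro m n hmn
  rw [SpatialPermutation.homog_add_pow, SpatialPermutation.homog_add_pow]
  have hnn := homog_nonneg ht
  have key : homog (fun j => t j + x ^ j) m * homog t (n + 1) ≤
      homog t (m + 1) * homog (fun j => t j + x ^ j) n := by
    rw [homog_add_pow_eq_sum, homog_add_pow_eq_sum, Finset.sum_mul, Finset.mul_sum]
    refine (Finset.sum_le_sum fun i hi => ?_).trans
      (Finset.sum_le_sum_of_subset_of_nonneg (Finset.range_mono (Nat.succ_le_succ hmn))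
        fun i _ _ => mul_nonneg (hnn _) (mul_nonneg (pow_nonneg hx _) (hnn _)))
    have hi' := Finset.mem_range.1 hi
    have := h.mul_le (i + 1) (m - i) (n - m)
    rw [show m - i + (i + 1) + (n - m) = n + 1 by omega, show m - i + (i + 1) = m + 1 by omega,
      show m - i + (n - m) = n - i by omega] at this
    calc x ^ i * homog t (m - i) * homog t (n + 1)
        = x ^ i * (homog t (m - i) * homog t (n + 1)) := by ring
      _ ≤ x ^ i * (homog t (m + 1) * homog t (n - i)) :=
          mul_le_mul_of_nonneg_left this (pow_nonneg hx _)
      _ = _ := by ring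
  nlinarith [key]

/-- The complete homogeneous symmetric functions of nonnegative variables are log-concave. -/
theorem logConcave_homog_of_hasSum {ι : Type*} {x : ι → ℝ} (hx : ∀ k, 0 ≤ x k) {t : ℕ → ℝ}
    (ht : ∀ j, HasSum (fun k => x k ^ (j + 1)) (t (j + 1))) : LogConcave (homog t) := by
  classical
  have hfin : ∀ s : Finset ι, LogConcave (homog fun j => ∑ k ∈ s, x k ^ j) := by
    intro s
    induction s using Finset.induction_on with
    | empty =>
      have hz : ∀ n, homog (fun j => ∑ k ∈ (∅ : Finset ι), x k ^ j) (n + 1) = 0 := by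
        intro n; rw [homog]; simp
      intro m n _
      rw [hz n, hz m]; simp
    | insert k s hk ih =>
      have h := ih.homog_add_pow (fun j => Finset.sum_nonneg fun k _ => pow_nonneg (hx k) _) (hx k)
      have he : (fun j => ∑ k ∈ insert k s, x k ^ j) = fun j => ∑ k ∈ s, x k ^ j + x k ^ j := by
        funext j; rw [Finset.sum_insert hk, add_comm]
      rw [he]; exact h
  have hlim := tendsto_homog (l := atTop) (t := fun (s : Finset ι) j => ∑ k ∈ s, x k ^ j)
    (t' := t) fun j => ht j
  intro m n hmn
  exact le_of_tendsto_of_tendsto' ((hlim m).mul (hlim (n + 1))) ((hlim (m + 1)).mul (hlim n))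
    fun s => hfin s m n hmn

/-- Removing one variable equal to `1`. -/
theorem homog_eq_sum_sub_one (t : ℕ → ℝ) (n : ℕ) :
    homog t n = ∑ m ∈ Finset.range (n + 1), homog (fun j => t j - 1) m := by
  have h := homog_add_pow_eq_sum (fun j => t j - 1) 1 n
  simp only [one_pow, sub_add_cancel, one_mul] at h
  rw [show homog t = homog fun j => t j from rfl, h,
    ← Finset.sum_range_reflect (homog fun j => t j - 1)]
  simp

theorem homog_mono {t : ℕ → ℝ} (ht : ∀ j, 1 ≤ t (j + 1)) : Monotone (homog t) := by
  refine monotone_nat_of_le_succ fun n => ?_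
  rw [homog_eq_sum_sub_one t n, homog_eq_sum_sub_one t (n + 1), Finset.sum_range_succ _ (n + 1)]
  have := homog_nonneg (t := fun j => t j - 1) (fun j => sub_nonneg.2 (ht j)) (n + 1)
  linarith

theorem one_le_homog {t : ℕ → ℝ} (ht : ∀ j, 1 ≤ t (j + 1)) (n : ℕ) : 1 ≤ homog t n := by
  have := homog_mono ht (Nat.zero_le n)
  rwa [homog_zero] at this

theorem homog_pos {t : ℕ → ℝ} (ht : ∀ j, 1 ≤ t (j + 1)) (n : ℕ) : 0 < homog t n :=
  zero_lt_one.trans_le (one_le_homog ht n)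

theorem homog_sum_rule (t : ℕ → ℝ) (N : ℕ) :
    ∑ j ∈ Finset.range N, t (j + 1) * homog t (N - 1 - j) = N * homog t N := by
  cases N with
  | zero => simp
  | succ n => rw [Nat.add_sub_cancel, ← homog_succ]; push_cast; ring

end Homog

/-! ### Moments of the number of particles outside the ground state -/

section Moments

variable {u : ℕ → ℝ}

theorem sum_homog_le (hu : ∀ j, 0 ≤ u (j + 1)) (hs : Summable fun j => u (j + 1)) (M : ℕ) :
    ∑ m ∈ Finset.range M, (m + 1 : ℝ) * homog u (m + 1) ≤
      (∑' j, u (j + 1)) * ∑ m ∈ Finset.range M, homog u m := by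
  have hnn := homog_nonneg hu
  simp_rw [homog_succ]
  rw [Finset.sum_range_diag_flip M fun i k => u (i + 1) * homog u k]
  calc ∑ i ∈ Finset.range M, ∑ k ∈ Finset.range (M - i), u (i + 1) * homog u k
      ≤ ∑ i ∈ Finset.range M, u (i + 1) * ∑ k ∈ Finset.range M, homog u k := by
        refine Finset.sum_le_sum fun i _ => ?_
        rw [← Finset.mul_sum]
        refine mul_le_mul_of_nonneg_left ?_ (hu i)
        exact Finset.sum_le_sum_of_subset_of_nonneg (Finset.range_mono (Nat.sub_le _ _))
          fun k _ _ => hnn k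
    _ ≤ _ := by
        rw [← Finset.sum_mul]
        exact mul_le_mul_of_nonneg_right (hs.sum_le_tsum _ fun i _ => hu i)
          (Finset.sum_nonneg fun k _ => hnn k)

theorem summable_homog (hu : ∀ j, 0 ≤ u (j + 1)) (hs : Summable fun j => u (j + 1)) :
    Summable (homog u) := by
  have hnn := homog_nonneg hu
  set T := ∑' j, u (j + 1) with hT
  have hT0 : 0 ≤ T := tsum_nonneg hu
  obtain ⟨k, hk⟩ := exists_nat_gt (2 * T)
  refine summable_of_sum_range_le (c := 2 * ∑ m ∈ Finset.range k, homog u m) hnn fun M => ?_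
  -- Markov's inequality: at most half of the mass lies beyond twice the mean.
  have h1 : ∀ M, k * ∑ m ∈ Finset.range M, homog u m ≤
      k * ∑ m ∈ Finset.range k, homog u m + ∑ m ∈ Finset.range M, (m : ℝ) * homog u m := by
    intro M
    induction M with
    | zero =>
      simp only [Finset.range_zero, Finset.sum_empty, mul_zero, add_zero]
      exact mul_nonneg (Nat.cast_nonneg _) (Finset.sum_nonneg fun m _ => hnn m)
    | succ M ih =>
      by_cases hMk : M + 1 ≤ k
      · have h2 : ∑ m ∈ Finset.range (M + 1), homog u m ≤ ∑ m ∈ Finset.range k, homog u m :=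
          Finset.sum_le_sum_of_subset_of_nonneg (Finset.range_mono hMk) fun m _ _ => hnn m
        have h3 : 0 ≤ ∑ m ∈ Finset.range (M + 1), (m : ℝ) * homog u m :=
          Finset.sum_nonneg fun m _ => mul_nonneg (Nat.cast_nonneg _) (hnn m)
        have := mul_le_mul_of_nonneg_left h2 (Nat.cast_nonneg (α := ℝ) k)
        linarith
      · rw [Finset.sum_range_succ, Finset.sum_range_succ, mul_add]
        have : (k : ℝ) * homog u M ≤ M * homog u M :=
          mul_le_mul_of_nonneg_right (by exact_mod_cast (by omega : k ≤ M)) (hnn M)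
        linarith
  have h2 : ∑ m ∈ Finset.range M, (m : ℝ) * homog u m ≤ T * ∑ m ∈ Finset.range M, homog u m := by
    cases M with
    | zero => simp
    | succ M =>
      rw [Finset.sum_range_succ']
      have h3 := sum_homog_le hu hs M
      have h4 : ∑ m ∈ Finset.range M, homog u m ≤ ∑ m ∈ Finset.range (M + 1), homog u m := by
        rw [Finset.sum_range_succ]; linarith [hnn M]
      have h5 := mul_le_mul_of_nonneg_left h4 hT0
      push_cast
      linarith
  have h6 : 0 ≤ ∑ m ∈ Finset.range M, homog u m := Finset.sum_nonneg fun m _ => hnn m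
  have h7 := h1 M
  have hk0 : (0 : ℝ) < k := by linarith
  have h8 : T * ∑ m ∈ Finset.range M, homog u m ≤ k / 2 * ∑ m ∈ Finset.range M, homog u m :=
    mul_le_mul_of_nonneg_right (by linarith) h6
  have h9 : (k : ℝ) * ∑ m ∈ Finset.range M, homog u m ≤
      k * (2 * ∑ m ∈ Finset.range k, homog u m) := by linarith
  exact le_of_mul_le_mul_left h9 hk0

theorem hasSum_cauchy {f g : ℕ → ℝ} (hf : ∀ n, 0 ≤ f n) (hg : ∀ n, 0 ≤ g n) (hf' : Summable f)
    (hg' : Summable g) :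
    HasSum (fun n => ∑ i ∈ Finset.range (n + 1), f i * g (n - i)) ((∑' n, f n) * ∑' n, g n) := by
  have hfn : Summable fun n => ‖f n‖ := by simpa [Real.norm_eq_abs, abs_of_nonneg, hf] using hf'
  have hgn : Summable fun n => ‖g n‖ := by simpa [Real.norm_eq_abs, abs_of_nonneg, hg] using hg'
  rw [tsum_mul_tsum_eq_tsum_sum_range_of_summable_norm hfn hgn]
  exact (summable_norm_sum_mul_range_of_summable_norm hfn hgn).of_norm.hasSum

theorem hasSum_mul_homog (hu : ∀ j, 0 ≤ u (j + 1)) (hs : Summable fun j => u (j + 1)) :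
    HasSum (fun m : ℕ => (m : ℝ) * homog u m) ((∑' j, u (j + 1)) * ∑' m, homog u m) := by
  rw [← hasSum_nat_add_iff' 1]
  simp only [Nat.cast_add, Nat.cast_one, homog_succ]
  simpa using hasSum_cauchy hu (homog_nonneg hu) hs (summable_homog hu hs)

theorem hasSum_sq_mul_homog (hu : ∀ j, 0 ≤ u (j + 1)) (hs : Summable fun j => u (j + 1))
    (hs' : Summable fun j : ℕ => (j + 1 : ℝ) * u (j + 1)) :
    HasSum (fun m : ℕ => (m : ℝ) ^ 2 * homog u m)
      (((∑' j, u (j + 1)) ^ 2 + ∑' j : ℕ, (j + 1 : ℝ) * u (j + 1)) * ∑' m, homog u m) := by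
  rw [← hasSum_nat_add_iff' 1]
  have h1 := hasSum_cauchy (fun j => mul_nonneg (by positivity) (hu j)) (homog_nonneg hu) hs'
    (summable_homog hu hs)
  have h2 := hasSum_cauchy hu (g := fun m : ℕ => (m : ℝ) * homog u m)
    (fun m => mul_nonneg (Nat.cast_nonneg _) (homog_nonneg hu m)) hs
    (hasSum_mul_homog hu hs).summable
  rw [(hasSum_mul_homog hu hs).tsum_eq] at h2
  have h3 := h1.add h2
  have e : ∀ n : ℕ, ((n + 1 : ℕ) : ℝ) ^ 2 * homog u (n + 1) =
      ∑ i ∈ Finset.range (n + 1), (i + 1 : ℝ) * u (i + 1) * homog u (n - i) +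
        ∑ i ∈ Finset.range (n + 1), u (i + 1) * ((n - i : ℕ) * homog u (n - i)) := by
    intro n
    rw [← Finset.sum_add_distrib]
    push_cast
    rw [sq, mul_assoc, homog_succ, Finset.mul_sum]
    refine Finset.sum_congr rfl fun i hi => ?_
    have hi' : i ≤ n := Nat.lt_succ_iff.1 (Finset.mem_range.1 hi)
    rw [Nat.cast_sub hi']
    ring
  simp only [e]
  have e' : ∀ S T D : ℝ, (T ^ 2 + D) * S = D * S + T * (T * S) := by intros; ring
  rw [e', Finset.sum_range_one]
  simpa using h3

/-- The variance of the number of particles whose generating function is `∑ h_n z^n`. -/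
theorem hasSum_variance_homog (hu : ∀ j, 0 ≤ u (j + 1)) (hs : Summable fun j => u (j + 1))
    (hs' : Summable fun j : ℕ => (j + 1 : ℝ) * u (j + 1)) :
    HasSum (fun m : ℕ => ((m : ℝ) - ∑' j, u (j + 1)) ^ 2 * homog u m)
      ((∑' j : ℕ, (j + 1 : ℝ) * u (j + 1)) * ∑' m, homog u m) := by
  have h0 := (summable_homog hu hs).hasSum
  have h1 := hasSum_mul_homog hu hs
  have h2 := hasSum_sq_mul_homog hu hs hs'
  set T := ∑' j, u (j + 1)
  have h3 := (h2.sub (h1.mul_left (2 * T))).add (h0.mul_left (T ^ 2))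
  have e : ∀ S D : ℝ, (T ^ 2 + D) * S - 2 * T * (T * S) + T ^ 2 * S = D * S := by intros; ring
  rw [e] at h3
  have e' : (fun m : ℕ => ((m : ℝ) - T) ^ 2 * homog u m) = fun m : ℕ =>
      (m : ℝ) ^ 2 * homog u m - 2 * T * (m * homog u m) + T ^ 2 * homog u m := by
    funext m; ring
  rw [e']
  exact h3

end Moments

/-! ### Cycle lengths below and above the critical density -/

section Asymptotics

/-- The ratios of successive terms of a log-concave sequence are monotone, so a lower bound on one
ratio propagates to larger indices. -/
theorem LogConcave.pow_mul_le {a : ℕ → ℝ} (h : LogConcave a) (hpos : ∀ n, 0 < a n) {N J : ℕ}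
    (hJ : J < N) {x : ℝ} (hx : 0 ≤ x) (hr : x * a (N - J) ≤ a (N - J - 1)) :
    ∀ i ≤ J + 1, x ^ i * a N ≤ a (N - i) := by
  intro i
  induction i with
  | zero => intro _; simp
  | succ i ih =>
    intro hi
    have h1 := h (N - J - 1) (N - i - 1) (by omega)
    rw [show N - i - 1 + 1 = N - i by omega, show N - J - 1 + 1 = N - J by omega] at h1
    have h2 := ih (by omega)
    have h3 : x * a (N - i) ≤ a (N - i - 1) := by
      have : a (N - J) * (x * a (N - i)) ≤ a (N - J) * a (N - i - 1) := by
        calc a (N - J) * (x * a (N - i)) = (x * a (N - J)) * a (N - i) := by ring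
          _ ≤ a (N - J - 1) * a (N - i) := mul_le_mul_of_nonneg_right hr (hpos _).le
          _ ≤ _ := h1
      exact le_of_mul_le_mul_left this (hpos _)
    calc x ^ (i + 1) * a N = x * (x ^ i * a N) := by ring
      _ ≤ x * a (N - i) := mul_le_mul_of_nonneg_left h2 hx
      _ ≤ a (N - (i + 1)) := by rwa [show N - (i + 1) = N - i - 1 by omega]

/-- An upper bound on one ratio of successive terms of a log-concave sequence propagates to smaller
indices. -/
theorem LogConcave.le_pow_mul {a : ℕ → ℝ} (h : LogConcave a) (hpos : ∀ n, 0 < a n) {N J : ℕ}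
    {x : ℝ} (hx : 0 ≤ x) (hr : a (N - J - 1) ≤ x * a (N - J)) :
    ∀ i, J + i ≤ N → a (N - J - i) ≤ x ^ i * a (N - J) := by
  intro i
  induction i with
  | zero => intro _; simp
  | succ i ih =>
    intro hi
    have h1 := h (N - J - (i + 1)) (N - J - 1) (by omega)
    rw [show N - J - (i + 1) + 1 = N - J - i by omega,
      show N - J - 1 + 1 = N - J by omega] at h1
    have h2 := ih (by omega)
    have h3 : a (N - J - (i + 1)) ≤ x * a (N - J - i) := by
      have : a (N - J - (i + 1)) * a (N - J) ≤ (x * a (N - J - i)) * a (N - J) := by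
        calc a (N - J - (i + 1)) * a (N - J) ≤ a (N - J - i) * a (N - J - 1) := h1
          _ ≤ a (N - J - i) * (x * a (N - J)) := mul_le_mul_of_nonneg_left hr (hpos _).le
          _ = _ := by ring
      exact le_of_mul_le_mul_right this (hpos _)
    calc a (N - J - (i + 1)) ≤ x * a (N - J - i) := h3
      _ ≤ x * (x ^ i * a (N - J)) := mul_le_mul_of_nonneg_left h2 hx
      _ = _ := by ring

/-- At most critical density: the points in long cycles have negligible density. Writing
`r_j = h_{N-j} / h_N`, either the ratio `h_{N-J-1} / h_{N-J}` is close to `1`, and by log-concavity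
so are `r_1, …, r_J`, which makes the cycles of length at most `J` carry all of the density; or it
is bounded away from `1`, and by log-concavity `r_j` decays exponentially for `j > J`. -/
theorem exists_tail_le {α : Type*} {l : Filter α} {t : α → ℕ → ℝ} {V : α → ℝ} {N : α → ℕ}
    {c : ℕ → ℝ} {ρ : ℝ} (hV : ∀ᶠ a in l, 0 < V a) (ht : ∀ᶠ a in l, ∀ j, 1 ≤ t a (j + 1))
    (ht1 : ∀ᶠ a in l, ∀ j, t a (j + 1) ≤ t a 1) (hlc : ∀ᶠ a in l, LogConcave (homog (t a)))
    (hN : Tendsto (fun a => (N a : ℝ) / V a) l (𝓝 ρ))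
    (hc : ∀ j, Tendsto (fun a => t a (j + 1) / V a) l (𝓝 (c j)))
    (hρ : ∀ ε > 0, ∃ J, ρ - ε < ∑ j ∈ Finset.range J, c j) {ε : ℝ} (hε : 0 < ε) :
    ∃ J, ∀ᶠ a in l, (∑ j ∈ Finset.Ico J (N a),
      t a (j + 1) * (homog (t a) (N a - 1 - j) / homog (t a) (N a))) / V a ≤ ε := by
  obtain ⟨J, hJ⟩ := hρ (ε / 4) (by positivity)
  set S := ∑ j ∈ Finset.range J, c j with hS
  set η : ℝ := min (1 / 2) (ε / 4 / (J * (|S| + 1) + 1)) with hη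
  have hη0 : 0 < η := by positivity
  have hη1 : η ≤ 1 / 2 := min_le_left _ _
  have hηJ : J * η * |S| ≤ ε / 4 := by
    have h1 : η ≤ ε / 4 / (J * (|S| + 1) + 1) := min_le_right _ _
    rw [le_div_iff₀ (by positivity)] at h1
    have : (0 : ℝ) ≤ J * η := by positivity
    nlinarith
  set x := 1 - η with hx
  have hx0 : 0 ≤ x := by linarith
  have hx1 : x < 1 := by linarith
  set K := |c 0| + 1 with hK
  have hK0 : 0 < K := by positivity
  obtain ⟨M, hM⟩ : ∃ M, K * (x ^ M / η) ≤ ε := by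
    have h1 : Tendsto (fun M => K * (x ^ M / η)) atTop (𝓝 (K * (0 / η))) :=
      ((tendsto_pow_atTop_nhds_zero_of_lt_one hx0 hx1).div_const _).const_mul _
    rw [zero_div, mul_zero] at h1
    exact ((h1.eventually (ge_mem_nhds hε)).exists)
  refine ⟨J + M, ?_⟩
  have hsum : Tendsto (fun a => ∑ j ∈ Finset.range J, t a (j + 1) / V a) l (𝓝 S) :=
    tendsto_finsetSum _ fun j _ => hc j
  have e1 := hsum.eventually (lt_mem_nhds (show S - ε / 4 < S by linarith))
  have e2 := hN.eventually (gt_mem_nhds (show ρ < ρ + ε / 4 by linarith))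
  have e3 := (hc 0).eventually (gt_mem_nhds (show c 0 < K by
    have := le_abs_self (c 0); linarith))
  filter_upwards [hV, ht, ht1, hlc, e1, e2, e3] with a hV ht ht1 hlc e1 e2 e3
  set Y := homog (t a) with hY
  have hpos : ∀ n, 0 < Y n := homog_pos ht
  have ht0 : ∀ j, 0 ≤ t a (j + 1) := fun j => zero_le_one.trans (ht j)
  set n := N a with hn
  have hw0 : ∀ j, 0 ≤ t a (j + 1) * (Y (n - 1 - j) / Y n) := fun j =>
    mul_nonneg (ht0 j) (div_nonneg (hpos _).le (hpos _).le)
  by_cases hnJ : n ≤ J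
  · rw [Finset.Ico_eq_empty (by omega)]; simpa using hε.le
  push Not at hnJ
  by_cases hr : x * Y (n - J) ≤ Y (n - J - 1)
  · have hlow := hlc.pow_mul_le hpos hnJ hx0 hr
    have hrule := homog_sum_rule (t a) n
    have htot : ∑ j ∈ Finset.range n, t a (j + 1) * (Y (n - 1 - j) / Y n) = n := by
      rw [← mul_div_cancel_right₀ (n : ℝ) (hpos n).ne', ← hrule, Finset.sum_div]
      exact Finset.sum_congr rfl fun j _ => by rw [mul_div_assoc]
    have hsplit := Finset.sum_range_add_sum_Ico
      (fun j => t a (j + 1) * (Y (n - 1 - j) / Y n)) hnJ.le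
    have hsub : ∑ j ∈ Finset.Ico (J + M) n, t a (j + 1) * (Y (n - 1 - j) / Y n) ≤
        ∑ j ∈ Finset.Ico J n, t a (j + 1) * (Y (n - 1 - j) / Y n) :=
      Finset.sum_le_sum_of_subset_of_nonneg (Finset.Ico_subset_Ico_left (by omega))
        fun j _ _ => hw0 j
    have hbern : 1 - J * η ≤ x ^ J := by
      have := one_add_mul_le_pow (show (-2 : ℝ) ≤ -η by linarith) J
      rw [hx]; calc 1 - J * η = 1 + J * -η := by ring
        _ ≤ (1 + -η) ^ J := this
        _ = _ := by ring
    have hhead : x ^ J * ∑ j ∈ Finset.range J, t a (j + 1) ≤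
        ∑ j ∈ Finset.range J, t a (j + 1) * (Y (n - 1 - j) / Y n) := by
      rw [Finset.mul_sum]
      refine Finset.sum_le_sum fun j hj => ?_
      have hj' := Finset.mem_range.1 hj
      rw [mul_comm]
      refine mul_le_mul_of_nonneg_left ?_ (ht0 j)
      rw [le_div_iff₀ (hpos n)]
      calc x ^ J * Y n ≤ x ^ (j + 1) * Y n :=
            mul_le_mul_of_nonneg_right (pow_le_pow_of_le_one hx0 hx1.le hj') (hpos n).le
        _ ≤ Y (n - (j + 1)) := hlow _ (by omega)
        _ = _ := by rw [show n - (j + 1) = n - 1 - j by omega]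
    rw [← Finset.sum_div] at e1
    rw [div_le_iff₀ hV]
    rw [lt_div_iff₀ hV] at e1
    rw [div_lt_iff₀ hV] at e2
    -- The head has density at least `x ^ J * (S - ε / 4) ≥ S - ε / 2`.
    have hA : (S - ε / 2) * V a ≤ x ^ J * ∑ j ∈ Finset.range J, t a (j + 1) := by
      have hxJ0 : 0 ≤ x ^ J := pow_nonneg hx0 _
      have hxJ1 : x ^ J ≤ 1 := pow_le_one₀ hx0 hx1.le
      have h1 : S - ε / 2 ≤ x ^ J * (S - ε / 4) := by
        have h2 : x ^ J * S ≥ S - ε / 4 := by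
          have h3 : (1 - x ^ J) * S ≤ (1 - x ^ J) * |S| :=
            mul_le_mul_of_nonneg_left (le_abs_self S) (by linarith)
          have h4 : (1 - x ^ J) * |S| ≤ J * η * |S| :=
            mul_le_mul_of_nonneg_right (by linarith) (abs_nonneg S)
          linarith
        have h5 : x ^ J * (ε / 4) ≤ ε / 4 := mul_le_of_le_one_left (by positivity) hxJ1
        linarith
      calc (S - ε / 2) * V a ≤ x ^ J * (S - ε / 4) * V a := mul_le_mul_of_nonneg_right h1 hV.le
        _ = x ^ J * ((S - ε / 4) * V a) := by ring
        _ ≤ _ := mul_le_mul_of_nonneg_left e1.le hxJ0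
    have hB : (ρ - ε / 4) * V a ≤ S * V a := mul_le_mul_of_nonneg_right hJ.le hV.le
    nlinarith
  · push Not at hr
    have hup := hlc.le_pow_mul hpos hx0 hr.le
    have hmono := homog_mono ht
    rw [Finset.sum_div]
    have hbd : ∀ j ∈ Finset.Ico (J + M) n,
        t a (j + 1) * (Y (n - 1 - j) / Y n) / V a ≤ K * x ^ (j - J) := by
      intro j hj
      obtain ⟨hj1, hj2⟩ := Finset.mem_Ico.1 hj
      have h1 : Y (n - 1 - j) / Y n ≤ x ^ (j - J) := by
        rw [div_le_iff₀ (hpos n)]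
        calc Y (n - 1 - j) = Y (n - J - (j + 1 - J)) := by congr 1; omega
          _ ≤ x ^ (j + 1 - J) * Y (n - J) := hup _ (by omega)
          _ ≤ x ^ (j - J) * Y n :=
            mul_le_mul (pow_le_pow_of_le_one hx0 hx1.le (by omega)) (hmono (Nat.sub_le _ _))
              (hpos _).le (pow_nonneg hx0 _)
      have h2 : t a (j + 1) / V a ≤ K :=
        (div_le_div_of_nonneg_right (ht1 j) hV.le).trans e3.le
      calc t a (j + 1) * (Y (n - 1 - j) / Y n) / V a
          = t a (j + 1) / V a * (Y (n - 1 - j) / Y n) := by ring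
        _ ≤ K * x ^ (j - J) :=
          mul_le_mul h2 h1 (div_nonneg (hpos _).le (hpos _).le) hK0.le
    refine (Finset.sum_le_sum hbd).trans (le_trans ?_ hM)
    rw [← Finset.mul_sum]
    refine mul_le_mul_of_nonneg_left ?_ hK0.le
    rw [Finset.sum_Ico_eq_sum_range]
    have h1 : ∀ i ∈ Finset.range (n - (J + M)), x ^ (J + M + i - J) = x ^ M * x ^ i := by
      intro i _
      rw [← pow_add]; congr 1; omega
    rw [Finset.sum_congr rfl h1, ← Finset.mul_sum, div_eq_mul_inv]
    refine mul_le_mul_of_nonneg_left ?_ (pow_nonneg hx0 _)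
    have h2 := (summable_geometric_of_lt_one hx0 hx1).sum_le_tsum (Finset.range (n - (J + M)))
      (fun i _ => pow_nonneg hx0 i)
    rw [tsum_geometric_of_lt_one hx0 hx1] at h2
    rwa [show η = 1 - x by rw [hx]; ring]

/-- Split off the variable `1` of the ground state: `homog (t - 1) m` is the weight of having `m`
particles in excited modes, and the left side counts `min M (N - m)` for each of them, the number
of particles in the ground state truncated at `M`. -/
theorem sum_homog_sub (t : ℕ → ℝ) (M N : ℕ) :
    ∑ j ∈ Finset.range (min M N), homog t (N - 1 - j) =
      ∑ m ∈ Finset.range (N + 1), (min M (N - m) : ℕ) * homog (fun j => t j - 1) m := by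
  set X := homog fun j => t j - 1
  have h1 : ∀ j ∈ Finset.range (min M N), homog t (N - 1 - j) =
      ∑ m ∈ Finset.range (N + 1), if j < N - m then X m else 0 := by
    intro j hj
    have hj' := Finset.mem_range.1 hj
    have hjN : j < N := lt_of_lt_of_le hj' (min_le_right _ _)
    rw [homog_eq_sum_sub_one, ← Finset.sum_filter]
    refine Finset.sum_congr ?_ fun _ _ => rfl
    ext m
    simp only [Finset.mem_range, Finset.mem_filter]
    omega
  rw [Finset.sum_congr rfl h1, Finset.sum_comm]
  refine Finset.sum_congr rfl fun m _ => ?_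
  rw [← Finset.sum_filter, Finset.sum_const, nsmul_eq_mul]
  congr 2
  have : (Finset.range (min M N)).filter (fun j => j < N - m) = Finset.range (min M (N - m)) := by
    ext j
    simp only [Finset.mem_range, Finset.mem_filter]
    omega
  rw [this, Finset.card_range]

/-- Above the critical density: the number of particles in the ground state is concentrated, by
Chebyshev's inequality for the number of the other particles. -/
theorem abs_sum_homog_sub_le {t : ℕ → ℝ} (ht : ∀ j, 1 ≤ t (j + 1)) {T D : ℝ}
    (hT : HasSum (fun j => t (j + 1) - 1) T)
    (hD : HasSum (fun j : ℕ => (j + 1 : ℝ) * (t (j + 1) - 1)) D) {M N : ℕ} (hTN : T < N)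
    (hDN : D ≤ (N - T) ^ 2 / 2) {c : ℝ} (hc : 0 < c) :
    |∑ j ∈ Finset.range (min M N), homog t (N - 1 - j) / homog t N - min (M : ℝ) (N - T)| ≤
      2 * (D / (4 * c) + c) := by
  set u : ℕ → ℝ := fun j => t j - 1 with hu_def
  have hu : ∀ j, 0 ≤ u (j + 1) := fun j => sub_nonneg.2 (ht j)
  set X := homog u with hX
  have hX0 : ∀ m, 0 ≤ X m := homog_nonneg hu
  have hvar := hasSum_variance_homog hu hT.summable hD.summable
  have hTe : ∑' j, u (j + 1) = T := hT.tsum_eq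
  have hDe : ∑' j : ℕ, (j + 1 : ℝ) * u (j + 1) = D := hD.tsum_eq
  rw [hTe, hDe] at hvar
  have hXs := summable_homog hu hT.summable
  set S := ∑' m, homog u m with hS
  have hY : homog t N = ∑ m ∈ Finset.range (N + 1), X m := homog_eq_sum_sub_one t N
  have hYpos := homog_pos ht N
  have hvar0 : ∀ m : ℕ, 0 ≤ ((m : ℝ) - T) ^ 2 * X m := fun m => mul_nonneg (sq_nonneg _) (hX0 m)
  have hSN := hXs.sum_add_tsum_nat_add (N + 1)
  have hNT : 0 < ((N : ℝ) - T) := by linarith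
  have hS0 : 0 ≤ S := tsum_nonneg hX0
  -- conditioning on at most `N` excited particles keeps at least half of the mass
  have hhalf : S ≤ 2 * homog t N := by
    have h1 : ((N : ℝ) - T) ^ 2 * ∑' i, X (i + (N + 1)) ≤ D * S := by
      rw [← tsum_mul_left]
      have h2 := hvar.summable.sum_add_tsum_nat_add (N + 1)
      rw [hvar.tsum_eq] at h2
      have h3 : 0 ≤ ∑ m ∈ Finset.range (N + 1), ((m : ℝ) - T) ^ 2 * homog u m :=
        Finset.sum_nonneg fun m _ => hvar0 m
      refine le_trans (Summable.tsum_le_tsum (fun i => ?_)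
        (((summable_nat_add_iff (N + 1)).2 hXs).mul_left _)
        ((summable_nat_add_iff (N + 1)).2 hvar.summable)) (by linarith)
      refine mul_le_mul_of_nonneg_right ?_ (hX0 _)
      have : (N : ℝ) ≤ ((i + (N + 1) : ℕ) : ℝ) := by push_cast; linarith [i.cast_nonneg (α := ℝ)]
      exact pow_le_pow_left₀ hNT.le (by linarith) 2
    have h4 : ((N : ℝ) - T) ^ 2 * ∑' i, X (i + (N + 1)) ≤ ((N : ℝ) - T) ^ 2 * (S / 2) :=
      h1.trans (by nlinarith)
    have h5 := le_of_mul_le_mul_left h4 (by positivity)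
    rw [hY]; linarith
  have hmain : |∑ m ∈ Finset.range (N + 1), (((min M (N - m) : ℕ) : ℝ) - min (M : ℝ) (N - T)) * X m|
      ≤ (D / (4 * c) + c) * S := by
    refine (Finset.abs_sum_le_sum_abs _ _).trans ?_
    have h1 : ∀ m ∈ Finset.range (N + 1),
        |(((min M (N - m) : ℕ) : ℝ) - min (M : ℝ) (N - T)) * X m| ≤
          1 / (4 * c) * (((m : ℝ) - T) ^ 2 * X m) + c * X m := by
      intro m hm
      have hm' : m ≤ N := Nat.lt_succ_iff.1 (Finset.mem_range.1 hm)
      rw [abs_mul, abs_of_nonneg (hX0 m), ← mul_assoc, ← add_mul]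
      refine mul_le_mul_of_nonneg_right ?_ (hX0 m)
      have h2 : |((min M (N - m) : ℕ) : ℝ) - min (M : ℝ) (N - T)| ≤ |(m : ℝ) - T| := by
        rw [Nat.cast_min, Nat.cast_sub hm']
        refine (abs_min_sub_min_le_max _ _ _ _).trans ?_
        rw [sub_self, abs_zero, max_eq_right (abs_nonneg _)]
        rw [show (N : ℝ) - m - (N - T) = -(m - T) by ring, abs_neg]
      refine h2.trans ?_
      rw [← sub_nonneg]
      -- `|y| ≤ y² / (4c) + c`, with a free scale `c` that is later a small multiple of `V`
      have h3 : 1 / (4 * c) * ((m : ℝ) - T) ^ 2 + c - |(m : ℝ) - T| =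
          (|(m : ℝ) - T| - 2 * c) ^ 2 / (4 * c) := by
        rw [← sq_abs ((m : ℝ) - T)]; field_simp; ring
      rw [h3]; positivity
    refine (Finset.sum_le_sum h1).trans ?_
    rw [Finset.sum_add_distrib, ← Finset.mul_sum, ← Finset.mul_sum]
    have h4 := sum_le_hasSum (Finset.range (N + 1)) (fun m _ => hvar0 m) hvar
    have h5 := hXs.sum_le_tsum (Finset.range (N + 1)) (fun m _ => hX0 m)
    have h6 := mul_le_mul_of_nonneg_left h4 (show 0 ≤ 1 / (4 * c) by positivity)
    have h7 := mul_le_mul_of_nonneg_left h5 hc.le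
    calc _ ≤ 1 / (4 * c) * (D * S) + c * S := add_le_add h6 h7
      _ = _ := by ring
  have hid : ∑ j ∈ Finset.range (min M N), homog t (N - 1 - j) / homog t N - min (M : ℝ) (N - T) =
      (∑ m ∈ Finset.range (N + 1), (((min M (N - m) : ℕ) : ℝ) - min (M : ℝ) (N - T)) * X m) /
        homog t N := by
    simp only [sub_mul]
    rw [Finset.sum_sub_distrib, ← Finset.mul_sum, ← hY, ← Finset.sum_div, sum_homog_sub, sub_div,
      mul_div_cancel_right₀ _ hYpos.ne']
  have hD0 : 0 ≤ D := by
    rw [← hDe]; exact tsum_nonneg fun j => mul_nonneg (by positivity) (hu j)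
  rw [hid, abs_div, abs_of_pos hYpos, div_le_iff₀ hYpos]
  refine hmain.trans ?_
  have : 0 ≤ D / (4 * c) + c := by positivity
  nlinarith

/-- Above the critical density, the limiting density of ground-state points in cycles of length at
most `M`: there are about `(ρ - ρ_c) V` points in the ground state, and the lengths of their cycles
are spread uniformly. -/
theorem tendsto_sum_homog_div {α : Type*} {l : Filter α} {t : α → ℕ → ℝ} {V T D : α → ℝ}
    {N M : α → ℕ} {ρ ρc s : ℝ} (hV : Tendsto V l atTop) (ht : ∀ᶠ a in l, ∀ j, 1 ≤ t a (j + 1))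
    (hT : ∀ᶠ a in l, HasSum (fun j => t a (j + 1) - 1) (T a))
    (hD : ∀ᶠ a in l, HasSum (fun j : ℕ => (j + 1 : ℝ) * (t a (j + 1) - 1)) (D a))
    (hN : Tendsto (fun a => (N a : ℝ) / V a) l (𝓝 ρ))
    (hM : Tendsto (fun a => (M a : ℝ) / V a) l (𝓝 s))
    (hTV : Tendsto (fun a => T a / V a) l (𝓝 ρc))
    (hDV : Tendsto (fun a => D a / V a ^ 2) l (𝓝 0)) (hρ : ρc < ρ) :
    Tendsto (fun a => (∑ j ∈ Finset.range (min (M a) (N a)),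
      homog (t a) (N a - 1 - j) / homog (t a) (N a)) / V a) l (𝓝 (min s (ρ - ρc))) := by
  have hlim : Tendsto (fun a => min ((M a : ℝ) / V a) (N a / V a - T a / V a)) l
      (𝓝 (min s (ρ - ρc))) := hM.min (hN.sub hTV)
  refine tendsto_of_tendsto_of_dist hlim ?_
  rw [Metric.tendsto_nhds]
  intro ε hε
  set η := ε / 8
  have hη : 0 < η := by positivity
  have hV0 := hV.eventually (eventually_gt_atTop 0)
  set δ := (ρ - ρc) / 2 with hδ
  have hδ0 : 0 < δ := by linarith
  have e1 := (hN.sub hTV).eventually (lt_mem_nhds (show δ < ρ - ρc by linarith))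
  have e2 := hDV.eventually (gt_mem_nhds (show 0 < min (δ ^ 2 / 2) (η * (4 * η)) by positivity))
  filter_upwards [hV0, ht, hT, hD, e1, e2] with a hV ht hT hD e1 e2
  rw [← sub_div, lt_div_iff₀ hV] at e1
  have hδV : 0 < δ * V a := by positivity
  have hTN : T a < N a := by linarith
  have e2' : D a < δ ^ 2 / 2 * V a ^ 2 := by
    rw [← div_lt_iff₀ (by positivity)]; exact e2.trans_le (min_le_left _ _)
  have e2'' : D a / V a ^ 2 < η * (4 * η) := e2.trans_le (min_le_right _ _)
  have hDN : D a ≤ (N a - T a) ^ 2 / 2 := by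
    have : (δ * V a) ^ 2 ≤ (N a - T a) ^ 2 := pow_le_pow_left₀ hδV.le e1.le 2
    nlinarith
  have key := abs_sum_homog_sub_le ht hT hD (M := M a) hTN hDN (show 0 < η * V a by positivity)
  have h3 : min ((M a : ℝ) / V a) (N a / V a - T a / V a) = min (M a : ℝ) (N a - T a) / V a := by
    rw [← sub_div, min_div_div_right hV.le]
  rw [Real.dist_0_eq_abs, abs_of_nonneg dist_nonneg, h3, dist_comm, Real.dist_eq, ← sub_div,
    abs_div, abs_of_pos hV, div_lt_iff₀ hV]
  refine key.trans_lt ?_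
  have h4 : D a / (4 * (η * V a)) < η * V a := by
    rw [div_lt_iff₀ (by positivity)]
    rw [div_lt_iff₀ (by positivity)] at e2''
    calc D a < η * (4 * η) * V a ^ 2 := e2''
      _ = _ := by ring
  have : ε = 8 * η := by simp only [η]; ring
  rw [this]
  nlinarith [mul_pos hη hV]

end Asymptotics

/-! ### Fourier series with nonnegative coefficients -/

section Torus

attribute [local instance] instMeasureSpaceUnitAddCircle
  instIsAddHaarMeasureUnitAddCircleVolume instIsProbabilityMeasureUnitAddCircleVolume

open UnitAddTorus ComplexConjugate

variable {ι : Type*} [Fintype ι]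

/-- The cube `{0, …, M - 1}^ι` of lattice points. -/
noncomputable def latticeCube (ι : Type*) [Fintype ι] (M : ℕ) : Finset (ι → ℤ) := by
  classical exact Fintype.piFinset fun _ => Finset.Ico (0 : ℤ) M

theorem mem_latticeCube {M : ℕ} {y : ι → ℤ} : y ∈ latticeCube ι M ↔ ∀ i, 0 ≤ y i ∧ y i < M := by
  classical
  simp [latticeCube, Fintype.mem_piFinset]

theorem card_latticeCube (M : ℕ) : (latticeCube ι M).card = M ^ Fintype.card ι := by
  classical
  simp [latticeCube, Fintype.card_piFinset]

/-- Fejér averages over cubes control the sum of a nonnegative function on the lattice. -/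
theorem sum_le_of_latticeCube {c : (ι → ℤ) → ℝ} (hc : ∀ n, 0 ≤ c n) {A : ℝ}
    (h : ∀ M : ℕ, ∑ y ∈ latticeCube ι M, ∑ y' ∈ latticeCube ι M, c (y - y') ≤
      A * (latticeCube ι M).card) (F : Finset (ι → ℤ)) : ∑ n ∈ F, c n ≤ A := by
  classical
  obtain ⟨R, hR⟩ : ∃ R : ℕ, ∀ n ∈ F, ∀ i, |n i| ≤ R := by
    refine ⟨∑ n ∈ F, ∑ i, (n i).natAbs, fun n hn i => ?_⟩
    have h1 : (n i).natAbs ≤ ∑ i, (n i).natAbs :=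
      Finset.single_le_sum (f := fun i => (n i).natAbs) (fun _ _ => Nat.zero_le _)
        (Finset.mem_univ i)
    have h2 : ∑ i, (n i).natAbs ≤ ∑ n ∈ F, ∑ i, (n i).natAbs :=
      Finset.single_le_sum (f := fun n : ι → ℤ => ∑ i, (n i).natAbs) (fun _ _ => Nat.zero_le _) hn
    rw [Int.abs_eq_natAbs]
    exact_mod_cast h1.trans h2
  set k := Fintype.card ι
  have key : ∀ M : ℕ, (M : ℝ) ^ k * ∑ n ∈ F, c n ≤ A * ((M + 2 * R : ℕ) : ℝ) ^ k := by
    intro M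
    have h0 := h (M + 2 * R)
    rw [card_latticeCube, Nat.cast_pow, Finset.sum_comm] at h0
    refine le_trans ?_ h0
    -- The translates of `F` by the points of the inner cube stay in the large cube.
    set B := (latticeCube ι M).image fun y => y + fun _ => (R : ℤ) with hB
    have hcard : B.card = M ^ k := by
      rw [hB, Finset.card_image_of_injective _ (add_left_injective _), card_latticeCube]
    have hBsub : B ⊆ latticeCube ι (M + 2 * R) := by
      intro y hy
      obtain ⟨z, hz, rfl⟩ := Finset.mem_image.1 hy
      rw [mem_latticeCube] at hz ⊢
      intro i
      have := hz i
      simp only [Pi.add_apply]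
      push_cast
      omega
    calc (M : ℝ) ^ k * ∑ n ∈ F, c n = ∑ y' ∈ B, ∑ n ∈ F, c n := by
          rw [Finset.sum_const, hcard, nsmul_eq_mul]; push_cast; ring
      _ ≤ ∑ y' ∈ B, ∑ y ∈ latticeCube ι (M + 2 * R), c (y - y') := by
          refine Finset.sum_le_sum fun y' hy' => ?_
          have e : ∑ n ∈ F, c n = ∑ y ∈ F.image (· + y'), c (y - y') := by
            rw [Finset.sum_image fun a _ b _ hab => add_left_injective y' hab]
            simp
          rw [e]
          refine Finset.sum_le_sum_of_subset_of_nonneg ?_ fun _ _ _ => hc _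
          intro y hy
          obtain ⟨n, hn, rfl⟩ := Finset.mem_image.1 hy
          obtain ⟨z, hz, rfl⟩ := Finset.mem_image.1 hy'
          rw [mem_latticeCube] at hz ⊢
          intro i
          have h1 := hz i
          have h2 := abs_le.1 (hR n hn i)
          simp only [Pi.add_apply]
          push_cast
          omega
      _ ≤ _ := Finset.sum_le_sum_of_subset_of_nonneg hBsub fun _ _ _ =>
          Finset.sum_nonneg fun _ _ => hc _
  have hlim : Tendsto (fun M : ℕ => A * (((M + 2 * R : ℕ) : ℝ) / M) ^ k) atTop
      (𝓝 (A * 1 ^ k)) := by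
    refine Tendsto.const_mul _ (Tendsto.pow ?_ k)
    have : Tendsto (fun M : ℕ => 1 + (2 * R : ℝ) / M) atTop (𝓝 (1 + 0)) :=
      tendsto_const_nhds.add (tendsto_const_div_atTop_nhds_zero_nat _)
    rw [add_zero] at this
    refine this.congr' ?_
    filter_upwards [eventually_gt_atTop 0] with M hM
    have hM' : (M : ℝ) ≠ 0 := by positivity
    push_cast
    field_simp
  rw [one_pow, mul_one] at hlim
  refine ge_of_tendsto hlim ?_
  filter_upwards [eventually_gt_atTop 0] with M hM
  have hM' : (0 : ℝ) < (M : ℝ) ^ k := by positivity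
  rw [div_pow, ← mul_div_assoc, le_div_iff₀ hM', mul_comm]
  exact key M

theorem integral_mFourier [DecidableEq ι] (n : ι → ℤ) :
    ∫ u : UnitAddTorus ι, mFourier n u = if n = 0 then 1 else 0 := by
  have h := mFourierCoeff_toLp (mFourier (d := ι) n) 0
  rw [← mFourierBasis_repr] at h
  have h1 : ContinuousMap.toLp 2 volume ℂ (mFourier n) = mFourierBasis (d := ι) n := by
    rw [coe_mFourierBasis]
  rw [h1, HilbertBasis.repr_self] at h
  have h2 : mFourierCoeff (mFourier n) 0 = ∫ u : UnitAddTorus ι, mFourier n u := by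
    simp [mFourierCoeff, mFourier_zero]
  rw [← h2, ← h, lp.single_apply]
  by_cases hn : n = 0
  · subst hn; simp
  · simp [hn, Ne.symm hn]

theorem integrable_ofReal_of_bounded {f : UnitAddTorus ι → ℝ} (hf : Measurable f) {A : ℝ}
    (h0 : ∀ u, 0 ≤ f u) (hA : ∀ u, f u ≤ A) : Integrable f :=
  Integrable.of_bound hf.aestronglyMeasurable A
    (ae_of_all _ fun u => by rw [Real.norm_eq_abs, abs_of_nonneg (h0 u)]; exact hA u)

theorem sum_mFourierCoeff_sub {f : UnitAddTorus ι → ℝ} (hf : Measurable f) {A : ℝ}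
    (h0 : ∀ u, 0 ≤ f u) (hA : ∀ u, f u ≤ A) (B : Finset (ι → ℤ)) :
    ∑ y ∈ B, ∑ y' ∈ B, mFourierCoeff (fun u => (f u : ℂ)) (y - y') =
      ((∫ u, f u * Complex.normSq (∑ y ∈ B, mFourier y u) : ℝ) : ℂ) := by
  have hi : ∀ n : ι → ℤ, Integrable fun u => mFourier n u • (f u : ℂ) := fun n =>
    (integrable_ofReal_of_bounded hf h0 hA).ofReal.bdd_mul (c := 1)
      (mFourier n).continuous.aestronglyMeasurable
      (ae_of_all _ fun u => (ContinuousMap.norm_coe_le_norm _ u).trans mFourier_norm.le)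
  unfold mFourierCoeff
  simp_rw [← integral_finsetSum B fun y' _ => hi _]
  rw [← integral_finsetSum B fun y _ => integrable_finsetSum B fun y' _ => hi _,
    ← integral_complex_ofReal]
  refine integral_congr_ae (ae_of_all _ fun u => ?_)
  simp only
  rw [Complex.ofReal_mul, Complex.normSq_eq_conj_mul_self, map_sum, Finset.sum_mul_sum,
    Finset.mul_sum]
  refine Finset.sum_congr rfl fun y _ => ?_
  rw [Finset.mul_sum]
  refine Finset.sum_congr rfl fun y' _ => ?_
  rw [neg_sub, sub_eq_neg_add, mFourier_add, mFourier_neg, smul_eq_mul]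
  ring

/-- A bounded function with nonnegative Fourier coefficients has an absolutely convergent Fourier
series. -/
theorem summable_of_mFourierCoeff_nonneg {f : UnitAddTorus ι → ℝ} (hf : Measurable f) {A : ℝ}
    (h0 : ∀ u, 0 ≤ f u) (hA : ∀ u, f u ≤ A) {c : (ι → ℤ) → ℝ} (hc : ∀ n, 0 ≤ c n)
    (hfc : ∀ n, mFourierCoeff (fun u => (f u : ℂ)) n = c n) : Summable c ∧ ∑' n, c n ≤ A := by
  classical
  suffices h : ∀ F : Finset (ι → ℤ), ∑ n ∈ F, c n ≤ A from
    ⟨summable_of_sum_le hc h, (summable_of_sum_le hc h).tsum_le_of_sum_le h⟩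
  refine sum_le_of_latticeCube hc fun M => ?_
  set B := latticeCube ι M
  have h1 := sum_mFourierCoeff_sub hf h0 hA B
  simp_rw [hfc] at h1
  have h2 : ∑ y ∈ B, ∑ y' ∈ B, c (y - y') =
      ∫ u, f u * Complex.normSq (∑ y ∈ B, mFourier y u) := by exact_mod_cast h1
  have h3 := sum_mFourierCoeff_sub (ι := ι) (f := fun _ => 1) measurable_const
    (A := 1) (fun _ => zero_le_one) (fun _ => le_rfl) B
  have h4 : ∀ n : ι → ℤ, mFourierCoeff (fun _ : UnitAddTorus ι => ((1 : ℝ) : ℂ)) n =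
      if n = 0 then 1 else 0 := by
    intro n
    simp [mFourierCoeff, integral_mFourier]
  simp_rw [h4, sub_eq_zero] at h3
  have h5 : ∫ u : UnitAddTorus ι, Complex.normSq (∑ y ∈ B, mFourier y u) = B.card := by
    have : (B.card : ℂ) = ((∫ u : UnitAddTorus ι,
        1 * Complex.normSq (∑ y ∈ B, mFourier y u) : ℝ) : ℂ) := by
      rw [← h3]; simp
    simp only [one_mul] at this
    exact_mod_cast this.symm
  have hcont : Continuous fun u : UnitAddTorus ι => Complex.normSq (∑ y ∈ B, mFourier y u) :=
    Complex.continuous_normSq.comp (continuous_finsetSum _ fun y _ => (mFourier y).continuous)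
  have hint : Integrable fun u : UnitAddTorus ι => Complex.normSq (∑ y ∈ B, mFourier y u) :=
    hcont.integrable_of_hasCompactSupport (HasCompactSupport.of_compactSpace _)
  rw [h2, ← h5, ← integral_const_mul]
  refine integral_mono_of_nonneg (ae_of_all _ fun u => mul_nonneg (h0 u) (Complex.normSq_nonneg _))
    (hint.const_mul _) (ae_of_all _ fun u => ?_)
  exact mul_le_mul_of_nonneg_right (hA u) (Complex.normSq_nonneg _)

/-- The continuous function with absolutely summable Fourier coefficients `c`. -/
noncomputable def fourierSeries (c : (ι → ℤ) → ℝ) : C(UnitAddTorus ι, ℂ) :=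
  ∑' n, (c n : ℂ) • mFourier n

theorem hasSum_fourierSeries {c : (ι → ℤ) → ℝ} (hc : Summable c) :
    HasSum (fun n => (c n : ℂ) • mFourier n) (fourierSeries c) := by
  refine Summable.hasSum (Summable.of_norm ?_)
  simp only [norm_smul, mFourier_norm, mul_one, Complex.norm_real]
  exact hc.norm

theorem hasSum_fourierSeries_apply {c : (ι → ℤ) → ℝ} (hc : Summable c) (u : UnitAddTorus ι) :
    HasSum (fun n => (c n : ℂ) * mFourier n u) (fourierSeries c u) := by
  simpa only [map_smul] using! (ContinuousMap.evalCLM ℂ u).hasSum (hasSum_fourierSeries hc)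

/-- Integration of a bounded function against an absolutely convergent Fourier series. -/
theorem hasSum_integral_mul_fourierSeries {c : (ι → ℤ) → ℝ} (hc : Summable c)
    {f : UnitAddTorus ι → ℂ} (hf : Integrable f) :
    HasSum (fun n => (c n : ℂ) * ∫ u, f u * mFourier n u) (∫ u, f u * fourierSeries c u) := by
  have hm : ∀ n : ι → ℤ, Integrable fun u => f u * mFourier n u := fun n =>
    hf.mul_bdd (c := 1) (mFourier n).continuous.aestronglyMeasurable
      (ae_of_all _ fun u => (ContinuousMap.norm_coe_le_norm _ u).trans mFourier_norm.le)
  have hi : ∀ n, Integrable fun u => f u * ((c n : ℂ) * mFourier n u) := fun n => by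
    have := (hm n).const_mul (c n : ℂ)
    refine this.congr (ae_of_all _ fun u => ?_)
    simp only; ring
  have hs : Summable fun n => ∫ u, ‖f u * ((c n : ℂ) * mFourier n u)‖ := by
    refine Summable.of_nonneg_of_le (fun n => integral_nonneg fun u => norm_nonneg _) (fun n => ?_)
      (hc.norm.mul_right (∫ u, ‖f u‖))
    rw [← integral_const_mul]
    refine integral_mono (hi n).norm (hf.norm.const_mul _) fun u => ?_
    simp only [norm_mul, Complex.norm_real]
    have : ‖mFourier n u‖ ≤ 1 := (ContinuousMap.norm_coe_le_norm _ u).trans mFourier_norm.le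
    calc ‖f u‖ * (‖c n‖ * ‖mFourier n u‖) ≤ ‖f u‖ * (‖c n‖ * 1) := by gcongr
      _ = _ := by ring
  have h := hasSum_integral_of_summable_integral_norm hi hs
  have e1 : ∀ n, ∫ u, f u * ((c n : ℂ) * mFourier n u) = (c n : ℂ) * ∫ u, f u * mFourier n u := by
    intro n
    rw [← integral_const_mul]
    exact integral_congr_ae (ae_of_all _ fun u => by simp only; ring)
  have e2 : ∫ u, ∑' n, f u * ((c n : ℂ) * mFourier n u) = ∫ u, f u * fourierSeries c u := by
    refine integral_congr_ae (ae_of_all _ fun u => ?_)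
    simp only
    rw [tsum_mul_left, (hasSum_fourierSeries_apply hc u).tsum_eq]
  rw [e2] at h
  simpa only [e1] using h

theorem mFourierCoeff_fourierSeries {c : (ι → ℤ) → ℝ} (hc : Summable c) (n : ι → ℤ) :
    mFourierCoeff (fourierSeries c) n = c n := by
  classical
  have h := hasSum_integral_mul_fourierSeries hc (f := mFourier (-n))
    ((mFourier (-n)).continuous.integrable_of_hasCompactSupport (HasCompactSupport.of_compactSpace _))
  have e : ∀ m, (c m : ℂ) * ∫ u, mFourier (-n) u * mFourier m u = if m = n then (c n : ℂ) else 0 := by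
    intro m
    have : ∫ u, mFourier (-n) u * mFourier m u = ∫ u : UnitAddTorus ι, mFourier (-n + m) u :=
      integral_congr_ae (ae_of_all _ fun u => by simp only [mFourier_add])
    rw [this, integral_mFourier]
    by_cases hmn : m = n
    · simp [hmn]
    · have : ¬ (-n + m = 0) := fun h => hmn (neg_add_eq_zero.1 h).symm
      simp [hmn, this]
  simp only [e] at h
  rw [← h.unique (hasSum_ite_eq n (c n : ℂ))]
  rfl

theorem ae_eq_fourierSeries {f : UnitAddTorus ι → ℝ} (hf : Measurable f) {A : ℝ}
    (h0 : ∀ u, 0 ≤ f u) (hA : ∀ u, f u ≤ A) {c : (ι → ℤ) → ℝ} (hc : Summable c)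
    (hfc : ∀ n, mFourierCoeff (fun u => (f u : ℂ)) n = c n) :
    (fun u => (f u : ℂ)) =ᵐ[volume] fourierSeries c := by
  have hL : MemLp (fun u => (f u : ℂ)) 2 (volume : Measure (UnitAddTorus ι)) :=
    MemLp.of_bound (Complex.measurable_ofReal.comp hf).aestronglyMeasurable A
      (ae_of_all _ fun u => by rw [Complex.norm_real, Real.norm_eq_abs, abs_of_nonneg (h0 u)]; exact hA u)
  have heq : hL.toLp _ = ContinuousMap.toLp 2 volume ℂ (fourierSeries c) := by
    apply mFourierBasis.repr.injective
    ext n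
    rw [mFourierBasis_repr, mFourierBasis_repr, mFourierCoeff_toLp, mFourierCoeff_fourierSeries hc,
      ← hfc]
    exact integral_congr_ae (hL.coeFn_toLp.mono fun u hu => by simp only [hu])
  have h1 := hL.coeFn_toLp
  rw [heq] at h1
  exact h1.symm.trans (ContinuousMap.coeFn_toLp volume _)

end Torus

/-! ### Kernels on the torus -/

section TorusKernel

open UnitAddTorus ComplexConjugate

attribute [local instance] instMeasureSpaceUnitAddCircle
  instIsAddHaarMeasureUnitAddCircleVolume instIsProbabilityMeasureUnitAddCircleVolume

variable {ι : Type*} [Fintype ι]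

theorem mFourier_apply_zero (n : ι → ℤ) : mFourier n (0 : UnitAddTorus ι) = 1 := by
  simp [mFourier]

theorem mFourier_apply_sub (n : ι → ℤ) (u w : UnitAddTorus ι) :
    mFourier n (u - w) = mFourier n u * mFourier (-n) w := by
  rw [mFourier_neg]
  simp only [mFourier, ContinuousMap.coe_mk, Pi.sub_apply, map_prod, ← Finset.prod_mul_distrib]
  refine Finset.prod_congr rfl fun i _ => ?_
  rw [← fourier_neg, sub_eq_add_neg]
  simp [fourier_apply, AddCircle.toCircle_add, AddCircle.toCircle_neg]

/-- The convolution powers of a nonnegative function on the torus with summable nonnegative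
Fourier coefficients `c`. -/
theorem exists_kernelIter_eq {f : UnitAddTorus ι → ℝ} (hf : Measurable f) {A : ℝ}
    (h0 : ∀ u, 0 ≤ f u) (hA : ∀ u, f u ≤ A) {c : (ι → ℤ) → ℝ} (hcnn : ∀ n, 0 ≤ c n)
    (hc : Summable c)
    (hfc : ∀ n, mFourierCoeff (fun u => (f u : ℂ)) n = c n) (hf0 : HasSum c (f 0)) {V : ℝ}
    (hV : 0 ≤ V) (j : ℕ) :
    ∃ h : UnitAddTorus ι → ℝ, Measurable h ∧ (∀ u, 0 ≤ h u) ∧ (∃ A', ∀ u, h u ≤ A') ∧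
      (∀ u v, kernelIter (ENNReal.ofReal V • volume) (fun u v => ENNReal.ofReal (f (u - v)))
        (fun u v => ENNReal.ofReal (f (u - v))) j u v = ENNReal.ofReal (h (u - v))) ∧
      (∀ n, mFourierCoeff (fun u => (h u : ℂ)) n = ((V ^ j * c n ^ (j + 1) : ℝ) : ℂ)) ∧
      HasSum (fun n => V ^ j * c n ^ (j + 1)) (h 0) := by
  have : (AddCircle.haarAddCircle (T := 1)).Regular :=
    inferInstanceAs (Measure.addHaarMeasure _).Regular
  have : (volume : Measure UnitAddCircle).IsNegInvariant :=
    inferInstanceAs (AddCircle.haarAddCircle (T := 1)).IsNegInvariant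
  induction j with
  | zero =>
    refine ⟨f, hf, h0, ⟨A, hA⟩, fun u v => rfl, ?_, ?_⟩
    · simpa using hfc
    · simpa using hf0
  | succ j ih =>
    obtain ⟨h, hm, hh0, ⟨A', hA'⟩, hk, hcoef, hsum⟩ := ih
    have hA0 : 0 ≤ A := (h0 0).trans (hA 0)
    have hA0' : 0 ≤ A' := (hh0 0).trans (hA' 0)
    have hprod0 : ∀ u w, 0 ≤ h (u - w) * f w := fun u w => mul_nonneg (hh0 _) (h0 _)
    have hint : ∀ u, Integrable fun w => h (u - w) * f w := fun u =>
      integrable_ofReal_of_bounded ((hm.comp (measurable_const.sub measurable_id)).mul hf)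
        (hprod0 u) fun w => mul_le_mul (hA' _) (hA w) (h0 w) hA0'
    set c' : (ι → ℤ) → ℝ := fun n => V ^ (j + 1) * c n ^ (j + 1 + 1) with hc'
    have hc's : Summable c' := by
      have hb : ∀ n, c n ≤ ∑' m, c m := fun n => hc.le_tsum n fun m _ => hcnn m
      have hS : 0 ≤ ∑' m, c m := tsum_nonneg hcnn
      refine Summable.mul_left _ (Summable.of_nonneg_of_le (fun n => pow_nonneg (hcnn n) _)
        (fun n => ?_) (hc.mul_left ((∑' m, c m) ^ (j + 1))))
      rw [pow_succ]
      exact mul_le_mul_of_nonneg_right (pow_le_pow_left₀ (hcnn n) (hb n) _) (hcnn n)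
    set h' : UnitAddTorus ι → ℝ := fun u => V * ∫ w, h (u - w) * f w with hh'
    have hae := ae_eq_fourierSeries hf h0 hA hc hfc
    have hser : ∀ u, (h' u : ℂ) = fourierSeries c' u := by
      intro u
      have hi : Integrable fun w => (h (u - w) : ℂ) :=
        (integrable_ofReal_of_bounded (hm.comp (measurable_const.sub measurable_id))
          (fun w => hh0 _) fun w => hA' _).ofReal
      have h1 := hasSum_integral_mul_fourierSeries hc hi
      have h2 : ∫ w, (h (u - w) : ℂ) * fourierSeries c w =
          ((∫ w, h (u - w) * f w : ℝ) : ℂ) := by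
        rw [← integral_complex_ofReal]
        refine integral_congr_ae (hae.mono fun w hw => ?_)
        simp only at hw ⊢
        rw [← hw, Complex.ofReal_mul]
      have h3 : ∀ n, ∫ w, (h (u - w) : ℂ) * mFourier n w =
          mFourier n u * ((V ^ j * c n ^ (j + 1) : ℝ) : ℂ) := by
        intro n
        rw [← hcoef n]
        have := integral_sub_left_eq_self (μ := (volume : Measure (UnitAddTorus ι)))
          (fun w => (h w : ℂ) * mFourier n (u - w)) u
        simp only [sub_sub_cancel] at this
        rw [this, mFourierCoeff, ← integral_const_mul]
        refine integral_congr_ae (ae_of_all _ fun w => ?_)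
        simp only [mFourier_apply_sub, smul_eq_mul]
        ring
      rw [h2] at h1
      simp only [h3] at h1
      have h4 := h1.mul_left (V : ℂ)
      refine (HasSum.unique ?_ (hasSum_fourierSeries_apply hc's u))
      rw [hh', Complex.ofReal_mul]
      have e : (fun n => (c' n : ℂ) * mFourier n u) = fun n => (V : ℂ) * ((c n : ℂ) *
          (mFourier n u * ((V ^ j * c n ^ (j + 1) : ℝ) : ℂ))) := by
        funext n
        simp only [hc']
        push_cast
        ring
      rw [e]
      exact h4
    have hre : h' = fun u => (fourierSeries c' u).re := by
      funext u; rw [← hser u, Complex.ofReal_re]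
    have hh'0 : ∀ u, 0 ≤ h' u := fun u => mul_nonneg hV (integral_nonneg (hprod0 u))
    refine ⟨h', ?_, hh'0, ⟨V * (A' * A), fun u => ?_⟩, ?_, ?_, ?_⟩
    · rw [hre]
      exact (Complex.continuous_re.comp (fourierSeries c').continuous).measurable
    · refine mul_le_mul_of_nonneg_left ?_ hV
      have := integral_mono (hint u) (integrable_const (A' * A))
        fun w => mul_le_mul (hA' (u - w)) (hA w) (h0 w) hA0'
      simpa using this
    · intro u v
      rw [kernelIter, kernelComp, lintegral_smul_measure, smul_eq_mul]
      simp only [hk]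
      have e : ∫⁻ w, ENNReal.ofReal (h (u - w)) * ENNReal.ofReal (f (w - v)) =
          ENNReal.ofReal (∫ w, h (u - v - w) * f w) := by
        rw [ofReal_integral_eq_lintegral_ofReal (hint _) (ae_of_all _ (hprod0 _)),
          ← lintegral_sub_right_eq_self (fun w => ENNReal.ofReal (h (u - v - w) * f w)) v]
        refine lintegral_congr fun w => ?_
        rw [← ENNReal.ofReal_mul (hh0 _)]
        congr 3
        abel
      rw [e, ← ENNReal.ofReal_mul hV]
    · intro n
      have : (fun u => (h' u : ℂ)) = fourierSeries c' := funext hser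
      rw [this, mFourierCoeff_fourierSeries hc's]
    · have h1 := hasSum_fourierSeries_apply hc's 0
      rw [← hser 0] at h1
      simp only [mFourier_apply_zero, mul_one] at h1
      exact_mod_cast h1

/-- The traces of the powers of a translation-invariant kernel on the torus are the power sums of
its Fourier coefficients. -/
theorem kernelTrace_torus {f : UnitAddTorus ι → ℝ} (hf : Measurable f) {A : ℝ}
    (h0 : ∀ u, 0 ≤ f u) (hA : ∀ u, f u ≤ A) {c : (ι → ℤ) → ℝ} (hcnn : ∀ n, 0 ≤ c n)
    (hc : Summable c)
    (hfc : ∀ n, mFourierCoeff (fun u => (f u : ℂ)) n = c n) (hf0 : HasSum c (f 0)) {V : ℝ}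
    (hV : 0 ≤ V) (j : ℕ) :
    Summable (fun n => (V * c n) ^ (j + 1)) ∧
    kernelTrace (ENNReal.ofReal V • volume)
      (kernelIter (ENNReal.ofReal V • volume) (fun u v => ENNReal.ofReal (f (u - v)))
        (fun u v => ENNReal.ofReal (f (u - v))) j) =
      ENNReal.ofReal (∑' n, (V * c n) ^ (j + 1)) := by
  obtain ⟨h, hm, hh0, -, hk, -, hsum⟩ := exists_kernelIter_eq hf h0 hA hcnn hc hfc hf0 hV j
  have h1 := hsum.mul_left V
  have e : (fun n => V * (V ^ j * c n ^ (j + 1))) = fun n => (V * c n) ^ (j + 1) := by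
    funext n; ring
  rw [e] at h1
  refine ⟨h1.summable, ?_⟩
  rw [h1.tsum_eq, kernelTrace, lintegral_smul_measure, smul_eq_mul]
  simp only [hk, sub_self]
  rw [lintegral_const, measure_univ, mul_one, ← ENNReal.ofReal_mul hV]

end TorusKernel

/-! ### Kernels under a change of variables -/

section KernelMap

theorem kernelIter_map {X Y : Type*} [MeasurableSpace X] [MeasurableSpace Y] {μ : Measure X}
    [SigmaFinite μ] {q : X → Y} (hq : Measurable q) {K : Y → Y → ℝ≥0∞} [SigmaFinite (μ.map q)]
    (hK : Measurable (Function.uncurry K)) (j : ℕ) :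
    Measurable (Function.uncurry (kernelIter (μ.map q) K K j)) ∧
    ∀ x y, kernelIter μ (fun x y => K (q x) (q y)) (fun x y => K (q x) (q y)) j x y =
      kernelIter (μ.map q) K K j (q x) (q y) := by
  induction j with
  | zero => exact ⟨hK, fun x y => rfl⟩
  | succ j ih =>
    refine ⟨measurable_kernelComp _ ih.1 hK, fun x y => ?_⟩
    rw [kernelIter, kernelIter, kernelComp, kernelComp, lintegral_map _ hq]
    · simp only [ih.2]
    · exact (ih.1.comp (measurable_const.prodMk measurable_id)).mul
        (hK.comp (measurable_id.prodMk measurable_const))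

theorem kernelTrace_map {X Y : Type*} [MeasurableSpace X] [MeasurableSpace Y] {μ : Measure X}
    [SigmaFinite μ] {q : X → Y} (hq : Measurable q) {K : Y → Y → ℝ≥0∞} [SigmaFinite (μ.map q)]
    (hK : Measurable (Function.uncurry K)) (j : ℕ) :
    kernelTrace μ (kernelIter μ (fun x y => K (q x) (q y)) (fun x y => K (q x) (q y)) j) =
      kernelTrace (μ.map q) (kernelIter (μ.map q) K K j) := by
  obtain ⟨h1, h2⟩ := kernelIter_map (μ := μ) hq hK j
  have hd : Measurable fun y => kernelIter (μ.map q) K K j y y :=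
    h1.comp (measurable_id.prodMk measurable_id)
  rw [kernelTrace, kernelTrace, lintegral_map hd hq]
  simp only [h2]

end KernelMap

/-! ### Positive definite jump weights -/

section JumpWeight

open Real RealInnerProductSpace

/-- A continuous integrable even weight `g ≥ 0` on `ℝ^d` with `g 0 = 1` whose Fourier transform
is the nonnegative function `G`. -/
structure IsJumpWeight {d : ℕ} (g G : Space d → ℝ) : Prop where
  continuous : Continuous g
  nonneg : ∀ x, 0 ≤ g x
  zero : g 0 = 1
  even : ∀ x, g (-x) = g x
  integrable : Integrable g
  fourier : ∀ k, 𝓕 (fun x => (g x : ℂ)) k = G k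
  fourier_nonneg : ∀ k, 0 ≤ G k

variable {d : ℕ} {g G : Space d → ℝ}

namespace IsJumpWeight

theorem fourier_eq (h : IsJumpWeight g G) :
    𝓕 (fun x => (g x : ℂ)) = fun k => (G k : ℂ) := funext h.fourier

theorem continuous_fourier (h : IsJumpWeight g G) : Continuous G := by
  have h1 : Continuous (𝓕 (fun x => (g x : ℂ))) :=
    VectorFourier.fourierIntegral_continuous Real.continuous_fourierChar
      (by exact continuous_inner) h.integrable.ofReal
  rw [h.fourier_eq] at h1
  have := Complex.continuous_re.comp h1
  exact this

theorem integrable_cos_mul {f : Space d → ℝ} (hf : Integrable f) (k : Space d) :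
    Integrable fun x => Real.cos (2 * π * ⟪x, k⟫) * f x :=
  hf.bdd_mul (c := 1) (by fun_prop) (ae_of_all _ fun x => Real.abs_cos_le_one _)

theorem re_fourierChar (x : ℝ) : ((Real.fourierChar x : Circle) : ℂ).re = Real.cos (2 * π * x) := by
  rw [Real.fourierChar_apply, ← Complex.exp_ofReal_mul_I_re]

theorem fourier_eq_integral_cos (h : IsJumpWeight g G) (k : Space d) :
    G k = ∫ x, Real.cos (2 * π * ⟪x, k⟫) * g x := by
  have h1 := h.fourier k
  rw [Real.fourier_eq] at h1
  have hi : Integrable fun x => (Real.fourierChar (-⟪x, k⟫)) • (g x : ℂ) :=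
    (Real.fourierIntegral_convergent_iff k).2 h.integrable.ofReal
  have h2 := congrArg Complex.re h1
  rw [Complex.ofReal_re, ← RCLike.re_eq_complex_re, ← integral_re hi] at h2
  rw [← h2]
  refine integral_congr_ae (ae_of_all _ fun x => ?_)
  simp only [RCLike.re_eq_complex_re, Circle.smul_def, smul_eq_mul, Complex.re_mul_ofReal,
    re_fourierChar]
  rw [mul_neg, Real.cos_neg]

/-- A nonnegative Fourier transform of a continuous integrable function is integrable: its integrals
against widening Gaussians converge to the value at `0` of the function, and Fatou's lemma
applies. -/
theorem integrable_fourier (h : IsJumpWeight g G) : Integrable G := by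
  have hgC : Integrable fun x => (g x : ℂ) := h.integrable.ofReal
  have hlim := Real.tendsto_integral_gaussian_smul' (f := fun x => (g x : ℂ))
    h.integrable.ofReal (v := 0) (by exact (Complex.continuous_ofReal.comp h.continuous).continuousAt)
  have hB : Tendsto (fun c : ℝ => ∫ w : Space d, Real.exp (-c⁻¹ * ‖w‖ ^ 2) * G w) atTop
      (𝓝 1) := by
    have h2 : Tendsto (fun c : ℝ => ((∫ w : Space d, Real.exp (-c⁻¹ * ‖w‖ ^ 2) * G w : ℝ) : ℂ)) atTop
        (𝓝 ((1 : ℝ) : ℂ)) := by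
      rw [h.zero] at hlim
      refine hlim.congr' ?_
      filter_upwards [Ioi_mem_atTop 0] with c (hc : 0 < c)
      have J : Integrable (fun w : Space d => Complex.exp (-c⁻¹ * ‖w‖ ^ 2)) := by
        simpa using GaussianFourier.integrable_cexp_neg_mul_sq_norm_add
          (V := Space d) (b := (c⁻¹ : ℂ)) (by simpa) 0 0
      have key := (VectorFourier.integral_fourierIntegral_smul_eq_flip (L := innerₗ (Space d))
        (μ := volume) (ν := volume)
        Real.continuous_fourierChar continuous_inner J hgC)
      rw [flip_innerₗ] at key
      change ∫ w, (𝓕 (fun w : Space d => Complex.exp (-c⁻¹ * ‖w‖ ^ 2))) w • (g w : ℂ) =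
        ∫ w, Complex.exp (-c⁻¹ * ‖w‖ ^ 2) • (𝓕 (fun x => (g x : ℂ))) w at key
      rw [h.fourier_eq] at key
      rw [← integral_complex_ofReal]
      have e1 : (fun w : Space d => Complex.exp (-c⁻¹ * ‖w‖ ^ 2) • (G w : ℂ)) =
          fun w => ((Real.exp (-c⁻¹ * ‖w‖ ^ 2) * G w : ℝ) : ℂ) := by
        funext w; push_cast; rfl
      rw [e1] at key
      rw [← key]
      congr with w
      rw [fourier_gaussian_innerProductSpace (by simpa)]
      simp only [zero_sub, norm_neg, Complex.ofReal_inv, div_inv_eq_mul]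
      rw [mul_right_comm (-(π : ℂ) ^ 2)]
    exact (Complex.continuous_re.tendsto _).comp h2
  refine ⟨h.continuous_fourier.aestronglyMeasurable, ?_⟩
  rw [hasFiniteIntegral_iff_ofReal (ae_of_all _ h.fourier_nonneg)]
  have hmeas : ∀ c : ℝ, Measurable fun w : Space d =>
      ENNReal.ofReal (Real.exp (-c⁻¹ * ‖w‖ ^ 2) * G w) := fun c =>
    ENNReal.measurable_ofReal.comp
      ((by fun_prop : Continuous fun w : Space d => Real.exp (-c⁻¹ * ‖w‖ ^ 2)).mul
        h.continuous_fourier).measurable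
  have hpt : ∀ w : Space d, liminf (fun c : ℝ => ENNReal.ofReal (Real.exp (-c⁻¹ * ‖w‖ ^ 2) * G w))
      atTop = ENNReal.ofReal (G w) := by
    intro w
    refine Tendsto.liminf_eq (ENNReal.tendsto_ofReal ?_)
    have h3 : Tendsto (fun c : ℝ => Real.exp (-c⁻¹ * ‖w‖ ^ 2) * G w) atTop
        (𝓝 (Real.exp (-0 * ‖w‖ ^ 2) * G w)) :=
      ((Real.continuous_exp.tendsto _).comp
        ((tendsto_inv_atTop_zero.neg).mul_const _)).mul_const _
    simpa using h3
  have hF := lintegral_liminf_le (μ := volume) (u := atTop) hmeas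
  simp only [hpt] at hF
  refine hF.trans_lt ?_
  have hev : (fun c : ℝ => ∫⁻ w, ENNReal.ofReal (Real.exp (-c⁻¹ * ‖w‖ ^ 2) * G w)) =ᶠ[atTop]
      fun c => ENNReal.ofReal (∫ w : Space d, Real.exp (-c⁻¹ * ‖w‖ ^ 2) * G w) := by
    filter_upwards [Ioi_mem_atTop 0] with c (hc : 0 < c)
    rw [ofReal_integral_eq_lintegral_ofReal]
    · have J : Integrable (fun w : Space d => Real.exp (-c⁻¹ * ‖w‖ ^ 2)) := by
        have := GaussianFourier.integrable_cexp_neg_mul_sq_norm_add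
          (V := Space d) (b := (c⁻¹ : ℂ)) (by simpa) 0 0
        have h4 := this.re
        refine h4.congr (ae_of_all _ fun w => ?_)
        simp only [zero_mul, add_zero, RCLike.re_eq_complex_re]
        rw [← Complex.ofReal_re (Real.exp _)]
        push_cast
        rfl
      refine J.mul_bdd (c := ∫ x, ‖g x‖) h.continuous_fourier.aestronglyMeasurable
        (ae_of_all _ fun k => ?_)
      rw [h.fourier_eq_integral_cos]
      refine (norm_integral_le_integral_norm _).trans ?_
      refine integral_mono (integrable_cos_mul h.integrable k).norm h.integrable.norm fun x => ?_
      simp only [norm_mul]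
      exact mul_le_of_le_one_left (norm_nonneg _) (Real.abs_cos_le_one _)
    · exact ae_of_all _ fun w => mul_nonneg (Real.exp_pos _).le (h.fourier_nonneg w)
  rw [(((ENNReal.tendsto_ofReal hB).congr' hev.symm)).liminf_eq]
  exact ENNReal.ofReal_lt_top

theorem eq_integral_cos (h : IsJumpWeight g G) (x : Space d) :
    g x = ∫ k, Real.cos (2 * π * ⟪k, x⟫) * G k := by
  have hG : Integrable (𝓕 (fun x => (g x : ℂ))) := by
    rw [h.fourier_eq]; exact h.integrable_fourier.ofReal
  have h1 := MeasureTheory.Integrable.fourierInv_fourier_eq (f := fun x => (g x : ℂ))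
    h.integrable.ofReal hG (v := x)
    (by exact (Complex.continuous_ofReal.comp h.continuous).continuousAt)
  rw [h.fourier_eq, Real.fourierInv_eq] at h1
  have hi : Integrable fun k => (Real.fourierChar ⟪k, x⟫) • (G k : ℂ) := by
    have hGC : Integrable fun k => (G k : ℂ) := h.integrable_fourier.ofReal
    simpa using (Real.fourierIntegral_convergent_iff (-x)).2 hGC
  have h2 := congrArg Complex.re h1
  rw [Complex.ofReal_re, ← RCLike.re_eq_complex_re, ← integral_re hi] at h2
  rw [← h2]
  refine integral_congr_ae (ae_of_all _ fun k => ?_)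
  simp only [RCLike.re_eq_complex_re, Circle.smul_def, smul_eq_mul, Complex.re_mul_ofReal,
    re_fourierChar]

theorem integral_fourier (h : IsJumpWeight g G) : ∫ k, G k = 1 := by
  have := h.eq_integral_cos 0
  simpa [h.zero] using this.symm

theorem sum_cos_add_sub {ι : Type*} (B : Finset ι) (θ : ℝ) (α : ι → ℝ) :
    ∑ y ∈ B, ∑ y' ∈ B, Real.cos (θ + (α y - α y')) =
      Real.cos θ * ((∑ y ∈ B, Real.cos (α y)) ^ 2 + (∑ y ∈ B, Real.sin (α y)) ^ 2) := by
  have e : ∀ y y', Real.cos (θ + (α y - α y')) =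
      Real.cos θ * (Real.cos (α y) * Real.cos (α y')) +
      Real.cos θ * (Real.sin (α y) * Real.sin (α y')) -
      Real.sin θ * (Real.sin (α y) * Real.cos (α y')) +
      Real.sin θ * (Real.cos (α y) * Real.sin (α y')) := by
    intro y y'
    rw [Real.cos_add, Real.cos_sub, Real.sin_sub]; ring
  simp only [e, Finset.sum_add_distrib, Finset.sum_sub_distrib, ← Finset.mul_sum,
    ← Finset.sum_mul]
  ring

/-- Positive definiteness: averaged over differences, `g` is largest without a shift. -/
theorem sum_sub_le (h : IsJumpWeight g G) {ι : Type*} (B : Finset ι) (a : ι → Space d)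
    (x : Space d) :
    ∑ y ∈ B, ∑ y' ∈ B, g (x + (a y - a y')) ≤ ∑ y ∈ B, ∑ y' ∈ B, g (a y - a y') := by
  have key : ∀ x, ∑ y ∈ B, ∑ y' ∈ B, g (x + (a y - a y')) = ∫ k, Real.cos (2 * π * ⟪k, x⟫) *
      ((∑ y ∈ B, Real.cos (2 * π * ⟪k, a y⟫)) ^ 2 +
        (∑ y ∈ B, Real.sin (2 * π * ⟪k, a y⟫)) ^ 2) * G k := by
    intro x
    simp only [h.eq_integral_cos]
    simp_rw [← integral_finsetSum B fun y' _ => integrable_cos_mul h.integrable_fourier _]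
    rw [← integral_finsetSum B fun y _ => integrable_finsetSum B fun y' _ =>
      integrable_cos_mul h.integrable_fourier _]
    refine integral_congr_ae (ae_of_all _ fun k => ?_)
    simp only
    rw [← sum_cos_add_sub, Finset.sum_mul]
    refine Finset.sum_congr rfl fun y _ => ?_
    rw [Finset.sum_mul]
    refine Finset.sum_congr rfl fun y' _ => ?_
    rw [inner_add_right, inner_sub_right]
    congr 2
    ring
  have h0 := key 0
  simp only [zero_add] at h0
  have hint : ∀ x, Integrable fun k => Real.cos (2 * π * ⟪k, x⟫) *
      ((∑ y ∈ B, Real.cos (2 * π * ⟪k, a y⟫)) ^ 2 +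
        (∑ y ∈ B, Real.sin (2 * π * ⟪k, a y⟫)) ^ 2) * G k := by
    intro x
    refine h.integrable_fourier.bdd_mul (c := (B.card : ℝ) ^ 2 + (B.card : ℝ) ^ 2) (by fun_prop)
      (ae_of_all _ fun k => ?_)
    have hb : ∀ f : ι → ℝ, (∀ y, |f y| ≤ 1) → (∑ y ∈ B, f y) ^ 2 ≤ (B.card : ℝ) ^ 2 := by
      intro f hf
      rw [← sq_abs]
      refine pow_le_pow_left₀ (abs_nonneg _) ((Finset.abs_sum_le_sum_abs _ _).trans ?_) 2
      exact (Finset.sum_le_sum fun y _ => hf y).trans (by simp)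
    rw [norm_mul, Real.norm_eq_abs, Real.norm_eq_abs,
      abs_of_nonneg (by positivity : (0 : ℝ) ≤ (∑ y ∈ B, Real.cos (2 * π * ⟪k, a y⟫)) ^ 2 +
        (∑ y ∈ B, Real.sin (2 * π * ⟪k, a y⟫)) ^ 2)]
    refine (mul_le_of_le_one_left (by positivity) (Real.abs_cos_le_one _)).trans ?_
    exact add_le_add (hb _ fun y => Real.abs_cos_le_one _) (hb _ fun y => Real.abs_sin_le_one _)
  rw [h0, key x]
  refine integral_mono (hint x) (hint 0) fun k => ?_
  simp only [inner_zero_right, mul_zero, Real.cos_zero, one_mul]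
  refine mul_le_mul_of_nonneg_right ?_ (h.fourier_nonneg k)
  exact mul_le_of_le_one_left (by positivity) (Real.cos_le_one _)

theorem latticeVec_sub (L : ℝ) (y y' : Fin d → ℤ) :
    latticeVec L (y - y') = latticeVec L y - latticeVec L y' := by
  ext j; simp [latticeVec]; ring

theorem latticeVec_neg (L : ℝ) (y : Fin d → ℤ) :
    latticeVec L (-y) = -latticeVec L y := by
  ext j; simp [latticeVec]

/-- The periodisation of a positive definite function is largest at the origin. -/
theorem summable_and_tsum_le (h : IsJumpWeight g G) {L : ℝ}
    (hs : Summable fun z => g (latticeVec L z)) (x : Space d) :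
    Summable (fun z => g (x - latticeVec L z)) ∧
      ∑' z, g (x - latticeVec L z) ≤ ∑' z, g (latticeVec L z) := by
  have hb : ∀ F : Finset (Fin d → ℤ), ∑ z ∈ F, g (x - latticeVec L z) ≤
      ∑' z, g (latticeVec L z) := by
    refine sum_le_of_latticeCube (fun z => h.nonneg _) fun M => ?_
    set B := latticeCube (Fin d) M
    have h1 := h.sum_sub_le B (fun y => -latticeVec L y) x
    have h2 : ∀ y y', x - latticeVec L (y - y') = x + (-latticeVec L y - -latticeVec L y') := by
      intro y y'; rw [latticeVec_sub]; abel
    have h3 : ∀ y ∈ B, ∑ y' ∈ B, g (-latticeVec L y - -latticeVec L y') ≤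
        ∑' z, g (latticeVec L z) := by
      intro y _
      have e : ∑ y' ∈ B, g (-latticeVec L y - -latticeVec L y') =
          ∑ z ∈ B.image fun y' => y' - y, g (latticeVec L z) := by
        rw [Finset.sum_image fun a _ b _ hab => sub_left_injective hab]
        refine Finset.sum_congr rfl fun y' _ => ?_
        rw [latticeVec_sub]; congr 1; abel
      rw [e]
      exact hs.sum_le_tsum _ fun z _ => h.nonneg _
    simp only [h2]
    refine h1.trans ((Finset.sum_le_sum h3).trans ?_)
    rw [Finset.sum_const, nsmul_eq_mul, mul_comm]
  have hsum := summable_of_sum_le (fun z => h.nonneg _) hb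
  exact ⟨hsum, hsum.tsum_le_of_sum_le hb⟩

end IsJumpWeight

end JumpWeight

/-! ### Lattice cells -/

section Cells

variable {d : ℕ}

/-- The index of the half-open lattice cell of side `L` that contains `x`. -/
noncomputable def cellIndex (L : ℝ) (x : Space d) : Fin d → ℤ := fun j => ⌊x j / L⌋

/-- The lattice cell of side `L` with index `z`. -/
def cell (L : ℝ) (z : Fin d → ℤ) : Set (Space d) := cellIndex L ⁻¹' {z}

theorem measurable_cellIndex (L : ℝ) : Measurable (cellIndex (d := d) L) := by
  refine measurable_pi_lambda _ fun j => Int.measurable_floor.comp ?_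
  exact Measurable.div_const (by fun_prop) _

theorem measurableSet_cell (L : ℝ) (z : Fin d → ℤ) : MeasurableSet (cell L z) :=
  measurable_cellIndex L (measurableSet_singleton z)

theorem pairwise_disjoint_cell (L : ℝ) : Pairwise (Function.onFun Disjoint (cell (d := d) L)) := by
  intro z z' hz
  exact Disjoint.preimage _ (Set.disjoint_singleton.2 hz)

theorem iUnion_cell (L : ℝ) : ⋃ z, cell (d := d) L z = Set.univ := by
  ext x; simp [cell]

theorem preimage_add_cell {L : ℝ} (hL : 0 < L) (z : Fin d → ℤ) :
    (fun x : Space d => x + latticeVec L z) ⁻¹' cell L z = cell L 0 := by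
  ext x
  simp only [cell, cellIndex, Set.mem_preimage, Set.mem_singleton_iff, funext_iff]
  refine forall_congr' fun j => ?_
  have : (x + latticeVec L z) j / L = x j / L + z j := by
    simp [latticeVec]; field_simp
  rw [this, Int.floor_add_intCast]
  simp

theorem cell_zero_ae_eq_box {L : ℝ} (hL : 0 < L) : cell L 0 =ᵐ[volume] box d L := by
  have h1 : (Set.univ.pi fun _ : Fin d => Set.Ico 0 L) =ᵐ[volume]
      (Set.univ.pi fun _ : Fin d => Set.Ioo 0 L) :=
    (Measure.univ_pi_Ico_ae_eq_Icc (f := fun _ => 0) (g := fun _ => L)).trans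
      (Measure.univ_pi_Ioo_ae_eq_Icc (f := fun _ => 0) (g := fun _ => L)).symm
  have h2 := (PiLp.volume_preserving_ofLp (Fin d)).quasiMeasurePreserving.preimage_ae_eq h1
  have e1 : cell L 0 = (WithLp.ofLp : Space d → _) ⁻¹' Set.univ.pi fun _ : Fin d => Set.Ico 0 L := by
    ext x
    simp only [cell, cellIndex, Set.mem_preimage, Set.mem_singleton_iff, funext_iff, Set.mem_pi,
      Set.mem_univ, true_implies, Set.mem_Ico, Pi.zero_apply, Int.floor_eq_zero_iff]
    refine forall_congr' fun j => ?_
    rw [le_div_iff₀ hL, div_lt_iff₀ hL, zero_mul, one_mul]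
  have e2 : box d L = (WithLp.ofLp : Space d → _) ⁻¹' Set.univ.pi fun _ : Fin d => Set.Ioo 0 L := by
    ext x; simp [box]
  rw [e1, e2]
  exact h2

theorem measurableSet_box (d : ℕ) (L : ℝ) : MeasurableSet (box d L) := by
  have : box d L = ⋂ j, (fun x : Space d => x j) ⁻¹' Set.Ioo 0 L := by ext x; simp [box]
  rw [this]
  exact MeasurableSet.iInter fun j => (by fun_prop : Measurable fun x : Space d => x j)
    measurableSet_Ioo

theorem volume_box (d : ℕ) {L : ℝ} (hL : 0 ≤ L) : volume (box d L) = ENNReal.ofReal (L ^ d) := by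
  have e2 : box d L = (WithLp.ofLp : Space d → _) ⁻¹' Set.univ.pi fun _ : Fin d => Set.Ioo 0 L := by
    ext x; simp [box]
  rw [e2, (PiLp.volume_preserving_ofLp (Fin d)).measure_preimage
    (MeasurableSet.univ_pi fun _ => measurableSet_Ioo).nullMeasurableSet, volume_pi_pi]
  simp [ENNReal.ofReal_pow hL]

theorem setLIntegral_cell {L : ℝ} (hL : 0 < L) (z : Fin d → ℤ) (f : Space d → ℝ≥0∞) :
    ∫⁻ x in cell L z, f x = ∫⁻ x in box d L, f (x + latticeVec L z) := by
  rw [← Measure.restrict_congr_set (cell_zero_ae_eq_box hL), ← preimage_add_cell hL z]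
  exact ((measurePreserving_add_right volume (latticeVec L z)).setLIntegral_comp_preimage_emb
    (measurableEmbedding_addRight _) f _).symm

theorem setIntegral_cell {E : Type*} [NormedAddCommGroup E] [NormedSpace ℝ E] {L : ℝ} (hL : 0 < L)
    (z : Fin d → ℤ) (f : Space d → E) :
    ∫ x in cell L z, f x = ∫ x in box d L, f (x + latticeVec L z) := by
  rw [← Measure.restrict_congr_set (cell_zero_ae_eq_box hL), ← preimage_add_cell hL z]
  exact ((measurePreserving_add_right volume (latticeVec L z)).setIntegral_preimage_emb
    (measurableEmbedding_addRight _) f _).symm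

theorem volume_cell {L : ℝ} (hL : 0 < L) (z : Fin d → ℤ) :
    volume (cell L z) = ENNReal.ofReal (L ^ d) := by
  have := setLIntegral_cell hL z fun _ => 1
  simpa [volume_box d hL.le] using this

theorem lintegral_cellIndex {L : ℝ} (hL : 0 < L) (F : (Fin d → ℤ) → ℝ≥0∞) :
    ∫⁻ x : Space d, F (cellIndex L x) = ENNReal.ofReal (L ^ d) * ∑' z, F z := by
  rw [← setLIntegral_univ, ← iUnion_cell L,
    lintegral_iUnion (fun z => measurableSet_cell L z) (pairwise_disjoint_cell L),
    ← ENNReal.tsum_mul_left]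
  congr 1
  funext z
  rw [setLIntegral_congr_fun (g := fun _ => F z) (measurableSet_cell L z)
    (fun x hx => by rw [show cellIndex L x = z from hx]), setLIntegral_const, volume_cell hL,
    mul_comm]

theorem hasSum_setIntegral_box {E : Type*} [NormedAddCommGroup E] [NormedSpace ℝ E] {L : ℝ}
    (hL : 0 < L) {f : Space d → E} (hf : Integrable f) :
    HasSum (fun z => ∫ x in box d L, f (x - latticeVec L z)) (∫ x, f x) := by
  have h := hasSum_integral_iUnion (fun z => measurableSet_cell L z) (pairwise_disjoint_cell L)
    (f := f) (μ := volume) hf.integrableOn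
  rw [iUnion_cell, setIntegral_univ] at h
  simp only [setIntegral_cell hL] at h
  rw [← (Equiv.neg (Fin d → ℤ)).hasSum_iff] at h
  convert h using 2 with z
  simp only [Function.comp, Equiv.neg_apply, IsJumpWeight.latticeVec_neg, sub_eq_add_neg]

end Cells

/-! ### The box as a torus -/

section BoxTorus

open UnitAddTorus RealInnerProductSpace

attribute [local instance] instMeasureSpaceUnitAddCircle
  instIsAddHaarMeasureUnitAddCircleVolume instIsProbabilityMeasureUnitAddCircleVolume

variable {d : ℕ}

/-- The projection of `ℝ^d` to the torus `(ℝ / L ℤ)^d`, rescaled to `(ℝ / ℤ)^d`. -/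
noncomputable def torusMap (L : ℝ) (x : Space d) : UnitAddTorus (Fin d) :=
  fun j => ((x j / L : ℝ) : UnitAddCircle)

theorem continuous_torusMap (L : ℝ) : Continuous (torusMap (d := d) L) := by
  refine continuous_pi fun j => (AddCircle.continuous_mk' 1).comp ?_
  exact Continuous.div_const (by fun_prop) _

theorem measurable_torusMap (L : ℝ) : Measurable (torusMap (d := d) L) := by
  refine measurable_pi_lambda _ fun j => AddCircle.measurable_mk'.comp ?_
  exact Measurable.div_const (by fun_prop) _

theorem torusMap_sub (L : ℝ) (x y : Space d) :
    torusMap L (x - y) = torusMap L x - torusMap L y := by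
  funext j
  simp [torusMap, sub_div]

theorem torusMap_latticeVec {L : ℝ} (hL : L ≠ 0) (z : Fin d → ℤ) :
    torusMap L (latticeVec L z) = 0 := by
  funext j
  simp only [torusMap, latticeVec, Pi.zero_apply]
  rw [mul_div_cancel_left₀ _ hL]
  rw [AddCircle.coe_eq_zero_iff]
  exact ⟨z j, by simp⟩

theorem mFourier_torusMap (L : ℝ) (n : Fin d → ℤ) (x : Space d) :
    mFourier n (torusMap L x) = (Real.fourierChar ⟪x, latticeVec L⁻¹ n⟫ : ℂ) := by
  rw [Real.fourierChar_apply, PiLp.inner_apply]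
  simp only [mFourier, ContinuousMap.coe_mk, torusMap, fourier_coe_apply]
  rw [← Complex.exp_sum]
  congr 1
  push_cast
  rw [Finset.mul_sum, Finset.sum_mul]
  refine Finset.sum_congr rfl fun j _ => ?_
  simp [latticeVec]
  ring

theorem pi_smul_measure {ι α : Type*} [Fintype ι] [MeasurableSpace α] (μ : Measure α)
    [IsFiniteMeasure μ] {c : ℝ≥0∞} (hc : c ≠ ∞) :
    Measure.pi (fun _ : ι => c • μ) = c ^ Fintype.card ι • Measure.pi fun _ : ι => μ := by
  have : IsFiniteMeasure (c • μ) := μ.smul_finite hc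
  refine Measure.pi_eq fun s _ => ?_
  rw [Measure.smul_apply, Measure.pi_pi, smul_eq_mul]
  simp [Finset.prod_mul_distrib]

theorem measurePreserving_circle {L : ℝ} (hL : 0 < L) :
    MeasurePreserving (fun x : ℝ => ((x / L : ℝ) : UnitAddCircle))
      (volume.restrict (Set.Ioo 0 L)) (ENNReal.ofReal L • volume) := by
  have h1 : MeasurePreserving (fun x : ℝ => x / L) (volume.restrict (Set.Ioo 0 L))
      (ENNReal.ofReal L • volume.restrict (Set.Ioo 0 1)) := by
    have hm : Measurable fun x : ℝ => x / L := measurable_id.div_const L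
    refine ⟨hm, ?_⟩
    have e : Set.Ioo 0 L = (fun x : ℝ => x / L) ⁻¹' Set.Ioo 0 1 := by
      ext x
      simp only [Set.mem_Ioo, Set.mem_preimage]
      rw [div_lt_one hL, lt_div_iff₀ hL, zero_mul]
    rw [e, ← Measure.restrict_map hm measurableSet_Ioo]
    simp only [div_eq_mul_inv]
    rw [Real.map_volume_mul_right (inv_ne_zero hL.ne'), inv_inv, abs_of_pos hL,
      Measure.restrict_smul]
  have h2 : MeasurePreserving (fun x : ℝ => (x : UnitAddCircle)) (volume.restrict (Set.Ioo 0 1))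
      (volume : Measure UnitAddCircle) := by
    have h3 := AddCircle.measurePreserving_mk 1 0
    rw [zero_add, ← Measure.restrict_congr_set Ioo_ae_eq_Ioc] at h3
    have h4 := AddCircle.volume_eq_smul_haarAddCircle (T := 1)
    rw [ENNReal.ofReal_one, one_smul] at h4
    rw [h4] at h3
    exact h3
  exact (h2.smul_measure (ENNReal.ofReal L)).comp h1

theorem map_torusMap {L : ℝ} (hL : 0 < L) :
    (volume.restrict (box d L)).map (torusMap L) = ENNReal.ofReal (L ^ d) • volume := by
  have e2 : box d L = (WithLp.ofLp : Space d → _) ⁻¹' Set.univ.pi fun _ : Fin d => Set.Ioo 0 L := by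
    ext x; simp [box]
  have h1 := (PiLp.volume_preserving_ofLp (Fin d)).restrict_preimage
    (s := Set.univ.pi fun _ : Fin d => Set.Ioo 0 L) (MeasurableSet.univ_pi fun _ => measurableSet_Ioo)
  rw [← e2, volume_pi, Measure.restrict_pi_pi] at h1
  have : IsFiniteMeasure (ENNReal.ofReal L • (volume : Measure UnitAddCircle)) :=
    Measure.smul_finite _ ENNReal.ofReal_ne_top
  have h2 := measurePreserving_pi (fun _ : Fin d => volume.restrict (Set.Ioo 0 L))
    (fun _ : Fin d => ENNReal.ofReal L • (volume : Measure UnitAddCircle))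
    (fun _ => measurePreserving_circle hL)
  rw [pi_smul_measure _ ENNReal.ofReal_ne_top, Fintype.card_fin, ← ENNReal.ofReal_pow hL.le] at h2
  exact (h2.comp h1).map_eq

/-- A representative in `(0, L]^d` of a point of the torus. -/
noncomputable def torusRep (L : ℝ) (u : UnitAddTorus (Fin d)) : Space d :=
  WithLp.toLp 2 fun j => L * (measurableEquivPiIoc (fun _ : Fin d => (0 : ℝ)) u).1 j

theorem measurable_torusRep (L : ℝ) : Measurable (torusRep (d := d) L) := by
  refine (PiLp.volume_preserving_toLp (Fin d)).measurable.comp ?_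
  refine measurable_pi_lambda _ fun j => Measurable.const_mul ?_ L
  exact (measurable_pi_apply j).comp (measurable_subtype_coe.comp (MeasurableEquiv.measurable _))

theorem exists_torusRep_torusMap {L : ℝ} (hL : L ≠ 0) (x : Space d) :
    ∃ z : Fin d → ℤ, torusRep L (torusMap L x) = x - latticeVec L z := by
  have h1 : (fun j => (((measurableEquivPiIoc (fun _ : Fin d => (0 : ℝ)) (torusMap L x)).1 j : ℝ) :
      UnitAddCircle)) = torusMap L x :=
    (measurableEquivPiIoc (fun _ : Fin d => (0 : ℝ))).symm_apply_apply (torusMap L x)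
  have h2 : ∀ j, ∃ z : ℤ, (measurableEquivPiIoc (fun _ : Fin d => (0 : ℝ)) (torusMap L x)).1 j =
      x j / L - z := by
    intro j
    have h3 := congrFun h1 j
    simp only [torusMap] at h3
    rw [← sub_eq_zero, ← AddCircle.coe_sub, AddCircle.coe_eq_zero_iff] at h3
    obtain ⟨n, hn⟩ := h3
    refine ⟨-n, ?_⟩
    simp only [zsmul_eq_mul, mul_one] at hn
    push_cast
    linarith
  choose z hz using h2
  refine ⟨z, ?_⟩
  ext j
  simp only [torusRep, latticeVec, PiLp.sub_apply]
  rw [hz]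
  field_simp

end BoxTorus

/-! ### The periodised kernel on the box -/

section BoxTrace

open UnitAddTorus RealInnerProductSpace

attribute [local instance] instMeasureSpaceUnitAddCircle
  instIsAddHaarMeasureUnitAddCircleVolume instIsProbabilityMeasureUnitAddCircleVolume

variable {d : ℕ} {g G : Space d → ℝ}

/-- The sum of the translates of `g` by the lattice `L ℤ^d`. -/
noncomputable def periodicSum (g : Space d → ℝ) (L : ℝ) (x : Space d) : ℝ :=
  ∑' z : Fin d → ℤ, g (x - latticeVec L z)

theorem periodicSum_sub_latticeVec (g : Space d → ℝ) (L : ℝ) (x : Space d) (z : Fin d → ℤ) :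
    periodicSum g L (x - latticeVec L z) = periodicSum g L x := by
  rw [periodicSum, periodicSum, ← (Equiv.subRight z).tsum_eq]
  refine tsum_congr fun z' => ?_
  rw [Equiv.subRight_apply, IsJumpWeight.latticeVec_sub]
  congr 1
  abel

theorem periodicSum_torusRep (g : Space d → ℝ) {L : ℝ} (hL : L ≠ 0) (x : Space d) :
    periodicSum g L (torusRep L (torusMap L x)) = periodicSum g L x := by
  obtain ⟨z, hz⟩ := exists_torusRep_torusMap hL x
  rw [hz, periodicSum_sub_latticeVec]

theorem torusMap_sub_latticeVec {L : ℝ} (hL : L ≠ 0) (x : Space d) (z : Fin d → ℤ) :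
    torusMap L (x - latticeVec L z) = torusMap L x := by
  rw [torusMap_sub, torusMap_latticeVec hL, sub_zero]

namespace IsJumpWeight

variable {L : ℝ}

theorem measurable_periodicSum (h : IsJumpWeight g G)
    (hs : Summable fun z => g (latticeVec L z)) : Measurable (periodicSum g L) := by
  have e : periodicSum g L =
      fun x => (∑' z : Fin d → ℤ, ENNReal.ofReal (g (x - latticeVec L z))).toReal := by
    funext x
    rw [← ENNReal.ofReal_tsum_of_nonneg (fun z => h.nonneg _) (h.summable_and_tsum_le hs x).1,
      ENNReal.toReal_ofReal (tsum_nonneg fun z => h.nonneg _)]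
    rfl
  rw [e]
  refine (Measurable.tsum fun z => ?_).ennreal_toReal
  exact (h.continuous.measurable.comp (measurable_id.sub_const _)).ennreal_ofReal

theorem periodicSum_nonneg (h : IsJumpWeight g G) (x : Space d) : 0 ≤ periodicSum g L x :=
  tsum_nonneg fun _ => h.nonneg _

theorem periodicSum_zero (h : IsJumpWeight g G) :
    periodicSum g L 0 = ∑' z, g (latticeVec L z) :=
  tsum_congr fun z => by rw [zero_sub, h.even]

theorem periodicSum_le (h : IsJumpWeight g G) (hs : Summable fun z => g (latticeVec L z))
    (x : Space d) : periodicSum g L x ≤ periodicSum g L 0 :=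
  (h.summable_and_tsum_le hs x).2.trans_eq h.periodicSum_zero.symm

/-- The Fourier coefficients of the periodised weight sample the Fourier transform. -/
theorem mFourierCoeff_periodicSum (h : IsJumpWeight g G) (hL : 0 < L)
    (hs : Summable fun z => g (latticeVec L z)) (n : Fin d → ℤ) :
    mFourierCoeff (fun u => ((periodicSum g L (torusRep L u) : ℝ) : ℂ)) n =
      ((G (latticeVec L⁻¹ n) / L ^ d : ℝ) : ℂ) := by
  have hm : Measurable fun u => mFourier (-n) u * ((periodicSum g L (torusRep L u) : ℝ) : ℂ) :=
    (mFourier (-n)).continuous.measurable.mul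
      (Complex.measurable_ofReal.comp ((h.measurable_periodicSum hs).comp (measurable_torusRep L)))
  have h1 := integral_map (μ := volume.restrict (box d L)) (measurable_torusMap L).aemeasurable
    (f := fun u => mFourier (-n) u * ((periodicSum g L (torusRep L u) : ℝ) : ℂ))
    hm.aestronglyMeasurable
  rw [map_torusMap hL, integral_smul_measure, ENNReal.toReal_ofReal (by positivity)] at h1
  simp only [periodicSum_torusRep g hL.ne'] at h1
  set φ : Space d → ℂ := fun x => mFourier (-n) (torusMap L x) * (g x : ℂ) with hφ
  have hnorm : ∀ x, ‖φ x‖ = g x := by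
    intro x
    rw [hφ, norm_mul, mFourier_torusMap, Circle.norm_coe, one_mul, Complex.norm_real,
      Real.norm_eq_abs, abs_of_nonneg (h.nonneg x)]
  have hφi : Integrable φ :=
    h.integrable.mono ((mFourier (-n)).continuous.comp (continuous_torusMap L) |>.mul
      (Complex.continuous_ofReal.comp h.continuous)).aestronglyMeasurable
      (ae_of_all _ fun x => by rw [hnorm, Real.norm_eq_abs, abs_of_nonneg (h.nonneg x)])
  have hφG : ∫ x, φ x = G (latticeVec L⁻¹ n) := by
    rw [← h.fourier, Real.fourier_eq]
    refine integral_congr_ae (ae_of_all _ fun x => ?_)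
    simp only [hφ]
    rw [mFourier_torusMap, latticeVec_neg, inner_neg_right, Circle.smul_def, smul_eq_mul]
  have h2 := hasSum_setIntegral_box hL hφi
  rw [hφG] at h2
  have h3 := hasSum_setIntegral_box hL hφi.norm
  have h4 := hasSum_integral_of_summable_integral_norm
    (μ := volume.restrict (box d L)) (F := fun z x => φ (x - latticeVec L z))
    (fun z => (hφi.comp_sub_right _).integrableOn) h3.summable
  have h5 : ∫ x in box d L, ∑' z, φ (x - latticeVec L z) =
      ∫ x in box d L, mFourier (-n) (torusMap L x) * (periodicSum g L x : ℂ) := by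
    refine integral_congr_ae (ae_of_all _ fun x => ?_)
    simp only [hφ, torusMap_sub_latticeVec hL.ne']
    rw [tsum_mul_left, periodicSum, Complex.ofReal_tsum]
  rw [← h5, h4.unique h2] at h1
  have hV : ((L ^ d : ℝ) : ℂ) ≠ 0 := by exact_mod_cast (pow_pos hL d).ne'
  rw [Complex.ofReal_div, eq_div_iff hV, mul_comm, ← h1, Complex.real_smul]
  rfl

/-- Poisson summation at the origin. No decay of `g` or `G` is needed: the Fourier coefficients are
nonnegative, so their series converges absolutely and represents the periodisation almost
everywhere; lower semicontinuity and maximality at the origin give the value there. -/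
theorem hasSum_periodicSum_zero (h : IsJumpWeight g G) (hL : 0 < L)
    (hs : Summable fun z => g (latticeVec L z)) :
    HasSum (fun n => G (latticeVec L⁻¹ n) / L ^ d) (periodicSum g L 0) := by
  set c : (Fin d → ℤ) → ℝ := fun n => G (latticeVec L⁻¹ n) / L ^ d with hc
  have hc0 : ∀ n, 0 ≤ c n := fun n => div_nonneg (h.fourier_nonneg _) (by positivity)
  have hm := (h.measurable_periodicSum hs).comp (measurable_torusRep L)
  obtain ⟨hsum, hle⟩ := summable_of_mFourierCoeff_nonneg hm (fun u => h.periodicSum_nonneg _)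
    (fun u => h.periodicSum_le hs _) hc0 (h.mFourierCoeff_periodicSum hL hs)
  have hae := ae_eq_fourierSeries hm (fun u => h.periodicSum_nonneg _)
    (fun u => h.periodicSum_le hs _) hsum (h.mFourierCoeff_periodicSum hL hs)
  have hae2 : ∀ᵐ u : UnitAddTorus (Fin d), periodicSum g L (torusRep L u) ≤ ∑' n, c n := by
    filter_upwards [hae] with u hu
    have hn : ∀ n, ‖(c n : ℂ) * mFourier n u‖ ≤ c n := fun n => by
      rw [norm_mul, Complex.norm_real, Real.norm_eq_abs, abs_of_nonneg (hc0 n)]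
      exact mul_le_of_le_one_right (hc0 n)
        ((ContinuousMap.norm_coe_le_norm _ u).trans mFourier_norm.le)
    have h1 : ‖fourierSeries c u‖ ≤ ∑' n, c n := by
      have hs' := hsum.of_nonneg_of_le (fun n => norm_nonneg _) hn
      rw [← (hasSum_fourierSeries_apply hsum u).tsum_eq]
      exact (norm_tsum_le_tsum_norm hs').trans (hs'.tsum_le_tsum hn hsum)
    rw [← hu, Complex.norm_real] at h1
    exact (le_abs_self _).trans h1
  have hae3 : ∀ᵐ x ∂(volume.restrict (box d L)), periodicSum g L x ≤ ∑' n, c n := by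
    have h2 : ∀ᵐ u ∂((volume.restrict (box d L)).map (torusMap L)),
        periodicSum g L (torusRep L u) ≤ ∑' n, c n := by
      rw [map_torusMap hL]
      exact Measure.smul_absolutelyContinuous.ae_le hae2
    filter_upwards [ae_of_ae_map (measurable_torusMap L).aemeasurable h2] with x hx
    rwa [periodicSum_torusRep g hL.ne'] at hx
  have hopen : IsOpen (box d L) := by
    have : box d L = ⋂ j, (fun x : Space d => x j) ⁻¹' Set.Ioo 0 L := by ext x; simp [box]
    rw [this]
    exact isOpen_iInter_of_finite fun j => isOpen_Ioo.preimage (by fun_prop)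
  -- partial sums are continuous, so the almost everywhere bound holds up to the corner `0`
  have hF : ∀ F : Finset (Fin d → ℤ), ∑ z ∈ F, g (0 - latticeVec L z) ≤ ∑' n, c n := by
    intro F
    have hcont : Continuous fun x : Space d => ∑ z ∈ F, g (x - latticeVec L z) :=
      continuous_finsetSum _ fun z _ => h.continuous.comp (continuous_id.sub continuous_const)
    have hU : IsOpen (box d L ∩ {x | ∑' n, c n < ∑ z ∈ F, g (x - latticeVec L z)}) :=
      hopen.inter (isOpen_lt continuous_const hcont)
    have hU0 : volume (box d L ∩ {x | ∑' n, c n < ∑ z ∈ F, g (x - latticeVec L z)}) = 0 := by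
      rw [ae_restrict_iff' (measurableSet_box d L), ae_iff] at hae3
      refine measure_mono_null (fun x hx => ?_) hae3
      simp only [Set.mem_ofPred_eq, Classical.not_imp, not_le]
      refine ⟨hx.1, hx.2.trans_le ?_⟩
      exact (h.summable_and_tsum_le hs x).1.sum_le_tsum _ fun z _ => h.nonneg _
    have hU1 := hU.eq_empty_of_measure_zero hU0
    have hlim : Tendsto (fun t : ℝ => (WithLp.toLp 2 fun _ => t : Space d)) (𝓝[>] 0) (𝓝 0) := by
      have : Continuous fun t : ℝ => (WithLp.toLp 2 fun _ => t : Space d) := by fun_prop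
      exact (this.tendsto' 0 0 rfl).mono_left nhdsWithin_le_nhds
    refine le_of_tendsto ((hcont.tendsto 0).comp hlim) ?_
    filter_upwards [Ioo_mem_nhdsGT hL] with t ht
    by_contra hlt
    have : (WithLp.toLp 2 fun _ => t : Space d) ∈
        box d L ∩ {x | ∑' n, c n < ∑ z ∈ F, g (x - latticeVec L z)} :=
      ⟨fun j => ht, not_le.1 hlt⟩
    rw [hU1] at this
    exact this
  have heq : ∑' n, c n = periodicSum g L 0 :=
    le_antisymm hle ((h.summable_and_tsum_le hs 0).1.tsum_le_of_sum_le hF)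
  rw [← heq]
  exact hsum.hasSum

/-- The traces of the powers of the periodised kernel are the power sums of the Fourier transform
over the dual lattice. -/
theorem kernelTrace_box (h : IsJumpWeight g G) (hL : 0 < L)
    (hs : Summable fun z => g (latticeVec L z)) (j : ℕ) :
    Summable (fun n => G (latticeVec L⁻¹ n) ^ (j + 1)) ∧
    kernelTrace (volume.restrict (box d L))
      (kernelIter (volume.restrict (box d L))
        (fun x y => ENNReal.ofReal (periodicSum g L (x - y)))
        (fun x y => ENNReal.ofReal (periodicSum g L (x - y))) j) =
      ENNReal.ofReal (∑' n, G (latticeVec L⁻¹ n) ^ (j + 1)) := by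
  have hm := (h.measurable_periodicSum hs).comp (measurable_torusRep L)
  have h0 := h.hasSum_periodicSum_zero hL hs
  have hV : (0 : ℝ) < L ^ d := by positivity
  have e0 : periodicSum g L (torusRep L 0) = periodicSum g L 0 := by
    rw [← periodicSum_torusRep g hL.ne' 0, show torusMap L (0 : Space d) = 0 by
      funext j; simp [torusMap]]
  have h1 := kernelTrace_torus hm (fun u => h.periodicSum_nonneg _)
    (fun u => h.periodicSum_le hs _)
    (fun n => div_nonneg (h.fourier_nonneg _) hV.le) h0.summable
    (h.mFourierCoeff_periodicSum hL hs) (by rw [Function.comp, e0]; exact h0) hV.le j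
  have e1 : ∀ n : Fin d → ℤ, L ^ d * (G (latticeVec L⁻¹ n) / L ^ d) = G (latticeVec L⁻¹ n) :=
    fun n => mul_div_cancel₀ _ hV.ne'
  simp only [e1] at h1
  refine ⟨h1.1, ?_⟩
  rw [← h1.2]
  have : IsFiniteMeasure (ENNReal.ofReal (L ^ d) • (volume : Measure (UnitAddTorus (Fin d)))) :=
    Measure.smul_finite _ ENNReal.ofReal_ne_top
  have : IsFiniteMeasure ((volume.restrict (box d L)).map (torusMap L)) := by
    rw [map_torusMap hL]; infer_instance
  have hK : Measurable (Function.uncurry fun u v : UnitAddTorus (Fin d) =>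
      ENNReal.ofReal (periodicSum g L (torusRep L (u - v)))) :=
    (hm.comp measurable_sub).ennreal_ofReal
  have : IsFiniteMeasure (volume.restrict (box d L)) :=
    ⟨by rw [Measure.restrict_apply_univ, volume_box d hL.le]; exact ENNReal.ofReal_lt_top⟩
  have h2 := kernelTrace_map (μ := volume.restrict (box d L)) (measurable_torusMap L) hK j
  rw [map_torusMap hL] at h2
  simp only [← torusMap_sub, periodicSum_torusRep g hL.ne'] at h2
  exact h2

end IsJumpWeight

end BoxTrace

/-! ### The mode weights -/

section ModeWeight

open Real RealInnerProductSpace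

variable {d : ℕ} {g G : Space d → ℝ}

/-- The normalised Fourier transform `λ(k) = G(k) / G(0) = e^{-ε(k)}`. -/
noncomputable def modeWeight (G : Space d → ℝ) (k : Space d) : ℝ := G k / G 0

/-- The mean occupation number `λ / (1 - λ) = 1 / (e^ε - 1)` of a mode. At `k = 0`, where `λ = 1`,
division by zero gives the value `0`, which is the one wanted for a sum over excited modes. -/
noncomputable def occupation (G : Space d → ℝ) (k : Space d) : ℝ :=
  modeWeight G k / (1 - modeWeight G k)

namespace IsJumpWeight

theorem fourier_zero_eq (h : IsJumpWeight g G) : G 0 = ∫ x, g x := by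
  simpa using h.fourier_eq_integral_cos 0

theorem fourier_zero_sub (h : IsJumpWeight g G) (k : Space d) :
    G 0 - G k = ∫ x, (1 - Real.cos (2 * π * ⟪x, k⟫)) * g x := by
  rw [h.fourier_zero_eq, h.fourier_eq_integral_cos k,
    ← integral_sub h.integrable (integrable_cos_mul h.integrable k)]
  refine integral_congr_ae (ae_of_all _ fun x => ?_)
  simp only; ring

theorem integrable_one_sub_cos_mul (h : IsJumpWeight g G) (k : Space d) :
    Integrable fun x => (1 - Real.cos (2 * π * ⟪x, k⟫)) * g x := by
  refine (h.integrable.sub (integrable_cos_mul h.integrable k)).congr (ae_of_all _ fun x => ?_)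
  simp only [Pi.sub_apply]; ring

theorem one_sub_cos_mul_nonneg (h : IsJumpWeight g G) (k x : Space d) :
    0 ≤ (1 - Real.cos (2 * π * ⟪x, k⟫)) * g x :=
  mul_nonneg (sub_nonneg.2 (Real.cos_le_one _)) (h.nonneg x)

theorem fourier_zero_pos (h : IsJumpWeight g G) : 0 < G 0 := by
  rw [h.fourier_zero_eq]
  rw [integral_pos_iff_support_of_nonneg h.nonneg h.integrable]
  exact h.continuous.isOpen_support.measure_pos _ ⟨0, by simp [h.zero]⟩

theorem fourier_le (h : IsJumpWeight g G) (k : Space d) : G k ≤ G 0 := by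
  rw [← sub_nonneg, h.fourier_zero_sub]
  exact integral_nonneg (h.one_sub_cos_mul_nonneg k)

theorem fourier_lt (h : IsJumpWeight g G) {k : Space d} (hk : k ≠ 0) : G k < G 0 := by
  rw [← sub_pos, h.fourier_zero_sub, integral_pos_iff_support_of_nonneg
    (h.one_sub_cos_mul_nonneg k) (h.integrable_one_sub_cos_mul k)]
  have hc : Continuous fun x : Space d => (1 - Real.cos (2 * π * ⟪x, k⟫)) * g x := by
    have := h.continuous
    fun_prop
  refine hc.isOpen_support.measure_pos _ ?_
  have hg : ∀ᶠ t : ℝ in 𝓝[>] 0, 0 < g (t • k) := by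
    have : Tendsto (fun t : ℝ => g (t • k)) (𝓝 0) (𝓝 1) :=
      (h.continuous.comp (continuous_id.smul continuous_const)).tendsto' 0 1 (by simp [h.zero])
    exact (this.mono_left nhdsWithin_le_nhds).eventually_const_lt one_pos
  have hk2 : 0 < ‖k‖ ^ 2 := by positivity
  obtain ⟨t, ht, ht0, ht1⟩ := (hg.and (Ioo_mem_nhdsGT (inv_pos.2 hk2))).exists
  refine ⟨t • k, (mul_pos (sub_pos.2 ?_) ht).ne'⟩
  rw [real_inner_smul_left, real_inner_self_eq_norm_sq]
  have h1 : t * ‖k‖ ^ 2 < 1 := by rwa [lt_inv_comm₀ ht0 hk2, ← one_div, lt_div_iff₀ ht0, mul_comm] at ht1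
  refine lt_of_le_of_ne (Real.cos_le_one _) fun hcos => ?_
  have h2 := (Real.cos_eq_one_iff_of_lt_of_lt (by nlinarith [pi_pos, mul_pos ht0 hk2])
    (by nlinarith [pi_pos])).1 hcos
  have : 0 < 2 * π * (t * ‖k‖ ^ 2) := by positivity
  exact this.ne' h2

theorem tendsto_fourier (h : IsJumpWeight g G) : Tendsto G (cocompact _) (𝓝 0) := by
  have h1 := tendsto_integral_exp_inner_smul_cocompact (fun x => (g x : ℂ))
  have h2 := (Complex.continuous_re.tendsto _).comp h1
  refine h2.congr fun k => ?_
  have := h.fourier k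
  rw [Real.fourier_eq] at this
  simp only [Function.comp]
  rw [this, Complex.ofReal_re]

theorem modeWeight_nonneg (h : IsJumpWeight g G) (k : Space d) : 0 ≤ modeWeight G k :=
  div_nonneg (h.fourier_nonneg k) h.fourier_zero_pos.le

theorem modeWeight_zero (h : IsJumpWeight g G) : modeWeight G 0 = 1 :=
  div_self h.fourier_zero_pos.ne'

theorem modeWeight_le_one (h : IsJumpWeight g G) (k : Space d) : modeWeight G k ≤ 1 :=
  div_le_one_of_le₀ (h.fourier_le k) h.fourier_zero_pos.le

theorem modeWeight_lt_one (h : IsJumpWeight g G) {k : Space d} (hk : k ≠ 0) :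
    modeWeight G k < 1 := (div_lt_one h.fourier_zero_pos).2 (h.fourier_lt hk)

theorem continuous_modeWeight (h : IsJumpWeight g G) : Continuous (modeWeight G) :=
  h.continuous_fourier.div_const _

theorem integrable_modeWeight (h : IsJumpWeight g G) : Integrable (modeWeight G) :=
  h.integrable_fourier.div_const _

theorem integral_modeWeight (h : IsJumpWeight g G) : ∫ k, modeWeight G k = (G 0)⁻¹ := by
  simp only [modeWeight, integral_div, h.integral_fourier, one_div]

theorem one_sub_modeWeight (h : IsJumpWeight g G) (k : Space d) :
    1 - modeWeight G k = (∫ x, (1 - Real.cos (2 * π * ⟪x, k⟫)) * g x) / G 0 := by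
  rw [← h.fourier_zero_sub, sub_div, div_self h.fourier_zero_pos.ne', modeWeight]

/-- Away from the origin the mode weight is bounded away from `1`. -/
theorem exists_modeWeight_le (h : IsJumpWeight g G) {δ : ℝ} (hδ : 0 < δ) :
    ∃ c < 1, ∀ k, δ ≤ ‖k‖ → modeWeight G k ≤ c := by
  have h1 : ∀ᶠ k in cocompact (Space d), modeWeight G k < 1 / 2 := by
    have := h.tendsto_fourier.div_const (G 0)
    rw [zero_div] at this
    exact this.eventually_lt_const (by norm_num)
  obtain ⟨s, hs, hsub⟩ := mem_cocompact.1 h1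
  set K := s ∩ {k | δ ≤ ‖k‖} with hK
  have hKc : IsCompact K := hs.inter_right (isClosed_le continuous_const continuous_norm)
  have hout : ∀ k, k ∉ K → δ ≤ ‖k‖ → modeWeight G k ≤ 1 / 2 := by
    intro k hk hδk
    have : k ∉ s := fun h => hk ⟨h, hδk⟩
    exact (hsub this).le
  rcases K.eq_empty_or_nonempty with he | hne
  · exact ⟨1 / 2, by norm_num, fun k hk => hout k (by simp [he]) hk⟩
  · obtain ⟨k₀, hk₀, hmax⟩ := hKc.exists_isMaxOn hne h.continuous_modeWeight.continuousOn
    have h0 : k₀ ≠ 0 := by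
      rintro rfl
      have := hk₀.2
      simp at this
      linarith
    refine ⟨max (1 / 2) (modeWeight G k₀), max_lt (by norm_num) (h.modeWeight_lt_one h0),
      fun k hk => ?_⟩
    by_cases hkK : k ∈ K
    · exact (hmax hkK).trans (le_max_right _ _)
    · exact (hout k hkK hk).trans (le_max_left _ _)

theorem one_sub_cos_add_le (a b : ℝ) :
    1 - Real.cos (a + b) ≤ 2 * (1 - Real.cos a) + 2 * (1 - Real.cos b) := by
  rw [Real.cos_add]
  nlinarith [sq_nonneg (1 - Real.cos a - (1 - Real.cos b)), sq_nonneg (Real.sin a - Real.sin b),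
    sq_nonneg (Real.sin a + Real.sin b), Real.sin_sq_add_cos_sq a, Real.sin_sq_add_cos_sq b,
    Real.cos_le_one a, Real.cos_le_one b, Real.neg_one_le_cos a,
    mul_nonneg (sub_nonneg.2 (Real.cos_le_one a)) (sub_nonneg.2 (Real.cos_le_one b))]

/-- The gap `1 - λ` is an average of `1 - cos (2π k·x)`, and
`1 - cos (α + β) ≤ 2 (1 - cos α) + 2 (1 - cos β)`; it behaves like a squared seminorm. -/
theorem one_sub_modeWeight_add_le (h : IsJumpWeight g G) (k k' : Space d) :
    1 - modeWeight G (k + k') ≤ 2 * (1 - modeWeight G k) + 2 * (1 - modeWeight G k') := by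
  simp only [h.one_sub_modeWeight]
  rw [← mul_div_assoc, ← mul_div_assoc, ← add_div, ← integral_const_mul, ← integral_const_mul,
    ← integral_add ((h.integrable_one_sub_cos_mul _).const_mul _)
      ((h.integrable_one_sub_cos_mul _).const_mul _)]
  refine div_le_div_of_nonneg_right ?_ h.fourier_zero_pos.le
  refine integral_mono (h.integrable_one_sub_cos_mul _)
    (((h.integrable_one_sub_cos_mul _).const_mul _).add
      ((h.integrable_one_sub_cos_mul _).const_mul _)) fun x => ?_
  simp only
  rw [inner_add_right, mul_add, ← mul_assoc, ← mul_assoc, ← add_mul]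
  exact mul_le_mul_of_nonneg_right (one_sub_cos_add_le _ _) (h.nonneg x)

theorem one_sub_modeWeight_two_pow_smul_le (h : IsJumpWeight g G) (k : Space d) (p : ℕ) :
    1 - modeWeight G ((2 : ℝ) ^ p • k) ≤ 4 ^ p * (1 - modeWeight G k) := by
  induction p with
  | zero => simp
  | succ p ih =>
    have := h.one_sub_modeWeight_add_le ((2 : ℝ) ^ p • k) ((2 : ℝ) ^ p • k)
    rw [← add_smul, ← mul_two, ← pow_succ] at this
    rw [pow_succ (4 : ℝ)]
    linarith

end IsJumpWeight

end ModeWeight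

/-! ### Comparison of the gap on spheres of different radii -/

section GapComparison

open Real RealInnerProductSpace

variable {d : ℕ} {g G : Space d → ℝ}

namespace IsJumpWeight

theorem modeWeight_eq_of_norm_eq (h : IsJumpWeight g G) (hr : ∀ x y, ‖x‖ = ‖y‖ → g x = g y)
    {k k' : Space d} (hk : ‖k‖ = ‖k'‖) : modeWeight G k = modeWeight G k' := by
  have h1 := Real.fourier_comp_linearIsometry (Submodule.reflection (ℝ ∙ (k - k'))ᗮ)
    (fun x => (g x : ℂ)) k
  have e : (fun x => (g x : ℂ)) ∘ (Submodule.reflection (ℝ ∙ (k - k'))ᗮ) = fun x => (g x : ℂ) := by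
    funext x
    simp only [Function.comp]
    rw [hr _ x (LinearIsometryEquiv.norm_map _ x)]
  rw [e, Submodule.reflection_sub hk, h.fourier, h.fourier] at h1
  have h2 : G k = G k' := by exact_mod_cast h1
  rw [modeWeight, modeWeight, h2]

theorem exists_add_eq_of_norm_le (hd : 2 ≤ d) {k k' : Space d} (hk : ‖k'‖ ≤ 2 * ‖k‖) :
    ∃ u v : Space d, u + v = k' ∧ ‖u‖ = ‖k‖ ∧ ‖v‖ = ‖k‖ := by
  have h1 : 0 < Module.finrank ℝ ((ℝ ∙ k')ᗮ : Submodule ℝ (Space d)) := by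
    have h2 := Submodule.finrank_add_finrank_orthogonal (ℝ ∙ k' : Submodule ℝ (Space d))
    have h3 : Module.finrank ℝ (ℝ ∙ k' : Submodule ℝ (Space d)) ≤ 1 := by
      simpa using finrank_span_le_card (R := ℝ) ({k'} : Set (Space d))
    rw [finrank_euclideanSpace_fin] at h2
    omega
  have : Nontrivial ((ℝ ∙ k')ᗮ : Submodule ℝ (Space d)) := Module.nontrivial_of_finrank_pos h1
  have hnn : 0 ≤ ‖k‖ ^ 2 - (‖k'‖ / 2) ^ 2 := by
    have := norm_nonneg k'
    nlinarith [norm_nonneg k]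
  obtain ⟨w, hw⟩ := exists_norm_eq ((ℝ ∙ k')ᗮ : Submodule ℝ (Space d))
    (Real.sqrt_nonneg (‖k‖ ^ 2 - (‖k'‖ / 2) ^ 2))
  have hort : ⟪k', (w : Space d)⟫ = 0 :=
    Submodule.inner_right_of_mem_orthogonal (Submodule.mem_span_singleton_self k') w.2
  have hw' : ‖(w : Space d)‖ ^ 2 = ‖k‖ ^ 2 - (‖k'‖ / 2) ^ 2 := by
    rw [← Submodule.coe_norm, hw, Real.sq_sqrt hnn]
  have key : ∀ ε : ℝ, ε ^ 2 = 1 → ‖(1 / 2 : ℝ) • k' + ε • (w : Space d)‖ = ‖k‖ := by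
    intro ε hε
    have h4 : ‖(1 / 2 : ℝ) • k' + ε • (w : Space d)‖ ^ 2 = ‖k‖ ^ 2 := by
      rw [norm_add_sq_real, norm_smul, norm_smul, mul_pow, mul_pow, hw', Real.norm_eq_abs,
        Real.norm_eq_abs, sq_abs, sq_abs, hε, real_inner_smul_left, real_inner_smul_right, hort]
      ring
    exact (pow_left_inj₀ (norm_nonneg _) (norm_nonneg _) two_ne_zero).1 h4
  refine ⟨(1 / 2 : ℝ) • k' + (1 : ℝ) • (w : Space d), (1 / 2 : ℝ) • k' + (-1 : ℝ) • (w : Space d),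
    ?_, key 1 (by norm_num), key (-1) (by norm_num)⟩
  module

/-- In dimension at least two a vector of length at most `2 ‖k‖` is the sum of two vectors of
length `‖k‖`, which compares the gaps of a radial weight. -/
theorem one_sub_modeWeight_le_of_radial (h : IsJumpWeight g G) (hd : 2 ≤ d)
    (hr : ∀ x y, ‖x‖ = ‖y‖ → g x = g y) {k k' : Space d} (hk : ‖k'‖ ≤ 2 * ‖k‖) :
    1 - modeWeight G k' ≤ 4 * (1 - modeWeight G k) := by
  obtain ⟨u, v, huv, hu, hv⟩ := exists_add_eq_of_norm_le hd hk
  have := h.one_sub_modeWeight_add_le u v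
  rw [huv, h.modeWeight_eq_of_norm_eq hr hu, h.modeWeight_eq_of_norm_eq hr hv] at this
  linarith

theorem one_le_one_sub_cos_add (t : ℝ) :
    1 ≤ (1 - Real.cos (2 * π * t)) + (1 - Real.cos (2 * π * (t - 1 / 3))) := by
  have h1 := Real.cos_add_cos (2 * π * t) (2 * π * (t - 1 / 3))
  have e : (2 * π * t - 2 * π * (t - 1 / 3)) / 2 = π / 3 := by ring
  rw [e, Real.cos_pi_div_three] at h1
  have := Real.cos_le_one ((2 * π * t + 2 * π * (t - 1 / 3)) / 2)
  linarith

theorem norm_eq_abs_apply_zero (x : Space 1) : ‖x‖ = |x 0| := by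
  rw [EuclideanSpace.norm_eq]
  simp [Real.sqrt_sq_eq_abs]

/-- On the line, a weight with monotone tails has comparable gaps: outside the first half-period
of the wave `k` a shift by a third of the period increases the weight, and the two phases cannot
both be resonant. -/
theorem one_sub_modeWeight_le_of_monotone {g G : Space 1 → ℝ} (h : IsJumpWeight g G) {R : ℝ}
    (hR : 0 < R) (hmono : ∀ x y, R ≤ ‖x‖ → ‖x‖ ≤ ‖y‖ → g y ≤ g x) {k k' : Space 1}
    (hk : ‖k‖ ≤ (6 * R)⁻¹) (hkk : ‖k'‖ ≤ ‖k‖) :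
    1 - modeWeight G k' ≤ 7 * (1 - modeWeight G k) := by
  rcases eq_or_ne k 0 with rfl | hk0
  · have : k' = 0 := by simpa using hkk
    subst this
    simp [h.modeWeight_zero]
  have hkpos : 0 < ‖k‖ := norm_pos_iff.2 hk0
  set φ : Space 1 → ℝ := fun x => (1 - Real.cos (2 * π * ⟪x, k⟫)) * g x with hφ
  have hφi : Integrable φ := h.integrable_one_sub_cos_mul k
  have hφ0 : ∀ x, 0 ≤ φ x := h.one_sub_cos_mul_nonneg k
  set v : Space 1 := (3 * ‖k‖ ^ 2)⁻¹ • k with hv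
  have hvk : ⟪v, k⟫ = 1 / 3 := by
    rw [hv, real_inner_smul_left, real_inner_self_eq_norm_sq]
    field_simp
  have habs : ∀ x y : Space 1, |⟪x, y⟫| = ‖x‖ * ‖y‖ := by
    intro x y
    simp [PiLp.inner_apply, norm_eq_abs_apply_zero, abs_mul, mul_comm]
  -- the shifted comparison on the half line where `x` points along `k`
  have hshift : ∀ x, 1 / 2 < ⟪x, k⟫ → g x ≤ φ x + φ (x - v) := by
    intro x hx
    have h1 : ⟪x - v, k⟫ = ⟪x, k⟫ - 1 / 3 := by rw [inner_sub_left, hvk]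
    have h2 : ‖x - v‖ * ‖k‖ = ⟪x, k⟫ - 1 / 3 := by
      rw [← habs, h1, abs_of_pos (by linarith)]
    have h3 : ‖x‖ * ‖k‖ = ⟪x, k⟫ := by rw [← habs, abs_of_pos (by linarith)]
    have h4 : R ≤ ‖x - v‖ := by
      have h5 : ‖k‖ * (6 * R) ≤ 1 := by
        rwa [← le_div_iff₀ (by positivity), one_div]
      by_contra hlt
      have := mul_lt_mul_of_pos_right (not_le.1 hlt) hkpos
      nlinarith
    have h5 : ‖x - v‖ ≤ ‖x‖ := le_of_mul_le_mul_right (by linarith) hkpos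
    have h6 := hmono _ _ h4 h5
    have h7 := one_le_one_sub_cos_add ⟪x, k⟫
    have h8 : (1 - Real.cos (2 * π * ⟪x - v, k⟫)) * g x ≤ φ (x - v) :=
      mul_le_mul_of_nonneg_left h6 (sub_nonneg.2 (Real.cos_le_one _))
    rw [h1] at h8
    have h9 := mul_le_mul_of_nonneg_right h7 (h.nonneg x)
    simp only [hφ] at *
    linarith
  have hφneg : ∀ x, φ (-x) = φ x := by
    intro x
    simp only [hφ, inner_neg_left, mul_neg, Real.cos_neg, h.even]
  have hpt : ∀ x, (1 - Real.cos (2 * π * ⟪x, k'⟫)) * g x ≤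
      3 * φ x + 2 * φ (x - v) + 2 * φ (x + v) := by
    intro x
    have hle2 : (1 - Real.cos (2 * π * ⟪x, k'⟫)) * g x ≤ 2 * g x :=
      mul_le_mul_of_nonneg_right (by linarith [Real.neg_one_le_cos (2 * π * ⟪x, k'⟫)]) (h.nonneg x)
    rcases lt_or_ge (1 / 2) ⟪x, k⟫ with h1 | h1
    · linarith [hshift x h1, hφ0 (x + v), hφ0 x]
    · rcases lt_or_ge ⟪x, k⟫ (-(1 / 2)) with h2 | h2
      · have h3 := hshift (-x) (by rw [inner_neg_left]; linarith)
        rw [h.even, hφneg, show -x - v = -(x + v) by abel, hφneg] at h3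
        linarith [hφ0 (x - v), hφ0 x]
      · have h3 : |⟪x, k'⟫| ≤ |⟪x, k⟫| := by
          rw [habs, habs]; exact mul_le_mul_of_nonneg_left hkk (norm_nonneg _)
        have h4 : |⟪x, k⟫| ≤ 1 / 2 := abs_le.2 ⟨by linarith, h1⟩
        have h5 : Real.cos (2 * π * ⟪x, k⟫) ≤ Real.cos (2 * π * ⟪x, k'⟫) := by
          rw [← Real.cos_abs (2 * π * ⟪x, k⟫), ← Real.cos_abs (2 * π * ⟪x, k'⟫),
            abs_mul _ ⟪x, k⟫, abs_mul _ ⟪x, k'⟫, abs_of_pos (by positivity : 0 < 2 * π)]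
          refine Real.cos_le_cos_of_nonneg_of_le_pi (by positivity) ?_ (by gcongr)
          nlinarith [pi_pos]
        have h6 : (1 - Real.cos (2 * π * ⟪x, k'⟫)) * g x ≤ φ x :=
          mul_le_mul_of_nonneg_right (by linarith) (h.nonneg x)
        linarith [hφ0 (x - v), hφ0 (x + v), hφ0 x]
  have hi1 := (hφi.comp_sub_right v).const_mul 2
  have hi2 := (hφi.comp_add_right v).const_mul 2
  have hint := integral_mono (h.integrable_one_sub_cos_mul k')
    (((hφi.const_mul 3).add hi1).add hi2) hpt
  have hsum : ∫ x, (3 * φ x + 2 * φ (x - v) + 2 * φ (x + v)) = 7 * ∫ x, φ x := by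
    have hi3 : Integrable fun x => 3 * φ x + 2 * φ (x - v) := (hφi.const_mul 3).add hi1
    rw [integral_add hi3 hi2, integral_add (hφi.const_mul 3) hi1,
      integral_const_mul, integral_const_mul, integral_const_mul, integral_sub_right_eq_self φ v,
      integral_add_right_eq_self φ v]
    ring
  rw [h.one_sub_modeWeight, h.one_sub_modeWeight, ← mul_div_assoc]
  refine div_le_div_of_nonneg_right ?_ h.fourier_zero_pos.le
  rw [← hsum]
  exact hint

/-- Near the origin the gap `1 - λ` at `k` controls the gap at all shorter vectors. In dimension
one this uses the monotonicity of the tails. -/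
theorem exists_gap_comparison (h : IsJumpWeight g G) (hd : 1 ≤ d)
    (hr : ∀ x y, ‖x‖ = ‖y‖ → g x = g y)
    (hone : d = 1 → ∃ R : ℝ, ∀ x y, R ≤ ‖x‖ → ‖x‖ ≤ ‖y‖ → g y ≤ g x) :
    ∃ δ > 0, ∃ A > 0, ∀ k k' : Space d, ‖k‖ ≤ δ → ‖k'‖ ≤ ‖k‖ →
      1 - modeWeight G k' ≤ A * (1 - modeWeight G k) := by
  rcases hd.eq_or_lt with rfl | hd2
  · obtain ⟨R, hR⟩ := hone rfl
    have hR' : 0 < max R 1 := lt_max_of_lt_right one_pos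
    refine ⟨(6 * max R 1)⁻¹, by positivity, 7, by norm_num, fun k k' hk hkk => ?_⟩
    exact h.one_sub_modeWeight_le_of_monotone hR'
      (fun x y hx => hR x y ((le_max_left _ _).trans hx)) hk hkk
  · exact ⟨1, one_pos, 4, by norm_num, fun k k' _ hkk =>
      h.one_sub_modeWeight_le_of_radial hd2 hr (hkk.trans (by linarith [norm_nonneg k]))⟩

end IsJumpWeight

end GapComparison

/-! ### Riemann sums over the dual lattice -/

section RiemannSum

/-- Dominated convergence with a convergent family of dominating functions. -/
theorem tendsto_lintegral_of_le_add {X α : Type*} [MeasurableSpace X] {μ : Measure X}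
    {l : Filter α} [l.NeBot] [l.IsCountablyGenerated] {f u : α → X → ℝ≥0∞} {f' u' H : X → ℝ≥0∞}
    (hf : ∀ a, Measurable (f a)) (hu : ∀ a, Measurable (u a)) (hu' : Measurable u')
    (hH : Measurable H) (hle : ∀ᶠ a in l, ∀ᵐ x ∂μ, f a x ≤ H x + u a x)
    (hft : ∀ᵐ x ∂μ, Tendsto (fun a => f a x) l (𝓝 (f' x)))
    (hut : ∀ᵐ x ∂μ, Tendsto (fun a => u a x) l (𝓝 (u' x)))
    (hHi : ∫⁻ x, H x ∂μ ≠ ∞) (hui : ∫⁻ x, u' x ∂μ ≠ ∞)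
    (hI : Tendsto (fun a => ∫⁻ x, u a x ∂μ) l (𝓝 (∫⁻ x, u' x ∂μ))) :
    Tendsto (fun a => ∫⁻ x, f a x ∂μ) l (𝓝 (∫⁻ x, f' x ∂μ)) := by
  -- the positive parts of `u a - u'` tend to zero in mean
  have h1 : Tendsto (fun a => ∫⁻ x, min (u a x) (u' x) ∂μ) l (𝓝 (∫⁻ x, u' x ∂μ)) := by
    refine tendsto_lintegral_filter_of_dominated_convergence u'
      (Eventually.of_forall fun a => (hu a).min hu')
      (Eventually.of_forall fun a => ae_of_all _ fun x => min_le_right _ _) hui ?_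
    filter_upwards [hut] with x hx
    simpa using hx.min (tendsto_const_nhds (x := u' x))
  have h2 : ∀ a, ∫⁻ x, u a x ∂μ =
      ∫⁻ x, (u a x - u' x) ∂μ + ∫⁻ x, min (u a x) (u' x) ∂μ := by
    intro a
    rw [← lintegral_add_left (f := fun x => u a x - u' x) ((hu a).sub hu')]
    exact lintegral_congr fun x => tsub_add_min.symm
  have hmin : ∀ a, ∫⁻ x, min (u a x) (u' x) ∂μ ≠ ∞ := fun a =>
    ((lintegral_mono fun x => min_le_right _ _).trans_lt hui.lt_top).ne
  have h3 : Tendsto (fun a => ∫⁻ x, (u a x - u' x) ∂μ) l (𝓝 0) := by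
    have h4 := ENNReal.Tendsto.sub hI h1 (Or.inl hui)
    rw [tsub_self] at h4
    refine h4.congr fun a => ?_
    rw [h2 a, ENNReal.add_sub_cancel_right (hmin a)]
  have hHu : ∫⁻ x, (H x + u' x) ∂μ ≠ ∞ := by
    rw [lintegral_add_left hH]
    exact ENNReal.add_ne_top.2 ⟨hHi, hui⟩
  have hf'le : ∀ᵐ x ∂μ, f' x ≤ H x + u' x := by
    obtain ⟨s, hs⟩ := l.exists_seq_tendsto
    have : ∀ᵐ x ∂μ, ∀ᶠ n in atTop, f (s n) x ≤ H x + u (s n) x := by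
      obtain ⟨n₀, hn₀⟩ := eventually_atTop.1 (hs.eventually hle)
      have h5 : ∀ᵐ x ∂μ, ∀ n, f (s (n₀ + n)) x ≤ H x + u (s (n₀ + n)) x :=
        ae_all_iff.2 fun n => hn₀ _ (Nat.le_add_right _ _)
      filter_upwards [h5] with x hx
      filter_upwards [eventually_ge_atTop n₀] with n hn
      have := hx (n - n₀)
      rwa [Nat.add_sub_cancel' hn] at this
    filter_upwards [this, hft, hut] with x h6 h7 h8
    exact le_of_tendsto_of_tendsto (h7.comp hs) ((h8.comp hs).const_add _) h6
  have h5 : Tendsto (fun a => ∫⁻ x, min (f a x) (H x + u' x) ∂μ) l (𝓝 (∫⁻ x, f' x ∂μ)) := by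
    refine tendsto_lintegral_filter_of_dominated_convergence (fun x => H x + u' x)
      (Eventually.of_forall fun a => (hf a).min (hH.add hu'))
      (Eventually.of_forall fun a => ae_of_all _ fun x => min_le_right _ _) hHu ?_
    filter_upwards [hft, hf'le] with x hx hx'
    simpa [min_eq_left hx'] using hx.min (tendsto_const_nhds (x := H x + u' x))
  have h6 : ∀ a, ∫⁻ x, f a x ∂μ =
      ∫⁻ x, (f a x - (H x + u' x)) ∂μ + ∫⁻ x, min (f a x) (H x + u' x) ∂μ := by
    intro a
    rw [← lintegral_add_left (f := fun x => f a x - (H x + u' x)) ((hf a).sub (hH.add hu'))]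
    exact lintegral_congr fun x => tsub_add_min.symm
  have h7 : Tendsto (fun a => ∫⁻ x, (f a x - (H x + u' x)) ∂μ) l (𝓝 0) := by
    refine tendsto_of_tendsto_of_tendsto_of_le_of_le' tendsto_const_nhds h3
      (Eventually.of_forall fun a => zero_le) ?_
    filter_upwards [hle] with a ha
    refine lintegral_mono_ae ?_
    filter_upwards [ha] with x hx
    rw [tsub_le_iff_right]
    refine hx.trans ?_
    rw [add_left_comm]
    gcongr
    exact le_tsub_add
  simp only [h6]
  simpa using h7.add h5

variable {d : ℕ} {g G : Space d → ℝ}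

/-- The point of the dual lattice `L⁻¹ ℤ^d` at the lower corner of the cell of `k`. -/
noncomputable def gridPoint (L : ℝ) (k : Space d) : Space d :=
  latticeVec L⁻¹ (cellIndex L⁻¹ k)

theorem lintegral_dual_cellIndex {L : ℝ} (hL : 0 < L) (F : (Fin d → ℤ) → ℝ≥0∞) :
    ∫⁻ k : Space d, F (cellIndex L⁻¹ k) = (ENNReal.ofReal (L ^ d))⁻¹ * ∑' n, F n := by
  rw [lintegral_cellIndex (inv_pos.2 hL), inv_pow, ENNReal.ofReal_inv_of_pos (by positivity)]

theorem norm_sub_gridPoint_le {L : ℝ} (hL : 0 < L) (k : Space d) :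
    ‖k - gridPoint L k‖ ≤ √d * L⁻¹ := by
  rw [EuclideanSpace.norm_eq, Real.sqrt_le_left (by positivity), mul_pow, Real.sq_sqrt (by positivity)]
  have : ∀ j ∈ Finset.univ, ‖(k - gridPoint L k) j‖ ^ 2 ≤ L⁻¹ ^ 2 := by
    intro j _
    have e : (k - gridPoint L k) j = L⁻¹ * Int.fract (k j / L⁻¹) := by
      simp only [PiLp.sub_apply, gridPoint, latticeVec, cellIndex, Int.fract]
      field_simp
    rw [e, Real.norm_eq_abs, abs_of_nonneg (mul_nonneg (inv_pos.2 hL).le (Int.fract_nonneg _))]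
    have := Int.fract_lt_one (k j / L⁻¹)
    have := Int.fract_nonneg (k j / L⁻¹)
    have := inv_pos.2 hL
    gcongr
    nlinarith
  exact (Finset.sum_le_sum this).trans (by simp)

theorem tendsto_gridPoint (k : Space d) :
    Tendsto (fun L => gridPoint L k) atTop (𝓝 k) := by
  rw [tendsto_iff_norm_sub_tendsto_zero]
  have h1 : Tendsto (fun L : ℝ => √d * L⁻¹) atTop (𝓝 0) := by
    simpa using tendsto_inv_atTop_zero.const_mul (√d)
  refine squeeze_zero' (Eventually.of_forall fun L => norm_nonneg _) ?_ h1
  filter_upwards [eventually_gt_atTop 0] with L hL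
  rw [norm_sub_rev]
  exact norm_sub_gridPoint_le hL k

theorem inv_le_norm_latticeVec {L : ℝ} (hL : 0 < L) {n : Fin d → ℤ} (hn : n ≠ 0) :
    L⁻¹ ≤ ‖(latticeVec L⁻¹ n : Space d)‖ := by
  obtain ⟨j, hj⟩ := Function.ne_iff.1 hn
  refine le_trans ?_ (PiLp.norm_apply_le (latticeVec L⁻¹ n : Space d) j)
  simp only [latticeVec, Real.norm_eq_abs, abs_mul, abs_of_pos (inv_pos.2 hL)]
  have h1 : (1 : ℝ) ≤ |(n j : ℝ)| := by exact_mod_cast Int.one_le_abs hj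
  exact le_mul_of_one_le_right (inv_pos.2 hL).le h1

theorem latticeVec_ne_zero {L : ℝ} (hL : 0 < L) {n : Fin d → ℤ} (hn : n ≠ 0) :
    (latticeVec L⁻¹ n : Space d) ≠ 0 := by
  have := inv_le_norm_latticeVec hL hn
  have := inv_pos.2 hL
  exact norm_pos_iff.1 (by linarith)

theorem latticeVec_zero (L : ℝ) : (latticeVec L 0 : Space d) = 0 := by
  ext j; simp [latticeVec]

/-- Apart from the cell at the origin, a point is comparable to its grid point. -/
theorem norm_le_mul_norm_gridPoint {L : ℝ} (hL : 0 < L) {k : Space d}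
    (hk : cellIndex L⁻¹ k ≠ 0) : ‖k‖ ≤ (1 + √d) * ‖gridPoint L k‖ := by
  have h1 := norm_sub_gridPoint_le hL k
  have h2 : L⁻¹ ≤ ‖gridPoint L k‖ := inv_le_norm_latticeVec hL hk
  have h3 : ‖k‖ ≤ ‖k - gridPoint L k‖ + ‖gridPoint L k‖ := by
    simpa using norm_add_le (k - gridPoint L k) (gridPoint L k)
  nlinarith [Real.sqrt_nonneg (d : ℝ)]

theorem eventually_cellIndex_ne_zero {k : Space d} (hk : k ≠ 0) :
    ∀ᶠ L : ℝ in atTop, cellIndex L⁻¹ k ≠ 0 := by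
  filter_upwards [(tendsto_gridPoint k).eventually_ne hk] with L hL h0
  exact hL (by rw [gridPoint, h0, latticeVec_zero])

namespace IsJumpWeight

theorem tendsto_lintegral_modeWeight_gridPoint (h : IsJumpWeight g G)
    (hs : ∀ᶠ L in atTop, Summable fun z => g (latticeVec L z))
    (hP : Tendsto (fun L => ∑' z, g (latticeVec L z)) atTop (𝓝 1)) :
    Tendsto (fun L => ∫⁻ k, ENNReal.ofReal (modeWeight G (gridPoint L k))) atTop
      (𝓝 (∫⁻ k, ENNReal.ofReal (modeWeight G k))) := by
  rw [← ofReal_integral_eq_lintegral_ofReal h.integrable_modeWeight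
    (ae_of_all _ h.modeWeight_nonneg), h.integral_modeWeight]
  have h1 : Tendsto (fun L => ENNReal.ofReal ((∑' z, g (latticeVec L z)) / G 0)) atTop
      (𝓝 (ENNReal.ofReal (G 0)⁻¹)) := by
    rw [← one_div]
    exact ENNReal.tendsto_ofReal (hP.div_const _)
  refine h1.congr' ?_
  filter_upwards [hs, eventually_gt_atTop 0] with L hL hL0
  have h2 := h.hasSum_periodicSum_zero hL0 hL
  rw [h.periodicSum_zero] at h2
  have hV : (0 : ℝ) < L ^ d := by positivity
  unfold gridPoint
  rw [lintegral_dual_cellIndex hL0 fun n => ENNReal.ofReal (modeWeight G (latticeVec L⁻¹ n)),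
    ← ENNReal.tsum_mul_left, ← (h2.div_const (G 0)).tsum_eq, ENNReal.ofReal_tsum_of_nonneg
      (fun n => div_nonneg (div_nonneg (h.fourier_nonneg _) hV.le) h.fourier_zero_pos.le)
      (h2.div_const _).summable]
  refine tsum_congr fun n => ?_
  rw [← ENNReal.ofReal_inv_of_pos hV, ← ENNReal.ofReal_mul (inv_pos.2 hV).le, modeWeight]
  congr 1
  ring

theorem measurable_ofReal_modeWeight_gridPoint (G : Space d → ℝ) (L : ℝ) :
    Measurable fun k : Space d => ENNReal.ofReal (modeWeight G (gridPoint L k)) :=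
  (Measurable.of_discrete (f := fun n : Fin d → ℤ =>
    ENNReal.ofReal (modeWeight G (latticeVec L⁻¹ n)))).comp (measurable_cellIndex L⁻¹)

/-- Riemann sums of functions dominated by the mode weight. -/
theorem tendsto_tsum_of_le_modeWeight (h : IsJumpWeight g G)
    (hs : ∀ᶠ L in atTop, Summable fun z => g (latticeVec L z))
    (hP : Tendsto (fun L => ∑' z, g (latticeVec L z)) atTop (𝓝 1)) {Φ : Space d → ℝ≥0∞}
    (hΦ : Continuous Φ) (hle : ∀ k, Φ k ≤ ENNReal.ofReal (modeWeight G k)) :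
    Tendsto (fun L : ℝ => (ENNReal.ofReal (L ^ d))⁻¹ * ∑' n, Φ (latticeVec L⁻¹ n)) atTop
      (𝓝 (∫⁻ k, Φ k)) := by
  have hmeas : ∀ L : ℝ, Measurable fun k : Space d => Φ (gridPoint L k) := fun L =>
    (Measurable.of_discrete (f := fun n : Fin d → ℤ => Φ (latticeVec L⁻¹ n))).comp
      (measurable_cellIndex L⁻¹)
  have hcont : Continuous fun k => ENNReal.ofReal (modeWeight G k) :=
    ENNReal.continuous_ofReal.comp h.continuous_modeWeight
  have key := tendsto_lintegral_of_le_add (μ := (volume : Measure (Space d))) (l := atTop)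
    (f := fun L k => Φ (gridPoint L k)) (f' := Φ)
    (u := fun L k => ENNReal.ofReal (modeWeight G (gridPoint L k)))
    (u' := fun k => ENNReal.ofReal (modeWeight G k)) (H := fun _ => 0) hmeas
    (measurable_ofReal_modeWeight_gridPoint G) hcont.measurable measurable_const
    (Eventually.of_forall fun L => ae_of_all _ fun k => by rw [zero_add]; exact hle _)
    (ae_of_all _ fun k => (hΦ.tendsto k).comp (tendsto_gridPoint k))
    (ae_of_all _ fun k => (hcont.tendsto k).comp (tendsto_gridPoint k)) (by simp)
    (by
      rw [← ofReal_integral_eq_lintegral_ofReal h.integrable_modeWeight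
        (ae_of_all _ h.modeWeight_nonneg)]
      exact ENNReal.ofReal_ne_top)
    (h.tendsto_lintegral_modeWeight_gridPoint hs hP)
  refine key.congr' ?_
  filter_upwards [eventually_gt_atTop 0] with L hL
  exact lintegral_dual_cellIndex hL fun n => Φ (latticeVec L⁻¹ n)

theorem occupation_nonneg (h : IsJumpWeight g G) (k : Space d) : 0 ≤ occupation G k :=
  div_nonneg (h.modeWeight_nonneg k) (sub_nonneg.2 (h.modeWeight_le_one k))

theorem inv_one_sub_modeWeight (h : IsJumpWeight g G) {k : Space d} (hk : k ≠ 0) :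
    (1 - modeWeight G k)⁻¹ = 1 + occupation G k := by
  have := sub_pos.2 (h.modeWeight_lt_one hk)
  rw [occupation]
  field_simp
  ring

theorem measurable_occupation (h : IsJumpWeight g G) : Measurable (occupation G) :=
  h.continuous_modeWeight.measurable.div (measurable_const.sub h.continuous_modeWeight.measurable)

/-- Riemann sums, without the mode at the origin, of functions dominated by the occupation
number, when the latter is integrable. Away from the origin `λ` itself dominates, with convergent
Riemann sums; near the origin `1 / (1 - λ)` at a grid point is bounded by a multiple of its value at
the points of the cell, because of the comparison of gaps. -/
theorem tendsto_tsum_of_le_occupation (h : IsJumpWeight g G) (hd : 1 ≤ d)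
    (hs : ∀ᶠ L in atTop, Summable fun z => g (latticeVec L z))
    (hP : Tendsto (fun L => ∑' z, g (latticeVec L z)) atTop (𝓝 1))
    (hgap : ∃ δ > 0, ∃ A > 0, ∀ k k' : Space d, ‖k‖ ≤ δ → ‖k'‖ ≤ ‖k‖ →
      1 - modeWeight G k' ≤ A * (1 - modeWeight G k))
    (hocc : ∫⁻ k, ENNReal.ofReal (occupation G k) ≠ ∞)
    {Φ : ℝ → Space d → ℝ≥0∞} {Φ' : Space d → ℝ≥0∞}
    (hle : ∀ᶠ L in atTop, ∀ k, Φ L k ≤ ENNReal.ofReal (occupation G k))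
    (hlim : ∀ k, k ≠ 0 → Tendsto (fun L => Φ L (gridPoint L k)) atTop (𝓝 (Φ' k))) :
    Tendsto (fun L : ℝ => (ENNReal.ofReal (L ^ d))⁻¹ *
      ∑' n, if n = 0 then 0 else Φ L (latticeVec L⁻¹ n)) atTop (𝓝 (∫⁻ k, Φ' k)) := by
  have : Nonempty (Fin d) := ⟨⟨0, hd⟩⟩
  have hae : ∀ᵐ k : Space d, k ≠ 0 := by simp [ae_iff]
  obtain ⟨δ, hδ, A, hA, hcomp⟩ := hgap
  obtain ⟨c, hc1, hc⟩ := h.exists_modeWeight_le hδ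
  obtain ⟨p, hp⟩ := pow_unbounded_of_one_lt (1 + √d) (by norm_num : (1 : ℝ) < 2)
  have hcont : Continuous fun k => ENNReal.ofReal (modeWeight G k) :=
    ENNReal.continuous_ofReal.comp h.continuous_modeWeight
  set B : ℝ := 4 ^ p * A with hB
  have hBpos : 0 < B := by positivity
  set H : Space d → ℝ≥0∞ := (Metric.closedBall 0 (2 ^ p * δ)).indicator
    fun k => ENNReal.ofReal B * (1 + ENNReal.ofReal (occupation G k)) with hH
  have hHm : Measurable H :=
    ((measurable_const.add h.measurable_occupation.ennreal_ofReal).const_mul _).indicator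
      measurableSet_closedBall
  have hHi : ∫⁻ k, H k ≠ ∞ := by
    rw [hH, lintegral_indicator measurableSet_closedBall,
      lintegral_const_mul' _ _ ENNReal.ofReal_ne_top, lintegral_add_left measurable_const]
    refine ENNReal.mul_ne_top ENNReal.ofReal_ne_top (ENNReal.add_ne_top.2 ⟨?_, ?_⟩)
    · simpa using measure_closedBall_lt_top.ne
    · exact ((setLIntegral_le_lintegral _ _).trans_lt hocc.lt_top).ne
  have hf : ∀ L : ℝ, Measurable fun k : Space d =>
      if cellIndex L⁻¹ k = 0 then 0 else Φ L (gridPoint L k) := fun L =>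
    (Measurable.of_discrete (f := fun n : Fin d → ℤ =>
      if n = 0 then 0 else Φ L (latticeVec L⁻¹ n))).comp (measurable_cellIndex L⁻¹)
  have hc' : 0 < 1 - c := by linarith
  have hbound : ∀ᶠ L in atTop, ∀ᵐ k : Space d,
      (if cellIndex L⁻¹ k = 0 then 0 else Φ L (gridPoint L k)) ≤
        H k + ENNReal.ofReal (1 - c)⁻¹ * ENNReal.ofReal (modeWeight G (gridPoint L k)) := by
    filter_upwards [hle, eventually_gt_atTop 0] with L hL hL0
    filter_upwards [hae] with k hk
    split_ifs with h0
    · exact zero_le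
    have hp0 : gridPoint L k ≠ 0 := latticeVec_ne_zero hL0 h0
    have hlt := sub_pos.2 (h.modeWeight_lt_one hp0)
    refine (hL _).trans ?_
    rcases le_or_gt ‖gridPoint L k‖ δ with hn | hn
    · refine le_trans ?_ le_self_add
      have hk1 : ‖k‖ ≤ 2 ^ p * ‖gridPoint L k‖ :=
        (norm_le_mul_norm_gridPoint hL0 h0).trans (by gcongr)
      have hmem : k ∈ Metric.closedBall (0 : Space d) (2 ^ p * δ) := by
        rw [mem_closedBall_zero_iff]
        exact hk1.trans (by gcongr)
      rw [hH, Set.indicator_of_mem hmem, ← ENNReal.ofReal_one,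
        ← ENNReal.ofReal_add zero_le_one (h.occupation_nonneg k), ← ENNReal.ofReal_mul hBpos.le]
      refine ENNReal.ofReal_le_ofReal ?_
      rw [← h.inv_one_sub_modeWeight hk]
      have hkk : ‖((2 : ℝ) ^ p)⁻¹ • k‖ ≤ ‖gridPoint L k‖ := by
        rw [norm_smul, norm_inv, norm_pow, Real.norm_two, inv_mul_le_iff₀ (by positivity)]
        exact hk1
      have h2 := h.one_sub_modeWeight_two_pow_smul_le (((2 : ℝ) ^ p)⁻¹ • k) p
      rw [smul_inv_smul₀ (by positivity)] at h2
      have h3 := hcomp _ _ hn hkk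
      have h4 : 1 - modeWeight G k ≤ B * (1 - modeWeight G (gridPoint L k)) := by
        rw [hB, mul_assoc]
        exact h2.trans (by gcongr)
      have hlt' := sub_pos.2 (h.modeWeight_lt_one hk)
      rw [occupation, ← div_eq_mul_inv, div_le_div_iff₀ hlt hlt']
      have h5 := h.modeWeight_le_one (gridPoint L k)
      nlinarith
    · refine le_trans ?_ le_add_self
      rw [← ENNReal.ofReal_mul (inv_pos.2 hc').le]
      refine ENNReal.ofReal_le_ofReal ?_
      rw [occupation, div_eq_inv_mul]
      refine mul_le_mul_of_nonneg_right ?_ (h.modeWeight_nonneg _)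
      exact inv_anti₀ hc' (by linarith [hc _ hn.le])
  have key := tendsto_lintegral_of_le_add (μ := (volume : Measure (Space d))) (l := atTop)
    (f := fun L k => if cellIndex L⁻¹ k = 0 then 0 else Φ L (gridPoint L k)) (f' := Φ')
    (u := fun L k => ENNReal.ofReal (1 - c)⁻¹ * ENNReal.ofReal (modeWeight G (gridPoint L k)))
    (u' := fun k => ENNReal.ofReal (1 - c)⁻¹ * ENNReal.ofReal (modeWeight G k)) (H := H) hf
    (fun L => (measurable_ofReal_modeWeight_gridPoint G L).const_mul _)
    (hcont.measurable.const_mul _) hHm hbound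
    (by
      filter_upwards [hae] with k hk
      refine (hlim k hk).congr' ?_
      filter_upwards [eventually_cellIndex_ne_zero hk] with L hL
      rw [if_neg hL])
    (ae_of_all _ fun k => ENNReal.Tendsto.const_mul ((hcont.tendsto k).comp (tendsto_gridPoint k))
      (Or.inr ENNReal.ofReal_ne_top)) hHi
    (by
      rw [lintegral_const_mul _ hcont.measurable, ← ofReal_integral_eq_lintegral_ofReal
        h.integrable_modeWeight (ae_of_all _ h.modeWeight_nonneg)]
      exact ENNReal.mul_ne_top ENNReal.ofReal_ne_top ENNReal.ofReal_ne_top)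
    (by
      simp only [lintegral_const_mul _ hcont.measurable,
        lintegral_const_mul _ (measurable_ofReal_modeWeight_gridPoint G _)]
      exact ENNReal.Tendsto.const_mul (h.tendsto_lintegral_modeWeight_gridPoint hs hP)
        (Or.inr ENNReal.ofReal_ne_top))
  refine key.congr' ?_
  filter_upwards [eventually_gt_atTop 0] with L hL
  exact lintegral_dual_cellIndex hL fun n => if n = 0 then 0 else Φ L (latticeVec L⁻¹ n)

end IsJumpWeight

end RiemannSum

/-! ### Power sums of the mode weights -/

section PowerSum

variable {d : ℕ} {g G : Space d → ℝ}

/-- The power sum `∑ λ(k)^j` over the dual lattice `k ∈ L⁻¹ ℤ^d`. -/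
noncomputable def modePowerSum (G : Space d → ℝ) (L : ℝ) (j : ℕ) : ℝ :=
  ∑' n : Fin d → ℤ, modeWeight G (latticeVec L⁻¹ n) ^ j

/-- The sum over the nonzero modes `k ∈ L⁻¹ ℤ^d`, `k ≠ 0`. -/
noncomputable def excitedSum (L : ℝ) (Φ : Space d → ℝ) : ℝ≥0∞ :=
  ∑' n : Fin d → ℤ, if n = 0 then 0 else ENNReal.ofReal (Φ (latticeVec L⁻¹ n))

namespace IsJumpWeight

theorem continuous_ofReal_modeWeight_pow (h : IsJumpWeight g G) (j : ℕ) :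
    Continuous fun k => ENNReal.ofReal (modeWeight G k ^ j) :=
  ENNReal.continuous_ofReal.comp (h.continuous_modeWeight.pow j)

theorem hasSum_modePowerSum (h : IsJumpWeight g G) {L : ℝ} (hL : 0 < L)
    (hs : Summable fun z => g (latticeVec L z)) (j : ℕ) :
    HasSum (fun n => modeWeight G (latticeVec L⁻¹ n) ^ (j + 1)) (modePowerSum G L (j + 1)) := by
  refine Summable.hasSum ?_
  simp only [modeWeight, div_pow]
  exact (h.kernelTrace_box hL hs j).1.div_const _

theorem one_le_modePowerSum (h : IsJumpWeight g G) {L : ℝ} (hL : 0 < L)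
    (hs : Summable fun z => g (latticeVec L z)) (j : ℕ) : 1 ≤ modePowerSum G L (j + 1) := by
  have h1 := (h.hasSum_modePowerSum hL hs j).summable.le_tsum 0
    fun n _ => pow_nonneg (h.modeWeight_nonneg _) _
  rwa [latticeVec_zero, h.modeWeight_zero, one_pow] at h1

theorem modePowerSum_le (h : IsJumpWeight g G) {L : ℝ} (hL : 0 < L)
    (hs : Summable fun z => g (latticeVec L z)) (j : ℕ) :
    modePowerSum G L (j + 1) ≤ modePowerSum G L 1 :=
  hasSum_le (fun _ => pow_le_pow_of_le_one (h.modeWeight_nonneg _) (h.modeWeight_le_one _)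
    (Nat.le_add_left 1 j)) (h.hasSum_modePowerSum hL hs j) (h.hasSum_modePowerSum hL hs 0)

theorem logConcave_homog_modePowerSum (h : IsJumpWeight g G) {L : ℝ} (hL : 0 < L)
    (hs : Summable fun z => g (latticeVec L z)) : LogConcave (homog (modePowerSum G L)) :=
  logConcave_homog_of_hasSum (fun n => h.modeWeight_nonneg (latticeVec L⁻¹ n))
    (h.hasSum_modePowerSum hL hs)

theorem tsum_modePowerSum_sub_one (h : IsJumpWeight g G) {L : ℝ} (hL : 0 < L)
    (hs : Summable fun z => g (latticeVec L z)) {w : ℕ → ℝ} (hw : ∀ j, 0 ≤ w j)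
    {Φ : Space d → ℝ}
    (hΦ : ∀ k, k ≠ 0 → HasSum (fun j => w j * modeWeight G k ^ (j + 1)) (Φ k)) :
    ∑' j, ENNReal.ofReal (w j * (modePowerSum G L (j + 1) - 1)) = excitedSum L Φ := by
  have h1 : ∀ j, ENNReal.ofReal (w j * (modePowerSum G L (j + 1) - 1)) =
      ∑' n : Fin d → ℤ, if n = 0 then 0 else
        ENNReal.ofReal (w j * modeWeight G (latticeVec L⁻¹ n) ^ (j + 1)) := by
    intro j
    have h2 := (h.hasSum_modePowerSum hL hs j).update 0 0
    rw [latticeVec_zero, h.modeWeight_zero, one_pow] at h2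
    have h3 := h2.mul_left (w j)
    rw [show (0 : ℝ) - 1 + modePowerSum G L (j + 1) = modePowerSum G L (j + 1) - 1 by ring] at h3
    rw [← h3.tsum_eq, ENNReal.ofReal_tsum_of_nonneg _ h3.summable]
    · refine tsum_congr fun n => ?_
      rcases eq_or_ne n 0 with rfl | hn
      · simp
      · simp [hn]
    · intro n
      refine mul_nonneg (hw j) ?_
      rcases eq_or_ne n 0 with rfl | hn
      · simp
      · rw [Function.update_of_ne hn]
        exact pow_nonneg (h.modeWeight_nonneg _) _
  simp only [h1]
  rw [ENNReal.tsum_comm]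
  refine tsum_congr fun n => ?_
  split_ifs with hn
  · simp
  · have h4 := hΦ _ (latticeVec_ne_zero hL hn)
    rw [← h4.tsum_eq, ENNReal.ofReal_tsum_of_nonneg
      (fun j => mul_nonneg (hw j) (pow_nonneg (h.modeWeight_nonneg _) _)) h4.summable]

theorem hasSum_modePowerSum_sub_one (h : IsJumpWeight g G) {L : ℝ} (hL : 0 < L)
    (hs : Summable fun z => g (latticeVec L z)) {w : ℕ → ℝ} (hw : ∀ j, 0 ≤ w j)
    {Φ : Space d → ℝ}
    (hΦ : ∀ k, k ≠ 0 → HasSum (fun j => w j * modeWeight G k ^ (j + 1)) (Φ k))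
    (hfin : excitedSum L Φ ≠ ∞) :
    HasSum (fun j => w j * (modePowerSum G L (j + 1) - 1)) (excitedSum L Φ).toReal := by
  have h1 := h.tsum_modePowerSum_sub_one hL hs hw hΦ
  have h2 := ENNReal.hasSum_toReal (h1.trans_ne hfin)
  rw [← ENNReal.tsum_toReal_eq fun _ => ENNReal.ofReal_ne_top, h1] at h2
  convert h2 using 2 with j
  rw [ENNReal.toReal_ofReal]
  exact mul_nonneg (hw j) (sub_nonneg.2 (h.one_le_modePowerSum hL hs j))

theorem hasSum_occupation (h : IsJumpWeight g G) {k : Space d} (hk : k ≠ 0) :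
    HasSum (fun j => 1 * modeWeight G k ^ (j + 1)) (occupation G k) := by
  have h1 := (hasSum_geometric_of_lt_one (h.modeWeight_nonneg k)
    (h.modeWeight_lt_one hk)).mul_left (modeWeight G k)
  simp only [one_mul, pow_succ', occupation, div_eq_mul_inv]
  exact h1

theorem hasSum_mul_occupation (h : IsJumpWeight g G) {k : Space d} (hk : k ≠ 0) :
    HasSum (fun j : ℕ => (j + 1 : ℝ) * modeWeight G k ^ (j + 1))
      (occupation G k / (1 - modeWeight G k)) := by
  have h1 := hasSum_coe_mul_geometric_of_norm_lt_one (r := modeWeight G k)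
    (by rw [Real.norm_eq_abs, abs_of_nonneg (h.modeWeight_nonneg k)]; exact h.modeWeight_lt_one hk)
  rw [← hasSum_nat_add_iff' 1] at h1
  simp only [Finset.range_one, Finset.sum_singleton, Nat.cast_zero, zero_mul, sub_zero] at h1
  rw [occupation, div_div, ← sq]
  exact_mod_cast h1

theorem hasSum_tail_occupation (h : IsJumpWeight g G) (m : ℕ) {k : Space d} (hk : k ≠ 0) :
    HasSum (fun j : ℕ => (if m ≤ j then 1 else 0) * modeWeight G k ^ (j + 1))
      (modeWeight G k ^ m * occupation G k) := by
  rw [← hasSum_nat_add_iff' m, Finset.sum_eq_zero, sub_zero]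
  · have e : (fun j : ℕ => (if m ≤ j + m then (1 : ℝ) else 0) * modeWeight G k ^ (j + m + 1)) =
        fun j => modeWeight G k ^ m * (1 * modeWeight G k ^ (j + 1)) := by
      funext j
      rw [if_pos (Nat.le_add_left m j)]
      ring
    rw [e]
    exact (h.hasSum_occupation hk).mul_left _
  · intro j hj
    rw [if_neg (by simpa using hj), zero_mul]

/-- The density of points in cycles of a fixed length. -/
theorem tendsto_modePowerSum_div (h : IsJumpWeight g G)
    (hs : ∀ᶠ L in atTop, Summable fun z => g (latticeVec L z))
    (hP : Tendsto (fun L => ∑' z, g (latticeVec L z)) atTop (𝓝 1)) (j : ℕ) :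
    Tendsto (fun L : ℝ => modePowerSum G L (j + 1) / L ^ d) atTop
      (𝓝 (∫⁻ k, ENNReal.ofReal (modeWeight G k ^ (j + 1))).toReal) := by
  have hle : ∀ k, ENNReal.ofReal (modeWeight G k ^ (j + 1)) ≤ ENNReal.ofReal (modeWeight G k) :=
    fun k => ENNReal.ofReal_le_ofReal (pow_le_of_le_one (h.modeWeight_nonneg k)
      (h.modeWeight_le_one k) (Nat.succ_ne_zero j))
  have h1 := h.tendsto_tsum_of_le_modeWeight hs hP
    (h.continuous_ofReal_modeWeight_pow (j + 1)) hle
  have hfin : ∫⁻ k, ENNReal.ofReal (modeWeight G k ^ (j + 1)) ≠ ∞ := by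
    refine ((lintegral_mono hle).trans_lt ?_).ne
    rw [← ofReal_integral_eq_lintegral_ofReal h.integrable_modeWeight
      (ae_of_all _ h.modeWeight_nonneg)]
    exact ENNReal.ofReal_lt_top
  refine ((ENNReal.tendsto_toReal hfin).comp h1).congr' ?_
  filter_upwards [hs, eventually_gt_atTop 0] with L hL hL0
  have h2 := h.hasSum_modePowerSum hL0 hL j
  have hV : (0 : ℝ) < L ^ d := by positivity
  simp only [Function.comp, ENNReal.toReal_mul, ENNReal.toReal_inv, ENNReal.toReal_ofReal hV.le]
  rw [← ENNReal.ofReal_tsum_of_nonneg (fun n => pow_nonneg (h.modeWeight_nonneg _) _) h2.summable,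
    h2.tsum_eq, ENNReal.toReal_ofReal (zero_le_one.trans (h.one_le_modePowerSum hL0 hL j))]
  ring

theorem lintegral_occupation (h : IsJumpWeight g G) (hd : 1 ≤ d) :
    ∫⁻ k, ENNReal.ofReal (occupation G k) =
      ∑' j : ℕ, ∫⁻ k, ENNReal.ofReal (modeWeight G k ^ (j + 1)) := by
  have : Nonempty (Fin d) := ⟨⟨0, hd⟩⟩
  have hae : ∀ᵐ k : Space d, k ≠ 0 := by simp [ae_iff]
  rw [← lintegral_tsum fun j =>
    (h.continuous_ofReal_modeWeight_pow (j + 1)).measurable.aemeasurable]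
  refine lintegral_congr_ae ?_
  filter_upwards [hae] with k hk
  have h1 := h.hasSum_occupation hk
  simp only [one_mul] at h1
  rw [← h1.tsum_eq, ENNReal.ofReal_tsum_of_nonneg
    (fun j => pow_nonneg (h.modeWeight_nonneg _) _) h1.summable]

end IsJumpWeight

end PowerSum

/-! ### Thermodynamic limits -/

section ThermodynamicLimit

variable {d : ℕ} {g G : Space d → ℝ}

namespace IsJumpWeight

theorem continuousAt_occupation (h : IsJumpWeight g G) {k : Space d} (hk : k ≠ 0) :
    ContinuousAt (occupation G) k :=
  h.continuous_modeWeight.continuousAt.div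
    (continuousAt_const.sub h.continuous_modeWeight.continuousAt)
    (sub_pos.2 (h.modeWeight_lt_one hk)).ne'

theorem tendsto_excitedSum_div (h : IsJumpWeight g G) (hd : 1 ≤ d)
    (hs : ∀ᶠ L in atTop, Summable fun z => g (latticeVec L z))
    (hP : Tendsto (fun L => ∑' z, g (latticeVec L z)) atTop (𝓝 1))
    (hgap : ∃ δ > 0, ∃ A > 0, ∀ k k' : Space d, ‖k‖ ≤ δ → ‖k'‖ ≤ ‖k‖ →
      1 - modeWeight G k' ≤ A * (1 - modeWeight G k))
    (hocc : ∫⁻ k, ENNReal.ofReal (occupation G k) ≠ ∞)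
    {Φ : ℝ → Space d → ℝ} {Φ' : Space d → ℝ} (hΦ' : ∫⁻ k, ENNReal.ofReal (Φ' k) ≠ ∞)
    (hle : ∀ᶠ L in atTop, ∀ k, Φ L k ≤ occupation G k)
    (hlim : ∀ k, k ≠ 0 → Tendsto (fun L => Φ L (gridPoint L k)) atTop (𝓝 (Φ' k))) :
    (∀ᶠ L in atTop, excitedSum L (Φ L) ≠ ∞) ∧
      Tendsto (fun L => (excitedSum L (Φ L)).toReal / L ^ d) atTop
        (𝓝 (∫⁻ k, ENNReal.ofReal (Φ' k)).toReal) := by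
  have h1 := h.tendsto_tsum_of_le_occupation hd hs hP hgap hocc
    (Φ := fun L k => ENNReal.ofReal (Φ L k)) (Φ' := fun k => ENNReal.ofReal (Φ' k))
    (hle.mono fun L hL k => ENNReal.ofReal_le_ofReal (hL k))
    (fun k hk => ENNReal.tendsto_ofReal (hlim k hk))
  constructor
  · filter_upwards [h1.eventually_lt_const hΦ'.lt_top] with L hL htop
    unfold excitedSum at htop
    rw [htop, ENNReal.mul_top (by simp)] at hL
    exact lt_irrefl _ hL
  · refine ((ENNReal.tendsto_toReal hΦ').comp h1).congr' ?_
    filter_upwards [eventually_gt_atTop 0] with L hL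
    have hV : (0 : ℝ) < L ^ d := by positivity
    simp only [Function.comp, ENNReal.toReal_mul, ENNReal.toReal_inv, ENNReal.toReal_ofReal hV.le]
    rw [mul_comm, ← div_eq_mul_inv, excitedSum]

theorem tendsto_excitedSum_occupation (h : IsJumpWeight g G) (hd : 1 ≤ d)
    (hs : ∀ᶠ L in atTop, Summable fun z => g (latticeVec L z))
    (hP : Tendsto (fun L => ∑' z, g (latticeVec L z)) atTop (𝓝 1))
    (hgap : ∃ δ > 0, ∃ A > 0, ∀ k k' : Space d, ‖k‖ ≤ δ → ‖k'‖ ≤ ‖k‖ →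
      1 - modeWeight G k' ≤ A * (1 - modeWeight G k))
    (hocc : ∫⁻ k, ENNReal.ofReal (occupation G k) ≠ ∞) :
    (∀ᶠ L in atTop, excitedSum L (occupation G) ≠ ∞) ∧
      Tendsto (fun L => (excitedSum L (occupation G)).toReal / L ^ d) atTop
        (𝓝 (∫⁻ k, ENNReal.ofReal (occupation G k)).toReal) :=
  h.tendsto_excitedSum_div hd hs hP hgap hocc (Φ := fun _ => occupation G) hocc
    (Eventually.of_forall fun _ _ => le_rfl)
    fun k hk => (h.continuousAt_occupation hk).tendsto.comp (tendsto_gridPoint k)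

/-- The excited modes do not contribute to cycles whose length diverges. -/
theorem tendsto_excitedSum_pow_mul (h : IsJumpWeight g G) (hd : 1 ≤ d)
    (hs : ∀ᶠ L in atTop, Summable fun z => g (latticeVec L z))
    (hP : Tendsto (fun L => ∑' z, g (latticeVec L z)) atTop (𝓝 1))
    (hgap : ∃ δ > 0, ∃ A > 0, ∀ k k' : Space d, ‖k‖ ≤ δ → ‖k'‖ ≤ ‖k‖ →
      1 - modeWeight G k' ≤ A * (1 - modeWeight G k))
    (hocc : ∫⁻ k, ENNReal.ofReal (occupation G k) ≠ ∞) {m : ℝ → ℕ} (hm : Tendsto m atTop atTop) :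
    (∀ᶠ L in atTop, excitedSum L (fun k => modeWeight G k ^ m L * occupation G k) ≠ ∞) ∧
      Tendsto (fun L => (excitedSum L fun k => modeWeight G k ^ m L * occupation G k).toReal / L ^ d)
        atTop (𝓝 0) := by
  have h1 := h.tendsto_excitedSum_div hd hs hP hgap hocc
    (Φ := fun L k => modeWeight G k ^ m L * occupation G k) (Φ' := fun _ => 0) (by simp)
    (Eventually.of_forall fun L k => mul_le_of_le_one_left (h.occupation_nonneg k)
      (pow_le_one₀ (h.modeWeight_nonneg k) (h.modeWeight_le_one k))) fun k hk => ?_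
  · simpa using h1
  have h2 := (h.continuousAt_occupation hk).tendsto.comp (tendsto_gridPoint k)
  obtain ⟨q, hq, hq1⟩ := exists_between (h.modeWeight_lt_one hk)
  have hq0 : 0 ≤ q := (h.modeWeight_nonneg k).trans hq.le
  have h3 : Tendsto (fun L => modeWeight G (gridPoint L k) ^ m L) atTop (𝓝 0) := by
    refine squeeze_zero' (Eventually.of_forall fun L => pow_nonneg (h.modeWeight_nonneg _) _) ?_
      ((tendsto_pow_atTop_nhds_zero_of_lt_one hq0 hq1).comp hm)
    filter_upwards [((h.continuous_modeWeight.tendsto k).comp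
      (tendsto_gridPoint k)).eventually_lt_const hq] with L hL
    exact pow_le_pow_left₀ (h.modeWeight_nonneg _) hL.le _
  simpa using h3.mul h2

/-- The fluctuations of the number of points in excited modes are negligible: no excited mode is
macroscopically occupied. -/
theorem tendsto_excitedSum_div_sq (h : IsJumpWeight g G) (hd : 1 ≤ d)
    (hs : ∀ᶠ L in atTop, Summable fun z => g (latticeVec L z))
    (hP : Tendsto (fun L => ∑' z, g (latticeVec L z)) atTop (𝓝 1))
    (hgap : ∃ δ > 0, ∃ A > 0, ∀ k k' : Space d, ‖k‖ ≤ δ → ‖k'‖ ≤ ‖k‖ →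
      1 - modeWeight G k' ≤ A * (1 - modeWeight G k))
    (hocc : ∫⁻ k, ENNReal.ofReal (occupation G k) ≠ ∞) :
    (∀ᶠ L in atTop, excitedSum L (fun k => occupation G k / (1 - modeWeight G k)) ≠ ∞) ∧
      Tendsto (fun L => (excitedSum L fun k => occupation G k / (1 - modeWeight G k)).toReal /
        (L ^ d) ^ 2) atTop (𝓝 0) := by
  obtain ⟨hTfin, hT⟩ := h.tendsto_excitedSum_occupation hd hs hP hgap hocc
  set ρc := (∫⁻ k, ENNReal.ofReal (occupation G k)).toReal with hρc
  have hρc0 : 0 ≤ ρc := ENNReal.toReal_nonneg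
  set K := ρc + 2 with hK
  have hK0 : 0 < K := by positivity
  have hV : Tendsto (fun L : ℝ => L ^ d) atTop atTop := tendsto_pow_atTop (by omega)
  have h1 := h.tendsto_excitedSum_div hd hs hP hgap hocc
    (Φ := fun L k => occupation G k * min 1 ((K * L ^ d * (1 - modeWeight G k))⁻¹))
    (Φ' := fun _ => 0) (by simp)
    (Eventually.of_forall fun L k => mul_le_of_le_one_right (h.occupation_nonneg k)
      (min_le_left _ _)) fun k hk => ?_
  swap
  · have h2 := (h.continuousAt_occupation hk).tendsto.comp (tendsto_gridPoint k)
    have h3 : Tendsto (fun L => 1 - modeWeight G (gridPoint L k)) atTop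
        (𝓝 (1 - modeWeight G k)) :=
      ((h.continuous_modeWeight.tendsto k).comp (tendsto_gridPoint k)).const_sub 1
    have h4 : Tendsto (fun L : ℝ => K * L ^ d * (1 - modeWeight G (gridPoint L k))) atTop atTop :=
      (hV.const_mul_atTop hK0).atTop_mul_pos (sub_pos.2 (h.modeWeight_lt_one hk)) h3
    have h5 := (tendsto_const_nhds (x := (1 : ℝ))).min (tendsto_inv_atTop_zero.comp h4)
    rw [min_eq_right zero_le_one] at h5
    simpa using h2.mul h5
  obtain ⟨hfin, hlim⟩ := h1
  -- the occupation of a single mode is at most the total occupation, which is of order `L ^ d`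
  have hkey : ∀ᶠ L in atTop,
      excitedSum L (fun k => occupation G k / (1 - modeWeight G k)) =
        ENNReal.ofReal (K * L ^ d) * excitedSum L
          fun k => occupation G k * min 1 ((K * L ^ d * (1 - modeWeight G k))⁻¹) := by
    filter_upwards [hTfin, hT.eventually_lt_const (show ρc < ρc + 1 by linarith),
      hV.eventually_ge_atTop 1, eventually_gt_atTop 0] with L hL1 hL2 hL3 hL4
    have hVpos : (0 : ℝ) < L ^ d := by positivity
    rw [div_lt_iff₀ hVpos] at hL2
    unfold excitedSum
    rw [← ENNReal.tsum_mul_left]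
    refine tsum_congr fun n => ?_
    split_ifs with hn
    · simp
    · have hk := latticeVec_ne_zero hL4 hn
      set k : Space d := latticeVec L⁻¹ n
      have h6 : ENNReal.ofReal (occupation G k) ≤ excitedSum L (occupation G) := by
        have := ENNReal.le_tsum (f := fun n : Fin d → ℤ => if n = 0 then 0 else
          ENNReal.ofReal (occupation G (latticeVec L⁻¹ n))) n
        rwa [if_neg hn] at this
      have h7 : occupation G k ≤ (excitedSum L (occupation G)).toReal :=
        (ENNReal.ofReal_le_iff_le_toReal hL1).1 h6
      have h8 : (1 - modeWeight G k)⁻¹ ≤ K * L ^ d := by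
        rw [h.inv_one_sub_modeWeight hk, hK]
        nlinarith
      have hpos := sub_pos.2 (h.modeWeight_lt_one hk)
      have h9 : (K * L ^ d * (1 - modeWeight G k))⁻¹ ≤ 1 := by
        rw [mul_inv]
        exact (inv_mul_le_iff₀ (by positivity)).2 (by rwa [mul_one])
      beta_reduce
      rw [min_eq_right h9, ← ENNReal.ofReal_mul (by positivity)]
      congr 1
      field_simp
  constructor
  · filter_upwards [hkey, hfin] with L hL1 hL2
    rw [hL1]
    exact ENNReal.mul_ne_top ENNReal.ofReal_ne_top hL2
  · have h2 := hlim.const_mul K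
    rw [lintegral_congr (fun k => ENNReal.ofReal_zero), lintegral_zero, ENNReal.toReal_zero,
      mul_zero] at h2
    refine h2.congr' ?_
    filter_upwards [hkey, eventually_gt_atTop 0] with L hL1 hL2
    have hVpos : (0 : ℝ) < L ^ d := by positivity
    rw [hL1, ENNReal.toReal_mul, ENNReal.toReal_ofReal (by positivity)]
    field_simp

/-- The limiting density of points in cycles of length between diverging but microscopic lengths
`m` and lengths `M` of the order of the volume. -/
theorem tendsto_sum_cycles (h : IsJumpWeight g G) (hd : 1 ≤ d)
    (hs : ∀ᶠ L in atTop, Summable fun z => g (latticeVec L z))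
    (hP : Tendsto (fun L => ∑' z, g (latticeVec L z)) atTop (𝓝 1)) {ρ : ℝ} (hρ : 0 ≤ ρ)
    (hgap : ∫⁻ k, ENNReal.ofReal (occupation G k) < ENNReal.ofReal ρ →
      ∃ δ > 0, ∃ A > 0, ∀ k k' : Space d, ‖k‖ ≤ δ → ‖k'‖ ≤ ‖k‖ →
        1 - modeWeight G k' ≤ A * (1 - modeWeight G k))
    {N m M : ℝ → ℕ} (hN : Tendsto (fun L : ℝ => (N L : ℝ) / L ^ d) atTop (𝓝 ρ))
    (hm : Tendsto m atTop atTop) (hmV : Tendsto (fun L : ℝ => (m L : ℝ) / L ^ d) atTop (𝓝 0))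
    {s : ℝ} (hs0 : 0 ≤ s) (hM : Tendsto (fun L : ℝ => (M L : ℝ) / L ^ d) atTop (𝓝 s)) :
    Tendsto (fun L : ℝ => (∑ j ∈ Finset.Ico (m L) (min (M L) (N L)), modePowerSum G L (j + 1) *
      (homog (modePowerSum G L) (N L - 1 - j) / homog (modePowerSum G L) (N L))) / L ^ d) atTop
      (𝓝 (min s (ENNReal.ofReal ρ - ∫⁻ k, ENNReal.ofReal (occupation G k)).toReal)) := by
  have hV : Tendsto (fun L : ℝ => L ^ d) atTop atTop := tendsto_pow_atTop (by omega)
  have hL0 : ∀ᶠ L : ℝ in atTop, 0 < L := eventually_gt_atTop 0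
  have ht : ∀ᶠ L in atTop, ∀ j, 1 ≤ modePowerSum G L (j + 1) := by
    filter_upwards [hs, hL0] with L hL hL' using h.one_le_modePowerSum hL' hL
  rcases le_or_gt (ENNReal.ofReal ρ) (∫⁻ k, ENNReal.ofReal (occupation G k)) with hc | hc
  · rw [tsub_eq_zero_of_le hc, ENNReal.toReal_zero, min_eq_right hs0]
    have hfin : ∀ j : ℕ, ∫⁻ k, ENNReal.ofReal (modeWeight G k ^ (j + 1)) ≠ ∞ := by
      intro j
      refine ((lintegral_mono fun k => ENNReal.ofReal_le_ofReal (pow_le_of_le_one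
        (h.modeWeight_nonneg k) (h.modeWeight_le_one k) (Nat.succ_ne_zero j))).trans_lt ?_).ne
      rw [← ofReal_integral_eq_lintegral_ofReal h.integrable_modeWeight
        (ae_of_all _ h.modeWeight_nonneg)]
      exact ENNReal.ofReal_lt_top
    have hcsum : ∀ ε > 0, ∃ J, ρ - ε <
        ∑ j ∈ Finset.range J, (∫⁻ k, ENNReal.ofReal (modeWeight G k ^ (j + 1))).toReal := by
      intro ε hε
      rcases lt_or_ge (ρ - ε) 0 with hneg | hnn
      · exact ⟨0, by simpa using hneg⟩
      rw [h.lintegral_occupation hd] at hc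
      have h1 : ENNReal.ofReal (ρ - ε) <
          ∑' j : ℕ, ∫⁻ k, ENNReal.ofReal (modeWeight G k ^ (j + 1)) :=
        lt_of_lt_of_le ((ENNReal.ofReal_lt_ofReal_iff (by linarith)).2 (by linarith)) hc
      obtain ⟨J, hJ⟩ := ((ENNReal.tendsto_nat_tsum _).eventually_const_lt h1).exists
      refine ⟨J, ?_⟩
      rw [← ENNReal.toReal_sum fun j _ => hfin j]
      exact (ENNReal.ofReal_lt_iff_lt_toReal hnn
        (ENNReal.sum_ne_top.2 fun j _ => hfin j)).1 hJ
    have htail := fun ε hε => exists_tail_le (l := atTop) (t := modePowerSum G)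
      (V := fun L => L ^ d) (N := N) (ρ := ρ) (hL0.mono fun L hL => by positivity) ht
      (by filter_upwards [hs, hL0] with L hL hL' using h.modePowerSum_le hL' hL)
      (by filter_upwards [hs, hL0] with L hL hL' using h.logConcave_homog_modePowerSum hL' hL)
      hN (h.tendsto_modePowerSum_div hs hP) hcsum (ε := ε) hε
    rw [Metric.tendsto_nhds]
    intro ε hε
    obtain ⟨J, hJ⟩ := htail (ε / 2) (by positivity)
    filter_upwards [hJ, hm.eventually_ge_atTop J, ht, hL0] with L h1 h2 h3 h4
    have hw : ∀ j, 0 ≤ modePowerSum G L (j + 1) * (homog (modePowerSum G L) (N L - 1 - j) /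
        homog (modePowerSum G L) (N L)) := fun j =>
      mul_nonneg (zero_le_one.trans (h3 j)) (div_nonneg (homog_pos h3 _).le (homog_pos h3 _).le)
    rw [Real.dist_eq, sub_zero, abs_of_nonneg
      (div_nonneg (Finset.sum_nonneg fun j _ => hw j) (by positivity))]
    refine lt_of_le_of_lt ?_ (show ε / 2 < ε by linarith)
    refine le_trans ?_ h1
    refine div_le_div_of_nonneg_right ?_ (by positivity)
    exact Finset.sum_le_sum_of_subset_of_nonneg
      (Finset.Ico_subset_Ico h2 (min_le_right _ _)) fun j _ _ => hw j
  · have hocc : ∫⁻ k, ENNReal.ofReal (occupation G k) ≠ ∞ :=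
      (hc.trans ENNReal.ofReal_lt_top).ne
    obtain ⟨hTfin, hT⟩ := h.tendsto_excitedSum_occupation hd hs hP (hgap hc) hocc
    obtain ⟨hDfin, hD⟩ := h.tendsto_excitedSum_div_sq hd hs hP (hgap hc) hocc
    obtain ⟨hUfin, hU⟩ := h.tendsto_excitedSum_pow_mul hd hs hP (hgap hc) hocc hm
    have hρ' : (∫⁻ k, ENNReal.ofReal (occupation G k)).toReal < ρ := by
      have := (ENNReal.toReal_lt_toReal hocc ENNReal.ofReal_ne_top).2 hc
      rwa [ENNReal.toReal_ofReal hρ] at this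
    rw [ENNReal.toReal_sub_of_le hc.le ENNReal.ofReal_ne_top, ENNReal.toReal_ofReal hρ]
    have hTs : ∀ᶠ L in atTop, HasSum (fun j => modePowerSum G L (j + 1) - 1)
        (excitedSum L (occupation G)).toReal := by
      filter_upwards [hs, hL0, hTfin] with L h1 h2 h3
      simpa using h.hasSum_modePowerSum_sub_one h2 h1 (w := fun _ => 1) (fun _ => zero_le_one)
        (fun k hk => h.hasSum_occupation hk) h3
    have hDs : ∀ᶠ L in atTop, HasSum (fun j : ℕ => (j + 1 : ℝ) * (modePowerSum G L (j + 1) - 1))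
        (excitedSum L fun k => occupation G k / (1 - modeWeight G k)).toReal := by
      filter_upwards [hs, hL0, hDfin] with L h1 h2 h3
      exact h.hasSum_modePowerSum_sub_one h2 h1 (w := fun j => (j + 1 : ℝ)) (fun j => by positivity)
        (fun k hk => h.hasSum_mul_occupation hk) h3
    have hmain := tendsto_sum_homog_div hV ht hTs hDs hN hM hT hD hρ'
    have hdist := hU.add hmV
    rw [add_zero] at hdist
    refine tendsto_of_tendsto_of_dist hmain
      (squeeze_zero' (Eventually.of_forall fun L => dist_nonneg) ?_ hdist)
    filter_upwards [hs, hL0, hUfin, ht] with L h1 h2 h3 h4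
    have hsum := h.hasSum_modePowerSum_sub_one h2 h1 (w := fun j => if m L ≤ j then 1 else 0)
      (fun j => by split_ifs <;> norm_num) (fun k hk => h.hasSum_tail_occupation (m L) hk) h3
    set U := (excitedSum L fun k => modeWeight G k ^ m L * occupation G k).toReal
    have hU0 : 0 ≤ U := ENNReal.toReal_nonneg
    set t := modePowerSum G L
    set r : ℕ → ℝ := fun j => homog t (N L - 1 - j) / homog t (N L)
    have hr0 : ∀ j, 0 ≤ r j := fun j => div_nonneg (homog_pos h4 _).le (homog_pos h4 _).le
    have hr1 : ∀ j, r j ≤ 1 := fun j =>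
      div_le_one_of_le₀ (homog_mono h4 (by omega)) (homog_pos h4 _).le
    have ht1 : ∀ j, 0 ≤ t (j + 1) - 1 := fun j => sub_nonneg.2 (h4 j)
    set Q := min (M L) (N L)
    have hrange : ∀ q, ∑ j ∈ Finset.range q, r j ≤ q := fun q =>
      (Finset.sum_le_sum fun j _ => hr1 j).trans (by simp)
    have hrange0 : ∀ q, 0 ≤ ∑ j ∈ Finset.range q, r j := fun q =>
      Finset.sum_nonneg fun j _ => hr0 j
    rw [Real.dist_eq, ← sub_div, ← add_div, abs_div, abs_of_pos (by positivity : (0 : ℝ) < L ^ d)]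
    refine div_le_div_of_nonneg_right ?_ (by positivity)
    change |∑ j ∈ Finset.range Q, r j - ∑ j ∈ Finset.Ico (m L) Q, t (j + 1) * r j| ≤ U + m L
    rcases le_or_gt (m L) Q with hmQ | hmQ
    · have e1 : ∑ j ∈ Finset.Ico (m L) Q, t (j + 1) * r j =
          ∑ j ∈ Finset.Ico (m L) Q, (t (j + 1) - 1) * r j + ∑ j ∈ Finset.Ico (m L) Q, r j := by
        rw [← Finset.sum_add_distrib]
        exact Finset.sum_congr rfl fun j _ => by ring
      have e2 : 0 ≤ ∑ j ∈ Finset.Ico (m L) Q, (t (j + 1) - 1) * r j :=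
        Finset.sum_nonneg fun j _ => mul_nonneg (ht1 j) (hr0 j)
      have e3 : ∑ j ∈ Finset.Ico (m L) Q, (t (j + 1) - 1) * r j ≤ U := by
        refine le_trans (Finset.sum_le_sum fun j hj => ?_) (sum_le_hasSum (Finset.Ico (m L) Q)
          (fun j _ => mul_nonneg (by split_ifs <;> norm_num) (ht1 j)) hsum)
        rw [if_pos (Finset.mem_Ico.1 hj).1, one_mul]
        exact mul_le_of_le_one_right (ht1 j) (hr1 j)
      rw [← Finset.sum_range_add_sum_Ico _ hmQ, e1, abs_le]
      constructor <;> linarith [hrange (m L), hrange0 (m L), (Nat.cast_nonneg (m L) : (0 : ℝ) ≤ m L)]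
    · rw [Finset.Ico_eq_empty (by omega), Finset.sum_empty, sub_zero, abs_of_nonneg (hrange0 _)]
      have : (Q : ℝ) ≤ m L := by exact_mod_cast hmQ.le
      linarith [hrange Q]

end IsJumpWeight

end ThermodynamicLimit

/-! ### The partition function and the cycle expectations -/

section PartitionFunction

variable {d : ℕ} {ξ : Space d → ℝ≥0∞}

/-- The real-valued weight `e^{-ξ}`. -/
noncomputable def realWeight (ξ : Space d → ℝ≥0∞) (x : Space d) : ℝ := (weight ξ x).toReal

/-- The Fourier transform of `e^{-ξ}`, as a real function. -/
noncomputable def realFourier (ξ : Space d → ℝ≥0∞) (k : Space d) : ℝ := (weightFourier ξ k).re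

theorem weight_le_one (ξ : Space d → ℝ≥0∞) (x : Space d) : weight ξ x ≤ 1 := by
  rw [weight, EReal.exp_le_one_iff]
  simpa using EReal.neg_le_neg_iff.2 (EReal.coe_ennreal_nonneg (ξ x))

theorem weight_ne_top (ξ : Space d → ℝ≥0∞) (x : Space d) : weight ξ x ≠ ∞ :=
  ((weight_le_one ξ x).trans_lt ENNReal.one_lt_top).ne

theorem ofReal_realWeight (ξ : Space d → ℝ≥0∞) (x : Space d) :
    ENNReal.ofReal (realWeight ξ x) = weight ξ x := ENNReal.ofReal_toReal (weight_ne_top ξ x)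

theorem continuous_weight (hξ : Continuous ξ) : Continuous (weight ξ) :=
  ENNReal.continuous_exp.comp (continuous_neg.comp (continuous_coe_ennreal_ereal.comp hξ))

theorem isJumpWeight (hξ_radial : ∀ x y, ‖x‖ = ‖y‖ → ξ x = ξ y) (hξ_zero : ξ 0 = 0)
    (hξ_cont : Continuous ξ) (hξ_int : normC ξ < ∞) (hξ_fourier : ∀ k, 0 ≤ weightFourier ξ k) :
    IsJumpWeight (realWeight ξ) (realFourier ξ) where
  continuous := ENNReal.continuousOn_toReal.comp_continuous (continuous_weight hξ_cont)
    (weight_ne_top ξ)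
  nonneg x := ENNReal.toReal_nonneg
  zero := by simp [realWeight, weight, hξ_zero]
  even x := by rw [realWeight, realWeight, weight, weight, hξ_radial (-x) x (norm_neg x)]
  integrable := integrable_toReal_of_lintegral_ne_top
    (continuous_weight hξ_cont).measurable.aemeasurable hξ_int.ne
  fourier k := by
    obtain ⟨h1, h2⟩ := Complex.nonneg_iff.1 (hξ_fourier k)
    exact Complex.ext rfl h2.symm
  fourier_nonneg k := (Complex.nonneg_iff.1 (hξ_fourier k)).1

theorem exp_neg_periodised (ξ : Space d → ℝ≥0∞) (L : ℝ) (x : Space d) :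
    EReal.exp (-periodised ξ L x) = ∑' y : Fin d → ℤ, weight ξ (x - latticeVec L y) := by
  rw [periodised, neg_neg, ENNReal.exp_log]

theorem exp_neg_periodised_eq_ofReal (h : IsJumpWeight (realWeight ξ) (realFourier ξ)) {L : ℝ}
    (hs : Summable fun z => realWeight ξ (latticeVec L z)) (x : Space d) :
    EReal.exp (-periodised ξ L x) = ENNReal.ofReal (periodicSum (realWeight ξ) L x) := by
  rw [exp_neg_periodised, periodicSum, ENNReal.ofReal_tsum_of_nonneg (fun z => h.nonneg _)
    (h.summable_and_tsum_le hs x).1]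
  simp only [ofReal_realWeight]

theorem exp_neg_sum {ι : Type*} (s : Finset ι) {e : ι → EReal} (he : ∀ i, EReal.exp (-e i) ≠ ∞) :
    EReal.exp (-∑ i ∈ s, e i) = ∏ i ∈ s, EReal.exp (-e i) := by
  have h1 : EReal.exp (∑ i ∈ s, e i) = ∏ i ∈ s, EReal.exp (e i) := by
    induction s using Finset.cons_induction with
    | empty => simp
    | cons a s ha ih => rw [Finset.sum_cons, Finset.prod_cons, EReal.exp_add, ih]
  rw [EReal.exp_neg, h1]
  simp only [EReal.exp_neg] at he ⊢
  refine ENNReal.prod_inv_distrib fun i _ j _ _ => Or.inl ?_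
  exact fun h0 => he i (by rw [h0, ENNReal.inv_zero])

/-- The weights `e^{-H}` are products of the periodised kernel. -/
theorem exp_neg_hamiltonian (h : IsJumpWeight (realWeight ξ) (realFourier ξ)) {L : ℝ}
    (hs : Summable fun z => realWeight ξ (latticeVec L z)) {N : ℕ} (x : Fin N → Space d)
    (π : Equiv.Perm (Fin N)) : EReal.exp (-hamiltonian ξ L x π) =
      ∏ i, ENNReal.ofReal (periodicSum (realWeight ξ) L (x i - x (π i))) := by
  rw [hamiltonian, exp_neg_sum]
  · simp only [exp_neg_periodised_eq_ofReal h hs]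
  · intro i
    rw [exp_neg_periodised_eq_ofReal h hs]
    exact ENNReal.ofReal_ne_top

section Fixed

variable {g G : Space d → ℝ} {L : ℝ}

theorem restrict_pi_box (d N : ℕ) (L : ℝ) :
    (volume : Measure (Fin N → Space d)).restrict (Set.univ.pi fun _ => box d L) =
      Measure.pi fun _ => volume.restrict (box d L) := by
  rw [volume_pi, Measure.restrict_pi_pi]

theorem IsJumpWeight.measurable_periodicKernel (h : IsJumpWeight g G)
    (hs : Summable fun z => g (latticeVec L z)) :
    Measurable (Function.uncurry fun x y => ENNReal.ofReal (periodicSum g L (x - y))) :=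
  ((h.measurable_periodicSum hs).comp measurable_sub).ennreal_ofReal

theorem IsJumpWeight.kernelTrace_eq (h : IsJumpWeight g G) (hL : 0 < L)
    (hs : Summable fun z => g (latticeVec L z)) (j : ℕ) :
    kernelTrace (volume.restrict (box d L))
      (kernelIter (volume.restrict (box d L))
        (fun x y => ENNReal.ofReal (periodicSum g L (x - y)))
        (fun x y => ENNReal.ofReal (periodicSum g L (x - y))) j) =
      ENNReal.ofReal (G 0 ^ (j + 1) * modePowerSum G L (j + 1)) := by
  rw [(h.kernelTrace_box hL hs j).2, modePowerSum, ← tsum_mul_left]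
  congr 1
  refine tsum_congr fun n => ?_
  rw [modeWeight, ← mul_pow, mul_div_cancel₀ _ h.fourier_zero_pos.ne']

/-- The canonical partition functions are complete homogeneous symmetric functions of the mode
weights, since both satisfy Newton's recursion. -/
theorem IsJumpWeight.permWeight_eq (h : IsJumpWeight g G) (hL : 0 < L)
    (hs : Summable fun z => g (latticeVec L z)) (N : ℕ) :
    permWeight (volume.restrict (box d L)) (fun x y => ENNReal.ofReal (periodicSum g L (x - y))) N /
      (N.factorial : ℝ≥0∞) = ENNReal.ofReal (G 0 ^ N * homog (modePowerSum G L) N) := by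
  set μ := volume.restrict (box d L)
  set K : Space d → Space d → ℝ≥0∞ := fun x y => ENNReal.ofReal (periodicSum g L (x - y))
  have ht : ∀ j, 0 ≤ modePowerSum G L (j + 1) := fun j =>
    zero_le_one.trans (h.one_le_modePowerSum hL hs j)
  have hC := h.fourier_zero_pos
  induction N using Nat.strong_induction_on with
  | _ N ih =>
    rcases Nat.eq_zero_or_pos N with rfl | hN
    · simp [permWeight, homog_zero]
    have h1 := lintegral_sum_cycleLength μ (h.measurable_periodicKernel hs) N fun _ => 1
    have hfac : (N.factorial : ℝ≥0∞) ≠ 0 := by exact_mod_cast N.factorial_ne_zero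
    have hfac' : (N.factorial : ℝ≥0∞) ≠ ∞ := ENNReal.natCast_ne_top _
    have hN0 : (N : ℝ≥0∞) ≠ 0 := by exact_mod_cast hN.ne'
    have e1 : ∫⁻ x : Fin N → Space d, ∑ π : Equiv.Perm (Fin N), (∑ _q : Fin N, (1 : ℝ≥0∞)) *
        ∏ i, K (x i) (x (π i)) ∂(Measure.pi fun _ => μ) = N * permWeight μ K N := by
      rw [permWeight, ← lintegral_const_mul' _ _ (ENNReal.natCast_ne_top N)]
      simp [← Finset.mul_sum]
    have e2 : ∑ j ∈ Finset.range N, 1 * kernelTrace μ (kernelIter μ K K j) *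
        (permWeight μ K (N - 1 - j) / ((N - 1 - j).factorial : ℝ≥0∞)) =
        N * ENNReal.ofReal (G 0 ^ N * homog (modePowerSum G L) N) := by
      have e3 : ∀ j ∈ Finset.range N, 1 * kernelTrace μ (kernelIter μ K K j) *
          (permWeight μ K (N - 1 - j) / ((N - 1 - j).factorial : ℝ≥0∞)) =
          ENNReal.ofReal (G 0 ^ N * (modePowerSum G L (j + 1) *
            homog (modePowerSum G L) (N - 1 - j))) := by
        intro j hj
        have hj' := Finset.mem_range.1 hj
        rw [one_mul, ih _ (by omega), h.kernelTrace_eq hL hs j,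
          ← ENNReal.ofReal_mul (mul_nonneg (by positivity) (ht j))]
        congr 1
        have : G 0 ^ N = G 0 ^ (j + 1) * G 0 ^ (N - 1 - j) := by
          rw [← pow_add]; congr 1; omega
        rw [this]; ring
      rw [Finset.sum_congr rfl e3, ← ENNReal.ofReal_sum_of_nonneg
        (fun j _ => mul_nonneg (by positivity) (mul_nonneg (ht j) (homog_nonneg ht _))),
        ← Finset.mul_sum, homog_sum_rule, ← ENNReal.ofReal_natCast N,
        ← ENNReal.ofReal_mul (Nat.cast_nonneg N)]
      congr 1
      ring
    rw [e1, e2, ← mul_assoc, mul_comm (N.factorial : ℝ≥0∞), mul_assoc] at h1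
    have h2 := (ENNReal.mul_right_inj hN0 (ENNReal.natCast_ne_top N)).1 h1
    rw [h2, mul_comm, ENNReal.mul_div_cancel_right hfac hfac']

end Fixed

theorem partitionFunction_eq (h : IsJumpWeight (realWeight ξ) (realFourier ξ)) {L : ℝ} (hL : 0 < L)
    (hs : Summable fun z => realWeight ξ (latticeVec L z)) (N : ℕ) :
    partitionFunction ξ L N =
      ENNReal.ofReal (realFourier ξ 0 ^ N * homog (modePowerSum (realFourier ξ) L) N) := by
  rw [← h.permWeight_eq hL hs N, partitionFunction, restrict_pi_box, permWeight, mul_comm,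
    div_eq_mul_inv]
  simp only [exp_neg_hamiltonian h hs]

theorem cycleDensity_eq_sum (V m n : ℝ) {N : ℕ} (π : Equiv.Perm (Fin N)) :
    cycleDensity V m n π = ∑ q, if m ≤ (cycleLength π q : ℝ) ∧ (cycleLength π q : ℝ) ≤ n
      then ENNReal.ofReal V⁻¹ else 0 := by
  classical
  rw [cycleDensity, ← Finset.sum_filter, Finset.sum_const, nsmul_eq_mul,
    Set.ncard_eq_toFinset_card', div_eq_mul_inv, ENNReal.ofReal_mul (Nat.cast_nonneg _),
    ENNReal.ofReal_natCast]
  congr 3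
  ext q
  simp

/-- The expected density of points in cycles of length in `[m, n]`. -/
theorem expectation_cycleDensity (h : IsJumpWeight (realWeight ξ) (realFourier ξ)) {L : ℝ}
    (hL : 0 < L) (hs : Summable fun z => realWeight ξ (latticeVec L z)) (N : ℕ) {V : ℝ}
    (hV : 0 < V) (m n : ℝ) :
    expectation ξ L N (cycleDensity V m n) =
      ENNReal.ofReal ((∑ j ∈ (Finset.range N).filter fun j : ℕ =>
        m ≤ (j + 1 : ℕ) ∧ ((j + 1 : ℕ) : ℝ) ≤ n, modePowerSum (realFourier ξ) L (j + 1) *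
          (homog (modePowerSum (realFourier ξ) L) (N - 1 - j) /
            homog (modePowerSum (realFourier ξ) L) N)) / V) := by
  set G := realFourier ξ
  set t := modePowerSum G L
  have ht : ∀ j, 1 ≤ t (j + 1) := h.one_le_modePowerSum hL hs
  have hC : 0 < G 0 := h.fourier_zero_pos
  have hpos := homog_pos ht
  have hfac : (N.factorial : ℝ≥0∞) ≠ 0 := by exact_mod_cast N.factorial_ne_zero
  have hfac' : (N.factorial : ℝ≥0∞) ≠ ∞ := ENNReal.natCast_ne_top _
  rw [expectation, partitionFunction_eq h hL hs, restrict_pi_box]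
  simp only [exp_neg_hamiltonian h hs, cycleDensity_eq_sum]
  rw [lintegral_sum_cycleLength (volume.restrict (box d L)) (h.measurable_periodicKernel hs) N
    fun l => if m ≤ (l : ℝ) ∧ (l : ℝ) ≤ n then ENNReal.ofReal V⁻¹ else 0,
    mul_comm (ENNReal.ofReal _), ENNReal.mul_div_mul_left _ _ hfac hfac']
  change _ / ENNReal.ofReal (G 0 ^ N * homog t N) = _
  have e1 : ∀ j ∈ Finset.range N, (if m ≤ ((j + 1 : ℕ) : ℝ) ∧ ((j + 1 : ℕ) : ℝ) ≤ n
      then ENNReal.ofReal V⁻¹ else 0) *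
        kernelTrace (volume.restrict (box d L)) (kernelIter (volume.restrict (box d L))
          (fun x y => ENNReal.ofReal (periodicSum (realWeight ξ) L (x - y)))
          (fun x y => ENNReal.ofReal (periodicSum (realWeight ξ) L (x - y))) j) *
        (permWeight (volume.restrict (box d L))
          (fun x y => ENNReal.ofReal (periodicSum (realWeight ξ) L (x - y))) (N - 1 - j) /
          ((N - 1 - j).factorial : ℝ≥0∞)) =
      ENNReal.ofReal (if m ≤ ((j + 1 : ℕ) : ℝ) ∧ ((j + 1 : ℕ) : ℝ) ≤ n then
        G 0 ^ N * (V⁻¹ * (t (j + 1) * homog t (N - 1 - j))) else 0) := by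
    intro j hj
    have hj' := Finset.mem_range.1 hj
    split_ifs
    · rw [h.permWeight_eq hL hs, h.kernelTrace_eq hL hs j, ← ENNReal.ofReal_mul (inv_pos.2 hV).le,
        ← ENNReal.ofReal_mul (mul_nonneg (inv_pos.2 hV).le
          (mul_nonneg (by positivity) (zero_le_one.trans (ht j))))]
      congr 1
      have : G 0 ^ N = G 0 ^ (j + 1) * G 0 ^ (N - 1 - j) := by
        rw [← pow_add]; congr 1; omega
      rw [this]; ring
    · simp
  rw [Finset.sum_congr rfl e1, ← ENNReal.ofReal_sum_of_nonneg, ← ENNReal.ofReal_div_of_pos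
    (mul_pos (by positivity) (hpos N)), ← Finset.sum_filter]
  · congr 1
    rw [Finset.sum_div, Finset.sum_div]
    refine Finset.sum_congr rfl fun j _ => ?_
    have := (hpos N).ne'
    have := hC.ne'
    field_simp
  · intro j _
    split_ifs
    · exact mul_nonneg (by positivity) (mul_nonneg (inv_pos.2 hV).le
        (mul_nonneg (zero_le_one.trans (ht j)) (hpos _).le))
    · exact le_rfl

end PartitionFunction

/-! ### Cycle densities in the infinite volume limit -/

section CycleDensity

variable {d : ℕ} {ξ : Space d → ℝ≥0∞}

theorem normC_eq (h : IsJumpWeight (realWeight ξ) (realFourier ξ)) :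
    normC ξ = ENNReal.ofReal (realFourier ξ 0) := by
  rw [h.fourier_zero_eq, ofReal_integral_eq_lintegral_ofReal h.integrable (ae_of_all _ h.nonneg),
    normC]
  simp only [ofReal_realWeight]

theorem inv_inv_sub_one {x : ℝ} (hx : 0 ≤ x) (hx1 : x < 1) :
    ((ENNReal.ofReal x)⁻¹ - 1)⁻¹ = ENNReal.ofReal (x / (1 - x)) := by
  rcases hx.eq_or_lt with rfl | hx
  · simp
  · have h1 : 1 < x⁻¹ := (one_lt_inv₀ hx).2 hx1
    rw [← ENNReal.ofReal_inv_of_pos hx, ← ENNReal.ofReal_one, ← ENNReal.ofReal_sub _ zero_le_one,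
      ← ENNReal.ofReal_inv_of_pos (sub_pos.2 h1)]
    congr 1
    have : 1 - x ≠ 0 := (sub_pos.2 hx1).ne'
    field_simp

/-- The critical density is the integral of the mean occupation numbers. -/
theorem criticalDensity_eq (h : IsJumpWeight (realWeight ξ) (realFourier ξ)) (hd : 1 ≤ d) :
    criticalDensity ξ = ∫⁻ k, ENNReal.ofReal (occupation (realFourier ξ) k) := by
  have : Nonempty (Fin d) := ⟨⟨0, hd⟩⟩
  have hae : ∀ᵐ k : Space d, k ≠ 0 := by simp [ae_iff]
  refine lintegral_congr_ae ?_
  filter_upwards [hae] with k hk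
  rw [dispersion, EReal.exp_neg, ENNReal.exp_log, normC_eq h,
    ← ENNReal.ofReal_div_of_pos h.fourier_zero_pos]
  exact inv_inv_sub_one (h.modeWeight_nonneg k) (h.modeWeight_lt_one hk)

theorem tendsto_tsum_weight (hξ_zero : ξ 0 = 0)
    (hξ_periodised : Tendsto (fun L : ℝ => periodised ξ L 0) atTop (𝓝 (ξ 0 : EReal))) :
    Tendsto (fun L : ℝ => ∑' y : Fin d → ℤ, weight ξ (0 - latticeVec L y)) atTop (𝓝 1) := by
  have h1 := (ENNReal.continuous_exp.tendsto _).comp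
    ((continuous_neg.tendsto _).comp hξ_periodised)
  simpa [Function.comp_def, exp_neg_periodised, hξ_zero] using h1

theorem filter_range_eq_Ico (N : ℕ) (m : ℝ) {n : ℝ} (hn : 0 ≤ n) :
    ((Finset.range N).filter fun j : ℕ => m ≤ (j + 1 : ℕ) ∧ ((j + 1 : ℕ) : ℝ) ≤ n) =
      Finset.Ico (⌈m⌉₊ - 1) (min ⌊n⌋₊ N) := by
  ext j
  rw [Finset.mem_filter, Finset.mem_range, Finset.mem_Ico, ← Nat.ceil_le, ← Nat.le_floor_iff hn]
  omega

section Scales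

theorem tendsto_rpow_div_self {V : ℝ → ℝ} (hV : Tendsto V atTop atTop) {a : ℝ} (ha : a < 1) :
    Tendsto (fun L => V L ^ a / V L) atTop (𝓝 0) := by
  have h1 := (tendsto_rpow_neg_atTop (sub_pos.2 ha)).comp hV
  refine h1.congr' ?_
  filter_upwards [hV.eventually_gt_atTop 0] with L hL
  simp only [Function.comp, neg_sub]
  rw [Real.rpow_sub_one hL.ne']

theorem tendsto_floor_rpow_div {V : ℝ → ℝ} (hV : Tendsto V atTop atTop) {a : ℝ} (ha : a < 1) :
    Tendsto (fun L => (⌊V L ^ a⌋₊ : ℝ) / V L) atTop (𝓝 0) := by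
  refine squeeze_zero' ?_ ?_ (tendsto_rpow_div_self hV ha)
  all_goals filter_upwards [hV.eventually_gt_atTop 0] with L hL
  · positivity
  · gcongr
    exact Nat.floor_le (by positivity)

theorem tendsto_ceil_sub_one_rpow_div {V : ℝ → ℝ} (hV : Tendsto V atTop atTop) {a : ℝ}
    (ha : a < 1) : Tendsto (fun L => ((⌈V L ^ a⌉₊ - 1 : ℕ) : ℝ) / V L) atTop (𝓝 0) := by
  refine squeeze_zero' ?_ ?_ (tendsto_rpow_div_self hV ha)
  all_goals filter_upwards [hV.eventually_gt_atTop 0] with L hL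
  · positivity
  · gcongr
    have h1 : 0 < ⌈V L ^ a⌉₊ := Nat.ceil_pos.2 (by positivity)
    rw [Nat.cast_sub h1, Nat.cast_one]
    linarith [Nat.ceil_lt_add_one (show 0 ≤ V L ^ a by positivity)]

theorem tendsto_ceil_sub_one_rpow {V : ℝ → ℝ} (hV : Tendsto V atTop atTop) {a : ℝ} (ha : 0 < a) :
    Tendsto (fun L => ⌈V L ^ a⌉₊ - 1) atTop atTop :=
  (tendsto_sub_atTop_nat 1).comp (tendsto_nat_ceil_atTop.comp ((tendsto_rpow_atTop ha).comp hV))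

end Scales

end CycleDensity

end SpatialPermutation

theorem theorem5p1 (d : ℕ) (hd : 1 ≤ d)
    (ξ : SpatialPermutation.Space d → ℝ≥0∞)
    (hξ_radial : ∀ x y, ‖x‖ = ‖y‖ → ξ x = ξ y)
    (hξ_zero : ξ 0 = 0)
    (hξ_cont : Continuous ξ)
    (hξ_int : SpatialPermutation.normC ξ < ∞)
    (hξ_fourier : ∀ k, 0 ≤ SpatialPermutation.weightFourier ξ k)
    (hξ_periodised : ∀ x,
      Tendsto (fun L : ℝ => SpatialPermutation.periodised ξ L x) atTop (𝓝 (ξ x : EReal)))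
    (ρ : ℝ) (hρ : 0 ≤ ρ)
    (hξ_one : d = 1 → SpatialPermutation.criticalDensity ξ < ENNReal.ofReal ρ →
      ∃ R : ℝ, ∀ x y, R ≤ ‖x‖ → ‖x‖ ≤ ‖y‖ → ξ x ≤ ξ y)
    (a b s : ℝ) (ha : 0 < a) (hab : a < b) (hb : b < 1) (hs : 0 ≤ s) :
    (∀ᶠ L : ℝ in atTop,
      0 < SpatialPermutation.partitionFunction ξ L ⌊ρ * L ^ d⌋₊ ∧
        SpatialPermutation.partitionFunction ξ L ⌊ρ * L ^ d⌋₊ < ∞) ∧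
    Tendsto
      (fun L : ℝ => SpatialPermutation.expectedCycleDensity ξ ρ L 1 ((L ^ d) ^ a))
      atTop (𝓝 (min (ENNReal.ofReal ρ) (SpatialPermutation.criticalDensity ξ))) ∧
    Tendsto
      (fun L : ℝ => SpatialPermutation.expectedCycleDensity ξ ρ L ((L ^ d) ^ a) ((L ^ d) ^ b))
      atTop (𝓝 0) ∧
    Tendsto
      (fun L : ℝ => SpatialPermutation.expectedCycleDensity ξ ρ L ((L ^ d) ^ b) (s * L ^ d))
      atTop (𝓝 (min (ENNReal.ofReal s)
        (ENNReal.ofReal ρ - SpatialPermutation.criticalDensity ξ))) := by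
  open SpatialPermutation in
  have h := isJumpWeight hξ_radial hξ_zero hξ_cont hξ_int hξ_fourier
  set g := realWeight ξ
  set G := realFourier ξ
  have hV : Tendsto (fun L : ℝ => L ^ d) atTop atTop := tendsto_pow_atTop (by omega)
  have hL0 : ∀ᶠ L : ℝ in atTop, 0 < L := eventually_gt_atTop 0
  have hw := tendsto_tsum_weight hξ_zero (hξ_periodised 0)
  have hw0 : ∀ (L : ℝ) (z : Fin d → ℤ), weight ξ (0 - latticeVec L z) =
      ENNReal.ofReal (g (latticeVec L z)) := fun L z => by
    rw [← ofReal_realWeight, zero_sub]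
    exact congrArg ENNReal.ofReal (h.even _)
  simp only [hw0] at hw
  have hsum : ∀ᶠ L in atTop, Summable fun z => g (latticeVec L z) := by
    filter_upwards [hw.eventually_lt_const ENNReal.one_lt_top] with L hL
    have := ENNReal.summable_toReal hL.ne
    simpa only [ENNReal.toReal_ofReal (h.nonneg _)] using this
  have hP : Tendsto (fun L => ∑' z, g (latticeVec L z)) atTop (𝓝 1) := by
    have h1 := (ENNReal.tendsto_toReal ENNReal.one_ne_top).comp hw
    rw [ENNReal.toReal_one] at h1
    refine h1.congr' (hsum.mono fun L hL => ?_)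
    rw [Function.comp, ← ENNReal.ofReal_tsum_of_nonneg (fun z => h.nonneg _) hL,
      ENNReal.toReal_ofReal (tsum_nonneg fun z => h.nonneg _)]
  have hgr : ∀ x y, ‖x‖ = ‖y‖ → g x = g y := fun x y hxy => by
    simp only [g, realWeight, weight, hξ_radial x y hxy]
  have hcd := criticalDensity_eq h hd
  have hgap : ∫⁻ k, ENNReal.ofReal (occupation G k) < ENNReal.ofReal ρ →
      ∃ δ > 0, ∃ A > 0, ∀ k k' : Space d, ‖k‖ ≤ δ → ‖k'‖ ≤ ‖k‖ →
        1 - modeWeight G k' ≤ A * (1 - modeWeight G k) := by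
    intro hc
    refine h.exists_gap_comparison hd hgr fun hd1 => ?_
    obtain ⟨R, hR⟩ := hξ_one hd1 (by rwa [hcd])
    refine ⟨R, fun x y hx hxy => ENNReal.toReal_mono (weight_ne_top ξ x) ?_⟩
    rw [weight, weight, EReal.exp_le_exp_iff, EReal.neg_le_neg_iff, EReal.coe_ennreal_le_coe_ennreal_iff]
    exact hR x y hx hxy
  set N : ℝ → ℕ := fun L => ⌊ρ * L ^ d⌋₊ with hNdef
  have hN : Tendsto (fun L : ℝ => (N L : ℝ) / L ^ d) atTop (𝓝 ρ) :=
    (tendsto_nat_floor_mul_div_atTop hρ).comp hV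
  have hM : Tendsto (fun L : ℝ => (⌊s * L ^ d⌋₊ : ℝ) / L ^ d) atTop (𝓝 s) :=
    (tendsto_nat_floor_mul_div_atTop hs).comp hV
  -- `κ = (ρ - ρ_c)₊` is the density of the points in macroscopic cycles
  set κ := (ENNReal.ofReal ρ - ∫⁻ k, ENNReal.ofReal (occupation G k)).toReal with hκ
  have hκ0 : 0 ≤ κ := ENNReal.toReal_nonneg
  have hκtop : ENNReal.ofReal ρ - ∫⁻ k, ENNReal.ofReal (occupation G k) ≠ ∞ :=
    (tsub_le_self.trans_lt ENNReal.ofReal_lt_top).ne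
  have hκeq : ENNReal.ofReal κ = ENNReal.ofReal ρ - criticalDensity ξ := by
    rw [hκ, ENNReal.ofReal_toReal hκtop, hcd]
  have hκρ : κ ≤ ρ := by
    have := ENNReal.toReal_mono ENNReal.ofReal_ne_top
      (tsub_le_self : ENNReal.ofReal ρ - ∫⁻ k, ENNReal.ofReal (occupation G k) ≤ _)
    rwa [ENNReal.toReal_ofReal hρ] at this
  -- the expected densities as sums over cycle lengths
  set w : ℝ → ℕ → ℝ := fun L j => modePowerSum G L (j + 1) *
    (homog (modePowerSum G L) (N L - 1 - j) / homog (modePowerSum G L) (N L)) with hwdef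
  have hexp : ∀ m n : ℝ → ℝ, (∀ᶠ L in atTop, 0 ≤ n L) →
      (fun L => expectedCycleDensity ξ ρ L (m L) (n L)) =ᶠ[atTop] fun L =>
        ENNReal.ofReal ((∑ j ∈ Finset.Ico (⌈m L⌉₊ - 1) (min ⌊n L⌋₊ (N L)), w L j) / L ^ d) := by
    intro m n hn
    filter_upwards [hsum, hL0, hn] with L h1 h2 h3
    rw [expectedCycleDensity, expectation_cycleDensity h h2 h1 _ (by positivity),
      filter_range_eq_Ico _ _ h3]
  have hlim := fun {m M : ℝ → ℕ} hm hmV {s : ℝ} hs0 hM => h.tendsto_sum_cycles hd hsum hP hρ hgap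
    (N := N) (m := m) (M := M) hN hm hmV (s := s) hs0 hM
  have hpow0 : ∀ c : ℝ, ∀ᶠ L : ℝ in atTop, 0 ≤ (L ^ d) ^ c :=
    fun c => hL0.mono fun L hL => by positivity
  refine ⟨?_, ?_, ?_, ?_⟩
  · filter_upwards [hsum, hL0] with L h1 h2
    rw [partitionFunction_eq h h2 h1]
    refine ⟨ENNReal.ofReal_pos.2 ?_, ENNReal.ofReal_lt_top⟩
    exact mul_pos (pow_pos h.fourier_zero_pos _) (homog_pos (h.one_le_modePowerSum h2 h1) _)
  · -- the density of short cycles is the total density minus that of cycles longer than `V^a`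
    have hfl : Tendsto (fun L : ℝ => ⌊(L ^ d) ^ a⌋₊) atTop atTop :=
      tendsto_nat_floor_atTop.comp ((tendsto_rpow_atTop ha).comp hV)
    have h1 := hN.sub (hlim hfl (tendsto_floor_rpow_div hV (hab.trans hb)) hρ hN)
    rw [min_eq_right hκρ] at h1
    have h2 : min (ENNReal.ofReal ρ) (criticalDensity ξ) = ENNReal.ofReal (ρ - κ) := by
      rw [ENNReal.ofReal_sub _ hκ0, hκeq]
      rcases le_total (ENNReal.ofReal ρ) (criticalDensity ξ) with hc | hc
      · rw [min_eq_left hc, tsub_eq_zero_of_le hc, tsub_zero]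
      · rw [min_eq_right hc, ENNReal.sub_sub_cancel ENNReal.ofReal_ne_top hc]
    rw [h2]
    refine (ENNReal.tendsto_ofReal h1).congr' ?_
    filter_upwards [hexp (fun _ => 1) (fun L => (L ^ d) ^ a) (hpow0 a), hsum, hL0] with L h3 h4 h5
    rw [h3, ← sub_div]
    congr 2
    have hne := (homog_pos (h.one_le_modePowerSum h5 h4) (N L)).ne'
    have htot : ∑ j ∈ Finset.range (N L), w L j = N L := by
      rw [← mul_div_cancel_right₀ (N L : ℝ) hne, ← homog_sum_rule, Finset.sum_div]
      exact Finset.sum_congr rfl fun j _ => by rw [hwdef, mul_div_assoc]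
    rw [min_self, Nat.ceil_one, Nat.sub_self, ← Finset.range_eq_Ico, ← htot, sub_eq_iff_eq_add]
    rcases le_total ⌊(L ^ d) ^ a⌋₊ (N L) with hle | hle
    · rw [min_eq_left hle, Finset.sum_range_add_sum_Ico _ hle]
    · rw [min_eq_right hle, Finset.Ico_eq_empty_of_le hle, Finset.sum_empty, add_zero]
  · have h1 := hlim (tendsto_ceil_sub_one_rpow hV ha)
      (tendsto_ceil_sub_one_rpow_div hV (hab.trans hb)) le_rfl (tendsto_floor_rpow_div hV hb)
    rw [min_eq_left hκ0] at h1
    rw [← ENNReal.ofReal_zero]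
    exact (ENNReal.tendsto_ofReal h1).congr' (hexp _ _ (hpow0 b)).symm
  · have h1 := hlim (tendsto_ceil_sub_one_rpow hV (ha.trans hab))
      (tendsto_ceil_sub_one_rpow_div hV hb) hs hM
    rw [← hκeq, ← ENNReal.ofReal_min]
    exact (ENNReal.tendsto_ofReal h1).congr'
      (hexp _ _ (hL0.mono fun L hL => by positivity)).symm
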